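/- Let $d\in\{1,2,3,\dots\}$. Use the Fourier transform $\mathcal F\varphi(k)=(2\pi)^{-d/2}\int_{\mathbb R^d}e^{-ik\cdot x}\varphi(x)\,dx$. Let $\Phi$ be the space of Schwartz functions $\phi:\mathbb R^d\to\mathbb C$ all of whose moments $\int x_{i_1}\cdots x_{i_m}\phi(x)\,dx$ ($m\ge 0$) vanish, and $\Phi'$ its dual. For $s\ge 0$, $D^s\phi:=\mathcal F^{-1}(|k|^s\mathcal F\phi)$ for $\phi\in\Phi$, and $\langle D^sf,\phi\rangle:=\langle f,D^s\phi\rangle$ for $f\in\Phi'$. Let $\mathbf L^p:=L^p(\mathbb R^d,\mathbb C)$ for $p<\infty$, and let $\mathbf L^\infty:=C_0(\mathbb R^d,\mathbb C)$ be the space of continuous functions vanishing at infinity, with the sup norm; these spaces are identified with subspaces of $\Phi'$ by $\langle f,\phi\rangle=\int f\phi$. **Proposition.** Let $j,n,\theta$ be real numbers with $$0<n<+\infty,\qquad 0\le j\le n,\qquad \frac jn\le\theta\le\frac jn+\frac d{2n}<1,$$ define $r\in[2,+\infty]$ by $\frac1r=\frac12-\frac{\theta n-j}{d}$, and let $0^0:=1$.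 The Sobolev inequality $$f\in \mathbf L^2,\ D^nf\in \mathbf L^2\ \Longrightarrow\ D^jf\in\mathbf L^r,\quad \|D^jf\|_{\mathbf L^r}\le S\sqrt{\|f\|_{\mathbf L^2}^2+\|D^nf\|_{\mathbf L^2}^2}$$ holds for some constant $S\in[0,+\infty)$ independent of $f$. Its sharp constant $S(j,n,\theta)$, i.e. the infimum of all such $S$, satisfies $$S(j,n,\theta)\ \ge\ S_{--}(j,n,\theta):=\frac{I(j,n,\theta)}{\pi^{d/4+1/2}}\sqrt{\Gamma(d/2)\,n\,\sin\Big(\pi\Big(\frac jn+\frac d{2n}\Big)\Big)\frac{(1-\theta)^{1-\theta}\theta^\theta}{\big(1-\frac jn-\frac d{2n}\big)^{1-\theta}\big(\frac jn+\frac d{2n}\big)^\theta}}\,,$$ where $$I(j,n,\theta):=\begin{cases}\dfrac{\pi}{2^{d/2}\Gamma(d/2)\,n\sin(\pi\theta)}&\text{if }\theta=\frac jn+\frac d{2n},\\[2mm]\Big(\dfrac{2\pi^{d/2}}{\Gamma(d/2)}\displaystyle\int_0^{+\infty}\rho^{d-1}|L_{jn}(\rho)|^r\,d\rho\Big)^{1/r}&\text{if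 }\theta\ne\frac jn+\frac d{2n},\end{cases}$$ and $L_{jn}:[0,+\infty)\to\mathbb R$ is defined in terms of the Bessel function $J_{d/2-1}$ by $$L_{jn}(\rho):=\int_0^{+\infty}\frac{J_{d/2-1}(\rho\xi)}{(\rho\xi)^{d/2-1}}\,\frac{\xi^{d+2j-1}}{1+\xi^{2n}}\,d\xi\quad(\rho>0),\qquad L_{jn}(0):=\frac{\pi}{2^{d/2}\Gamma(d/2)\,n\,\sin\big(\pi\frac{2j+d}{2n}\big)}.$$ The two integrals converge absolutely (the first one under the condition $\theta\neq \frac jn+\frac d{2n}$), and $L_{jn}$ is continuous on $[0,+\infty)$. Moreover, $L_{jn}$ has the following expressions by Fox $H$-functions and Meijer $G$-functions. For all $\rho\ge0$, $$L_{jn}(\rho)=\frac1{2^{d/2}n}\,H\left(\left.\begin{array}{l}(1-\frac{2j+d}{2n},\frac1n);\\(0,1),(1-\frac{2j+d}{2n},\frac1n);(1-\frac d2,1)\end{array}\right|\Big(\frac\rho2\Big)^2\right),$$ and, whenever $n=N/M$ with $N,M\in\{1,2,3,\dots\}$, $$L_{jn}(\rho)=\frac{M}{2^{d/2+M-1}\pi^{M-1}N^{d/2}}\,G\left(\left.\begin{array}{l}a_1,\dots,a_M;\\b_1,\dots,b_{N+M};b^*_1,\dots,b^*_N\end{array}\right|\Big(\frac\rho{2N}\Big)^{2N}\right),$$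 with $a_\ell=1-\frac{2j+d}{2N}-\frac{\ell-1}M$ and $b_{N+\ell}=-\frac{2j+d}{2N}+\frac \ell M$ ($1\le \ell\le M$), $b_h=\frac{h-1}N$ and $b^*_h=1-\frac d{2N}-\frac{h-1}N$ ($1\le h\le N$). Here, for $z>0$, $$H\left(\left.\begin{array}{l}(a_1,A_1),\dots,(a_p,A_p);\\(b_1,B_1),\dots,(b_m,B_m);(b^*_1,B^*_1),\dots,(b^*_q,B^*_q)\end{array}\right|z\right):=\frac1{2\pi i}\int_{\mathcal L}z^s\,\frac{\prod_\ell\Gamma(1-a_\ell+A_\ell s)\prod_\ell\Gamma(b_\ell-B_\ell s)}{\prod_\ell\Gamma(1-b^*_\ell+B^*_\ell s)}\,ds,$$ where $\mathcal L$ is any path from $c-i\infty$ to $c+i\infty$ for some $c\in\mathbb R$ (that is, with a $C^1$ parametrization $\gamma:\mathbb R\to\mathbb C$ such that $\gamma(t)=c+it+O(1/t)$, $\gamma'(t)=i+O(1/t)$ for $t\to\pm\infty$) which has the poles of all $\Gamma(1-a_\ell+A_\ell s)$ on its left and the poles of all $\Gamma(b_\ell-B_\ell s)$ on its right (the value does not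 depend on the choice of such a path); $G$ is the case where all $A_\ell,B_\ell,B^*_\ell$ equal $1$; the values at $z=0$ are the limits for $z\to0^+$. The equality $S(j,n,\theta)=S_{--}(j,n,\theta)$ holds in the following cases: (a) $\theta=0$, which implies $j=0$, $r=2$; then $S(j,n,\theta)=1$; (b) $\theta=\frac jn+\frac d{2n}$; then $$S(j,n,\theta)=\frac1{2^{d/2}\,\pi^{d/4-1/2}\sqrt{\Gamma(d/2)\,n\,\sin(\pi\theta)}}.$$ -/

import Mathlib

open Set Filter Topology MeasureTheory Asymptotics
open scoped SchwartzMap FourierTransform ENNReal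

/-! ## Lizorkin test functions, the fractional Laplacian, the Sobolev inequality -/

/-- The Lizorkin space `Φ` on `ℝ^d`: Schwartz functions all of whose moments vanish. -/
def lizorkin (d : ℕ) : Set 𝓢(EuclideanSpace ℝ (Fin d), ℂ) :=
  {φ | ∀ (m : ℕ) (i : Fin m → Fin d),
    ∫ x : EuclideanSpace ℝ (Fin d), (∏ l, ((x (i l) : ℝ) : ℂ)) * φ x = 0}

/-- `φ' = D^s φ = 𝓕⁻¹ (|k|^s 𝓕 φ)` for Lizorkin test functions. Mathlib's Fourier transform uses
the character `exp (- 2 π i x · ξ)`, so the wave vector `k` of the convention `exp (- i x · k)`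
is `k = 2 π ξ`. -/
def IsTestFracLaplacian {d : ℕ} (s : ℝ) (φ φ' : 𝓢(EuclideanSpace ℝ (Fin d), ℂ)) : Prop :=
  φ ∈ lizorkin d ∧ φ' ∈ lizorkin d ∧
    ∀ ξ : EuclideanSpace ℝ (Fin d),
      𝓕 φ' ξ = (((2 * Real.pi * ‖ξ‖) ^ s : ℝ) : ℂ) * 𝓕 φ ξ

/-- `g = D^s f` in `Φ'`, where `f` and `g` are functions, identified with linear forms on `Φ` by
integration: `⟨D^s f, φ⟩ = ⟨f, D^s φ⟩` for all `φ ∈ Φ`. -/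
def IsFracLaplacian {d : ℕ} (s : ℝ) (f g : EuclideanSpace ℝ (Fin d) → ℂ) : Prop :=
  ∀ φ φ' : 𝓢(EuclideanSpace ℝ (Fin d), ℂ), IsTestFracLaplacian s φ φ' →
    ∫ x, g x * φ x = ∫ x, f x * φ' x

/-- Membership in the space `𝐋^p`: this is `L^p` for `p < ∞`, and it is the space of continuous
functions vanishing at infinity for `p = ∞` (there, the functions of `L^∞` are represented by
their continuous version). The norm is that of `L^p` in all cases. -/
def MemBoldL {d : ℕ} (p : ℝ≥0∞) (f : EuclideanSpace ℝ (Fin d) → ℂ) : Prop :=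
  MemLp f p volume ∧
    (p = ∞ → Continuous f ∧ Tendsto f (cocompact (EuclideanSpace ℝ (Fin d))) (𝓝 0))

/-- The norm of `𝐋^p`, as a real number. -/
noncomputable def boldNorm {d : ℕ} (p : ℝ≥0∞) (f : EuclideanSpace ℝ (Fin d) → ℂ) : ℝ :=
  (eLpNorm f p volume).toReal

/-- The exponent `r ∈ [1, ∞]` with `1 / r = 1 / 2 - (θ n - j) / d`. -/
noncomputable def sobolevExponent (d : ℕ) (j n θ : ℝ) : ℝ≥0∞ :=
  (ENNReal.ofReal (1 / 2 - (θ * n - j) / d))⁻¹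

/-- The set of all constants `C ∈ [0, ∞)` for which the Sobolev inequality holds: every `f ∈ L²`
with `D^n f ∈ L²` has `D^j f ∈ 𝐋^r` and
`‖D^j f‖_{L^r} ≤ C √(‖f‖²_{L²} + ‖D^n f‖²_{L²})`. -/
def sobolevConstants (d : ℕ) (j n θ : ℝ) : Set ℝ :=
  {C | 0 ≤ C ∧ ∀ f Dnf : EuclideanSpace ℝ (Fin d) → ℂ,
    MemBoldL 2 f → MemBoldL 2 Dnf → IsFracLaplacian n f Dnf →
      ∃ Djf : EuclideanSpace ℝ (Fin d) → ℂ,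
        MemBoldL (sobolevExponent d j n θ) Djf ∧ IsFracLaplacian j f Djf ∧
        boldNorm (sobolevExponent d j n θ) Djf
          ≤ C * Real.sqrt (boldNorm 2 f ^ 2 + boldNorm 2 Dnf ^ 2)}

/-- The sharp constant `S(j,n,θ)` of the Sobolev inequality. -/
noncomputable def sharpSobolev (d : ℕ) (j n θ : ℝ) : ℝ :=
  sInf (sobolevConstants d j n θ)

/-! ## The Bessel function and the lower bound -/

/-- The Bessel function `J_ν (x)` of the first kind, for real order and `x > 0`. -/
noncomputable def besselJ (ν x : ℝ) : ℝ :=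
  ∑' m : ℕ, (-1) ^ m / ((m.factorial : ℝ) * Real.Gamma (m + ν + 1)) * (x / 2) ^ (2 * (m : ℝ) + ν)

/-- The function `L_{jn}` on `[0, ∞)`. -/
noncomputable def besselL (d : ℕ) (j n ρ : ℝ) : ℝ :=
  if ρ = 0 then
    Real.pi / ((2 : ℝ) ^ ((d : ℝ) / 2) * Real.Gamma ((d : ℝ) / 2) * n
      * Real.sin (Real.pi * ((2 * j + d) / (2 * n))))
  else
    ∫ ξ in Ioi (0 : ℝ),
      besselJ ((d : ℝ) / 2 - 1) (ρ * ξ) / (ρ * ξ) ^ ((d : ℝ) / 2 - 1)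
        * (ξ ^ ((d : ℝ) + 2 * j - 1) / (1 + ξ ^ (2 * n)))

/-- The quantity `I(j,n,θ)`. -/
noncomputable def sobolevI (d : ℕ) (j n θ : ℝ) : ℝ :=
  if θ = j / n + d / (2 * n) then
    Real.pi / ((2 : ℝ) ^ ((d : ℝ) / 2) * Real.Gamma ((d : ℝ) / 2) * n * Real.sin (Real.pi * θ))
  else
    (2 * Real.pi ^ ((d : ℝ) / 2) / Real.Gamma ((d : ℝ) / 2)
        * ∫ ρ in Ioi (0 : ℝ),
            ρ ^ ((d : ℝ) - 1) * |besselL d j n ρ| ^ (sobolevExponent d j n θ).toReal)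
      ^ (1 / (sobolevExponent d j n θ).toReal)

/-- The lower bound `S_{--}(j,n,θ)`; here `0 ^ 0 = 1`. -/
noncomputable def sobolevLower (d : ℕ) (j n θ : ℝ) : ℝ :=
  sobolevI d j n θ / Real.pi ^ ((d : ℝ) / 4 + 1 / 2)
    * Real.sqrt (Real.Gamma ((d : ℝ) / 2) * n * Real.sin (Real.pi * (j / n + d / (2 * n)))
        * (((1 - θ) ^ (1 - θ) * θ ^ θ)
          / ((1 - j / n - d / (2 * n)) ^ (1 - θ) * (j / n + d / (2 * n)) ^ θ)))

/-! ## The Fox `H`-function and the Meijer `G`-function of a real variable `z ≥ 0` -/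

/-- The parameters `(a_ℓ, A_ℓ)`, `(a*_ℓ, A*_ℓ)`, `(b_ℓ, B_ℓ)`, `(b*_ℓ, B*_ℓ)` of an `H`-function. -/
structure FoxParams where
  a : List (ℂ × ℝ)
  aStar : List (ℂ × ℝ)
  b : List (ℂ × ℝ)
  bStar : List (ℂ × ℝ)

namespace FoxParams

/-- The integrand of the Mellin-Barnes integral, for `z > 0` (with `z ^ s = exp (s log z)`). -/
noncomputable def integrand (P : FoxParams) (z : ℝ) (s : ℂ) : ℂ :=
  Complex.exp (s * (Real.log z : ℂ))
    * ((P.a.map fun p => Complex.Gamma (1 - p.1 + p.2 * s)).prod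
      * (P.b.map fun p => Complex.Gamma (p.1 - p.2 * s)).prod)
    / ((P.aStar.map fun p => Complex.Gamma (p.1 - p.2 * s)).prod
      * (P.bStar.map fun p => Complex.Gamma (1 - p.1 + p.2 * s)).prod)

/-- The poles of the functions `s ↦ Γ(1 - a_ℓ + A_ℓ s)`. -/
def leftPoles (P : FoxParams) : Set ℂ :=
  {σ | ∃ p ∈ P.a, ∃ k : ℕ, σ = (-1 + p.1 - k) / p.2}

/-- The poles of the functions `s ↦ Γ(b_ℓ - B_ℓ s)`. -/
def rightPoles (P : FoxParams) : Set ℂ :=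
  {σ | ∃ p ∈ P.b, ∃ k : ℕ, σ = (p.1 + k) / p.2}

/-- The number `α = ∑ A_ℓ - ∑ A*_ℓ + ∑ B_ℓ - ∑ B*_ℓ`. -/
noncomputable def alpha (P : FoxParams) : ℝ :=
  (P.a.map Prod.snd).sum - (P.aStar.map Prod.snd).sum
    + (P.b.map Prod.snd).sum - (P.bStar.map Prod.snd).sum

/-- The path `γ` avoids `σ`, and the total variation of the argument of `γ - σ` along `γ` is `δ`
(as a principal value at infinity). For a path going from `c - i ∞` to `c + i ∞`, the point `σ` is
on the left of `γ` if `δ = π`, and on the right if `δ = - π`. -/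
def ArgVariation (γ : ℝ → ℂ) (σ : ℂ) (δ : ℝ) : Prop :=
  (∀ t, γ t ≠ σ) ∧
    Tendsto (fun T : ℝ => ∫ t in (-T)..T, deriv γ t / (γ t - σ)) atTop (𝓝 (δ * Complex.I))

/-- `γ` is a path from `c - i ∞` to `c + i ∞` with the left poles on its left and the right poles
on its right. -/
structure IsBarnesPath (P : FoxParams) (γ : ℝ → ℂ) (c : ℝ) : Prop where
  contDiff : ContDiff ℝ 1 γ
  asymp : (fun t : ℝ => γ t - ((c : ℂ) + t * Complex.I)) =O[atBot ⊔ atTop] fun t : ℝ => t⁻¹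
  asymp_deriv : (fun t : ℝ => deriv γ t - Complex.I) =O[atBot ⊔ atTop] fun t : ℝ => t⁻¹
  left : ∀ σ ∈ P.leftPoles, ArgVariation γ σ Real.pi
  right : ∀ σ ∈ P.rightPoles, ArgVariation γ σ (-Real.pi)

/-- `w` is the value of the `H`-function at `z > 0`, that is, the value of its (absolutely
convergent) Mellin-Barnes integral. By Cauchy's theorem this value is the same for all paths which
separate the poles. -/
def IsValuePos (P : FoxParams) (z : ℝ) (w : ℂ) : Prop :=
  0 < z ∧ (∀ p ∈ P.a ++ P.aStar ++ P.b ++ P.bStar, 0 < p.2) ∧ 0 < P.alpha ∧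
    ∃ (γ : ℝ → ℂ) (c : ℝ), P.IsBarnesPath γ c ∧
      Integrable (fun t : ℝ => P.integrand z (γ t) * deriv γ t) ∧
      w = 1 / (2 * Real.pi * Complex.I) * ∫ t : ℝ, P.integrand z (γ t) * deriv γ t

/-- `w` is the value of the `H`-function at `z ≥ 0`; at `z = 0` it is defined as the limit for
`z → 0⁺`. -/
def IsValue (P : FoxParams) (z : ℝ) (w : ℂ) : Prop :=
  P.IsValuePos z w ∨
    (z = 0 ∧ ∃ h : ℝ → ℂ, (∀ y, 0 < y → P.IsValuePos y (h y)) ∧ Tendsto h (𝓝[>] 0) (𝓝 w))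

/-- The Meijer `G`-function: all the numbers `A_ℓ`, `A*_ℓ`, `B_ℓ`, `B*_ℓ` are `1`. -/
def meijer (a aStar b bStar : List ℂ) : FoxParams where
  a := a.map fun x => (x, 1)
  aStar := aStar.map fun x => (x, 1)
  b := b.map fun x => (x, 1)
  bStar := bStar.map fun x => (x, 1)

end FoxParams

/-- The parameters of the `H`-function which represents `L_{jn}`. -/
noncomputable def besselLFox (d : ℕ) (j n : ℝ) : FoxParams where
  a := [(((1 - (2 * j + d) / (2 * n) : ℝ) : ℂ), 1 / n)]
  aStar := []
  b := [(0, 1), (((1 - (2 * j + d) / (2 * n) : ℝ) : ℂ), 1 / n)]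
  bStar := [(((1 - (d : ℝ) / 2 : ℝ) : ℂ), 1)]

/-- The parameters of the `G`-function which represents `L_{jn}` for `n = N / M`. -/
noncomputable def besselLMeijer (d : ℕ) (j : ℝ) (N M : ℕ) : FoxParams :=
  FoxParams.meijer
    (List.ofFn fun l : Fin M => ((1 - (2 * j + d) / (2 * N) - (l : ℕ) / M : ℝ) : ℂ))
    []
    ((List.ofFn fun h : Fin N => (((h : ℕ) / N : ℝ) : ℂ)) ++
      List.ofFn fun h : Fin M => ((-((2 * j + d) / (2 * N)) + ((h : ℕ) + 1) / M : ℝ) : ℂ))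
    (List.ofFn fun l : Fin N => ((1 - d / (2 * N) - (l : ℕ) / N : ℝ) : ℂ))

/-! ### Plancherel theorem and inverse Fourier transform, tested against Schwartz functions. -/

section FourierLTwo

variable {E : Type*} [NormedAddCommGroup E] [InnerProductSpace ℝ E] [FiniteDimensional ℝ E]
  [MeasurableSpace E] [BorelSpace E]

/-! Write a = j/n + d/(2n) and W(k) = 1 + |k|^{2n}, with k the wave vector. By Plancherel, ‖f‖² +
‖D^n f‖² = ∫ W |f̂|², and D^j f has transform |k|^j f̂.

Upper bound. Since 0 ≤ j ≤ n, |k|^{2j} ≤ W, so ‖D^j f‖₂ is at most the square root of the energy.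
Since a < 1, |k|^{2j}/W is integrable, and Cauchy–Schwarz applied to (|k|^j/√W)·(√W |f̂|) makes
|k|^j f̂ integrable; hence D^j f is continuous, vanishes at infinity, and has an explicit sup bound.
Exponents between 2 and ∞ follow by interpolation. See `exists_fracLaplacian_of_le` and
`memBoldL_of_bounded`.

Lower bound. Equality in that Cauchy–Schwarz estimate, for the value at the origin, occurs for f̂ =
|k|^j/W. The dilates of this function by λ > 0 are the trial functions (`exists_trial`). The inverse
Fourier transform of a radial function is a Bessel integral, so D^j f is a multiple of L_{jn}(λ|x|);
‖f‖² and ‖D^n f‖² are beta integrals in the ratio (1 - a) : λ^{2n} a. The Sobolev inequality becomes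
λ^{θn} I ≤ C √(K(1 - a + λ^{2n} a)), and the best λ gives S_{--} (`sobolevLower_le_of_mem`). At θ =
a this meets the Cauchy–Schwarz constant; at θ = 0, where j = 0 and r = 2, the number I follows from
Plancherel and both bounds are 1.

The operator D^s is defined by duality with Lizorkin functions, which do not see polynomials. Two
facts connect it with the Fourier picture. Testing on functions whose transform vanishes near 0
shows that, in L², g = D^s f means ĝ = |k|^s f̂ (`ae_eq_of_isFracLaplacian`). And D^s f is unique in
𝐋^r, whose elements are too small at infinity to hide a nonzero polynomial
(`ae_eq_of_isFracLaplacian_of_memBoldL`); this is needed because a Sobolev constant only provides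
some representative of D^j f.

H- and G-functions. The Mellin transform of L_{jn} is a product of Gamma factors (`mellin_besselL`).
It is computed by writing a power of ρ as a superposition of Gaussians, which replaces the
oscillating Bessel integral by absolutely convergent ones. Mellin inversion on Re u = d/4 is, with s
= -u/2, the Mellin–Barnes integral of the H-function on Re s = -d/8. For n = N/M, the substitution s
→ N s and the multiplication theorem of Gauss turn it into a G-function. -/

theorem exists_fourierInv_memLp_two {h : E → ℂ} (hh : MemLp h 2) :
    ∃ g : E → ℂ, MemLp g 2 ∧ eLpNorm g 2 volume = eLpNorm h 2 volume ∧
      ∀ φ : 𝓢(E, ℂ), ∫ x, g x * φ x = ∫ x, h x * 𝓕⁻ φ x := by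
  refine ⟨(𝓕⁻ (hh.toLp h) : Lp (α := E) ℂ 2 volume), Lp.memLp _, ?_, fun φ => ?_⟩
  · have h1 : ‖(𝓕⁻ (hh.toLp h) : Lp (α := E) ℂ 2 volume)‖ =
      ‖(hh.toLp h : Lp (α := E) ℂ 2 volume)‖ :=
      (Lp.fourierTransformₗᵢ E ℂ).symm.norm_map _
    rw [Lp.norm_def, Lp.norm_def, ENNReal.toReal_eq_toReal_iff' (Lp.memLp _).2.ne
      (Lp.memLp _).2.ne] at h1
    rw [h1]
    exact eLpNorm_congr_ae hh.coeFn_toLp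
  · have h1 := DFunLike.congr_fun (Lp.fourierInv_toTemperedDistribution_eq (hh.toLp h)) φ
    rw [TemperedDistribution.fourierInv_apply, Lp.toTemperedDistribution_apply,
      Lp.toTemperedDistribution_apply] at h1
    simp only [smul_eq_mul, mul_comm (φ _)] at h1
    rw [← h1]
    refine integral_congr_ae ?_
    filter_upwards [hh.coeFn_toLp] with x hx
    rw [hx, mul_comm]

theorem exists_fourier_memLp_two {f : E → ℂ} (hf : MemLp f 2) :
    ∃ h : E → ℂ, MemLp h 2 ∧ eLpNorm h 2 volume = eLpNorm f 2 volume ∧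
      ∀ φ : 𝓢(E, ℂ), ∫ x, f x * φ x = ∫ x, h x * 𝓕⁻ φ x := by
  refine ⟨(𝓕 (hf.toLp f) : Lp (α := E) ℂ 2 volume), Lp.memLp _, ?_, fun φ => ?_⟩
  · have h1 : ‖(𝓕 (hf.toLp f) : Lp (α := E) ℂ 2 volume)‖ =
      ‖(hf.toLp f : Lp (α := E) ℂ 2 volume)‖ := Lp.norm_fourier_eq _
    rw [Lp.norm_def, Lp.norm_def, ENNReal.toReal_eq_toReal_iff' (Lp.memLp _).2.ne
      (Lp.memLp _).2.ne] at h1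
    rw [h1]
    exact eLpNorm_congr_ae hf.coeFn_toLp
  · have h1 := DFunLike.congr_fun (Lp.fourier_toTemperedDistribution_eq (hf.toLp f)) (𝓕⁻ φ)
    rw [TemperedDistribution.fourier_apply, Lp.toTemperedDistribution_apply,
      Lp.toTemperedDistribution_apply, FourierTransform.fourier_fourierInv_eq] at h1
    simp only [smul_eq_mul] at h1
    have h2 : ∫ x, f x * φ x = ∫ x, φ x * (hf.toLp f) x := by
      refine integral_congr_ae ?_
      filter_upwards [hf.coeFn_toLp] with x hx
      rw [hx, mul_comm]
    rw [h2, h1]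
    simp only [mul_comm]

/-- Real smooth compactly supported functions are Schwartz, so this is the fundamental lemma of the
calculus of variations. -/
theorem ae_eq_of_integral_mul_schwartz_eq {f g : E → ℂ} (hf : LocallyIntegrable f)
    (hg : LocallyIntegrable g)
    (h : ∀ φ : 𝓢(E, ℂ), HasCompactSupport φ → ∫ x, f x * φ x = ∫ x, g x * φ x) : f =ᵐ[volume] g := by
  refine ae_eq_of_integral_contDiff_smul_eq hf hg fun ψ hψ hψs => ?_
  have hc : ContDiff ℝ (⊤ : ℕ∞) fun x => (ψ x : ℂ) := Complex.ofRealCLM.contDiff.comp hψ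
  have hs : HasCompactSupport fun x => (ψ x : ℂ) := hψs.comp_left (g := Complex.ofReal) rfl
  simpa [mul_comm] using h (hs.toSchwartzMap hc) hs

theorem integral_fourierInv_mul_schwartz {h : E → ℂ} (hh : Integrable h) (φ : 𝓢(E, ℂ)) :
    ∫ x, 𝓕⁻ h x * φ x = ∫ x, h x * 𝓕⁻ φ x := by
  have := VectorFourier.integral_bilin_fourierIntegral_eq_flip (μ := volume) (ν := volume)
    (L := -innerₗ E) (e := Real.fourierChar) (f := h) (g := φ) (ContinuousLinearMap.mul ℂ ℂ)
    Real.continuous_fourierChar (by simp only [LinearMap.neg_apply, innerₗ_apply_apply]; fun_prop)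
    hh φ.integrable
  simp only [ContinuousLinearMap.mul_apply'] at this
  have e1 : ∀ u : E → ℂ, VectorFourier.fourierIntegral Real.fourierChar volume (-innerₗ E) u
      = 𝓕⁻ u := by
    intro u; ext x
    simp [VectorFourier.fourierIntegral, Real.fourierInv_eq]
  have e2 : ∀ u : E → ℂ, VectorFourier.fourierIntegral Real.fourierChar volume (-innerₗ E).flip u
      = 𝓕⁻ u := by
    intro u; ext x
    simp [VectorFourier.fourierIntegral, Real.fourierInv_eq, real_inner_comm]
  rw [e1, e2] at this
  rw [this]
  simp [SchwartzMap.fourierInv_coe]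

theorem continuous_fourierInv {h : E → ℂ} (h1 : Integrable h) : Continuous (𝓕⁻ h) := by
  have : 𝓕⁻ h = fun x => 𝓕 h (-x) := by
    ext x; exact Real.fourierInv_eq_fourier_neg h x
  rw [this]
  exact (VectorFourier.fourierIntegral_continuous Real.continuous_fourierChar
    (L := innerₗ E) (by simp only [innerₗ_apply_apply]; fun_prop) h1).comp continuous_neg

/-- The pointwise inverse transform and the L² one have the same pairing with every Schwartz
function, hence agree almost everywhere; the isometry then passes to the pointwise one. -/
theorem memLp_two_fourierInv {h : E → ℂ} (h1 : Integrable h) (h2 : MemLp h 2) :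
    MemLp (𝓕⁻ h) 2 ∧ eLpNorm (𝓕⁻ h) 2 volume = eLpNorm h 2 volume := by
  obtain ⟨g, hg, hgn, hgp⟩ := exists_fourierInv_memLp_two h2
  have hc : Continuous (𝓕⁻ h) := continuous_fourierInv h1
  have : g =ᵐ[volume] 𝓕⁻ h := by
    refine ae_eq_of_integral_mul_schwartz_eq (hg.locallyIntegrable (by norm_num))
      hc.locallyIntegrable fun φ _ => ?_
    rw [hgp, integral_fourierInv_mul_schwartz h1]
  exact ⟨hg.ae_eq this, by rw [← hgn, eLpNorm_congr_ae this]⟩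

/-- Riemann–Lebesgue. Integrability is not required because the integral of a non-integrable
function is 0 by convention. -/
theorem tendsto_fourierInv_cocompact (h : E → ℂ) :
    Tendsto (𝓕⁻ h) (cocompact E) (𝓝 0) := by
  have : 𝓕⁻ h = fun x => 𝓕 h (-x) := by
    ext x; exact Real.fourierInv_eq_fourier_neg h x
  rw [this]
  exact (tendsto_integral_exp_inner_smul_cocompact h).comp
    (Homeomorph.neg E).isClosedEmbedding.tendsto_cocompact

theorem norm_fourierInv_le {h : E → ℂ} (x : E) : ‖𝓕⁻ h x‖ ≤ ∫ k, ‖h k‖ := by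
  rw [Real.fourierInv_eq_fourier_neg]
  exact VectorFourier.norm_fourierIntegral_le_integral_norm _ _ _ _ _

end FourierLTwo

/-! ### A cutoff near the origin that makes |k|^s a smooth multiplier of temperate growth. -/

section HighPass

variable {E : Type*} [NormedAddCommGroup E] [InnerProductSpace ℝ E]

/-- A smooth radial cutoff which vanishes near the origin and is `1` away from it. -/
noncomputable def highPass (ε : ℝ) (k : E) : ℝ :=
  Real.smoothTransition (2 - 3 * (1 + ‖ε⁻¹ • k‖ ^ 2)⁻¹)

theorem highPass_nonneg (ε : ℝ) (k : E) : 0 ≤ highPass ε k := Real.smoothTransition.nonneg _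

theorem highPass_le_one (ε : ℝ) (k : E) : highPass ε k ≤ 1 := Real.smoothTransition.le_one _

theorem highPass_neg (ε : ℝ) (k : E) : highPass ε (-k) = highPass ε k := by
  simp [highPass]

theorem highPass_eq_zero {ε : ℝ} {k : E} (h : ‖ε⁻¹ • k‖ ^ 2 ≤ 1 / 2) : highPass ε k = 0 := by
  apply Real.smoothTransition.zero_of_nonpos
  have : (2 / 3 : ℝ) ≤ (1 + ‖ε⁻¹ • k‖ ^ 2)⁻¹ := by
    rw [le_inv_comm₀ (by norm_num) (by positivity)]; linarith
  linarith

theorem highPass_eq_one {ε : ℝ} {k : E} (h : 2 ≤ ‖ε⁻¹ • k‖ ^ 2) : highPass ε k = 1 := by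
  apply Real.smoothTransition.one_of_one_le
  have : (1 + ‖ε⁻¹ • k‖ ^ 2)⁻¹ ≤ (1 / 3 : ℝ) := by
    rw [inv_le_comm₀ (by positivity) (by norm_num)]; linarith
  linarith

theorem highPass_eventually_eq_zero {ε : ℝ} : ∀ᶠ k : E in 𝓝 0, highPass ε k = 0 := by
  have : Tendsto (fun k : E => ‖ε⁻¹ • k‖ ^ 2) (𝓝 0) (𝓝 0) := by
    have : Continuous fun k : E => ‖ε⁻¹ • k‖ ^ 2 := by fun_prop
    simpa using this.tendsto 0
  filter_upwards [this.eventually (gt_mem_nhds (show (0 : ℝ) < 1 / 2 by norm_num))] with k hk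
  exact highPass_eq_zero hk.le

theorem continuous_highPass (ε : ℝ) : Continuous (highPass ε : E → ℝ) := by
  refine Real.smoothTransition.continuous.comp ?_
  have : ∀ k : E, 1 + ‖ε⁻¹ • k‖ ^ 2 ≠ 0 := fun k => by positivity
  fun_prop (disch := exact this _)

theorem highPass_pos_eq_one_of_ne_zero {k : E} (hk : k ≠ 0) :
    ∀ᶠ ε : ℝ in 𝓝[>] 0, highPass ε k = 1 := by
  have hk' : 0 < ‖k‖ := norm_pos_iff.2 hk
  filter_upwards [Ioo_mem_nhdsGT (show 0 < ‖k‖ / 2 by positivity)] with ε hε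
  apply highPass_eq_one
  have h2 : 2 ≤ ‖ε⁻¹ • k‖ := by
    rw [norm_smul, norm_inv, Real.norm_of_nonneg hε.1.le, inv_mul_eq_div, le_div_iff₀ hε.1]
    linarith [hε.2]
  nlinarith

/-- The power is singular only at u = 1, and the first cutoff already vanishes for u ≥ 2/3. The
second cutoff equals 1 for u ≥ -1 and serves only to make the support compact. -/
theorem contDiff_one_sub_rpow_mul_cutoff (s : ℝ) : ContDiff ℝ (⊤ : ℕ∞) fun u : ℝ =>
    (1 - u) ^ s * Real.smoothTransition (2 - 3 * u) * Real.smoothTransition (u + 2) := by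
  rw [contDiff_iff_contDiffAt]
  intro u
  have h1 : ContDiff ℝ (⊤ : ℕ∞) fun u : ℝ => Real.smoothTransition (2 - 3 * u) :=
    Real.smoothTransition.contDiff.comp (by fun_prop)
  have h2 : ContDiff ℝ (⊤ : ℕ∞) fun u : ℝ => Real.smoothTransition (u + 2) :=
    Real.smoothTransition.contDiff.comp (by fun_prop)
  rcases lt_or_ge u 1 with hu | hu
  · refine ContDiffAt.mul (ContDiffAt.mul ?_ h1.contDiffAt) h2.contDiffAt
    exact ContDiffAt.rpow_const_of_ne (by fun_prop) (by linarith)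
  · have : (fun u : ℝ => (1 - u) ^ s * Real.smoothTransition (2 - 3 * u)
        * Real.smoothTransition (u + 2)) =ᶠ[𝓝 u] fun _ => 0 := by
      filter_upwards [lt_mem_nhds (show (2 / 3 : ℝ) < u by linarith)] with v hv
      rw [Real.smoothTransition.zero_of_nonpos (x := 2 - 3 * v) (by linarith)]
      simp
    exact contDiffAt_const.congr_of_eventuallyEq this

/-- With u = 1/(1 + |x|²) one has |x|^s = (1 + |x|²)^{s/2} (1 - u)^{s/2}, and the cutoff is a
function of u. The product is therefore a power of 1 + |x|² times a smooth compactly supported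
function of u. -/
theorem hasTemperateGrowth_highPass_mul_norm_rpow (ε s : ℝ) :
    (fun k : E => highPass ε k * ‖ε⁻¹ • k‖ ^ s).HasTemperateGrowth := by
  have hq : (fun u : ℝ => (1 - u) ^ (s / 2) * Real.smoothTransition (2 - 3 * u) *
      Real.smoothTransition (u + 2)).HasTemperateGrowth := by
    refine HasCompactSupport.hasTemperateGrowth ?_ (contDiff_one_sub_rpow_mul_cutoff _)
    refine HasCompactSupport.intro (K := Icc (-2) 1) isCompact_Icc fun u hu => ?_
    rw [mem_Icc, not_and_or, not_le, not_le] at hu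
    rcases hu with hu | hu
    · rw [Real.smoothTransition.zero_of_nonpos (x := u + 2) (by linarith)]; simp
    · rw [Real.smoothTransition.zero_of_nonpos (x := 2 - 3 * u) (by linarith)]; simp
  have h1 : (fun k : E => (1 + ‖k‖ ^ 2) ^ (s / 2) *
      ((1 - (1 + ‖k‖ ^ 2) ^ (-1 : ℝ)) ^ (s / 2) *
        Real.smoothTransition (2 - 3 * (1 + ‖k‖ ^ 2) ^ (-1 : ℝ)) *
        Real.smoothTransition ((1 + ‖k‖ ^ 2) ^ (-1 : ℝ) + 2))).HasTemperateGrowth :=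
    (Function.hasTemperateGrowth_one_add_norm_sq_rpow E (s / 2)).mul
      (hq.comp (Function.hasTemperateGrowth_one_add_norm_sq_rpow E (-1)))
  have h2 := h1.comp (ε⁻¹ • ContinuousLinearMap.id ℝ E).hasTemperateGrowth
  convert h2 using 1
  ext k
  simp only [Function.comp_apply, smul_apply, ContinuousLinearMap.id_apply,
    Real.rpow_neg_one, highPass]
  set x : E := ε⁻¹ • k
  have hx : 0 < 1 + ‖x‖ ^ 2 := by positivity
  rw [Real.smoothTransition.one_of_one_le (x := _ + 2) (by have := inv_pos.2 hx; linarith), mul_one,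
    ← mul_assoc, ← Real.mul_rpow hx.le]
  · have : (1 + ‖x‖ ^ 2) * (1 - (1 + ‖x‖ ^ 2)⁻¹) = ‖x‖ ^ 2 := by field_simp; ring
    rw [this, ← Real.rpow_natCast, ← Real.rpow_mul (norm_nonneg _), mul_comm]
    congr 2
    push_cast; ring
  · rw [sub_nonneg]
    exact inv_le_one_of_one_le₀ (by nlinarith [norm_nonneg x])

theorem hasTemperateGrowth_highPass (ε : ℝ) :
    (fun k : E => (highPass ε k : ℂ)).HasTemperateGrowth := by
  have := hasTemperateGrowth_highPass_mul_norm_rpow (E := E) ε 0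
  simp only [Real.rpow_zero, mul_one] at this
  exact Function.Complex.hasTemperateGrowth_ofReal.comp this

theorem hasTemperateGrowth_symbol_mul_highPass {ε : ℝ} (hε : 0 < ε) (s : ℝ) :
    (fun k : E => (((2 * Real.pi * ‖k‖) ^ s * highPass ε k : ℝ) : ℂ)).HasTemperateGrowth := by
  refine Function.Complex.hasTemperateGrowth_ofReal.comp ?_
  have h : (fun k : E => (2 * Real.pi * ‖k‖) ^ s * highPass ε k) =
      (fun _ : E => (2 * Real.pi * ε) ^ s) * fun k : E => highPass ε k * ‖ε⁻¹ • k‖ ^ s := by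
    ext k
    simp only [Pi.mul_apply]
    rw [mul_left_comm, mul_comm, ← Real.mul_rpow (by positivity) (by positivity), norm_smul,
      norm_inv, Real.norm_of_nonneg hε.le]
    congr 2
    field_simp
  change Function.HasTemperateGrowth (fun k : E => (2 * Real.pi * ‖k‖) ^ s * highPass ε k)
  rw [h]
  exact (Function.HasTemperateGrowth.const (E := E) ((2 * Real.pi * ε) ^ s)).mul
    (hasTemperateGrowth_highPass_mul_norm_rpow (E := E) ε s)

end HighPass

/-! ### Construction of Lizorkin test functions. -/

section Lizorkin

variable {d : ℕ}

/-- Moments are, up to constants, derivatives of the Fourier transform at 0. The induction absorbs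
one coordinate into the function: multiplying by a coordinate differentiates the transform, which
still vanishes near 0. -/
theorem mem_lizorkin_of_fourier_eventually_zero {φ : 𝓢(EuclideanSpace ℝ (Fin d), ℂ)}
    (h : ∀ᶠ k in 𝓝 0, 𝓕 φ k = 0) : φ ∈ lizorkin d := by
  intro m
  induction m generalizing φ with
  | zero =>
    intro i
    have h0 := h.self_of_nhds
    rw [SchwartzMap.fourier_coe, Real.fourier_eq] at h0
    simpa using h0
  | succ m ih =>
    intro i
    set e : EuclideanSpace ℝ (Fin d) := EuclideanSpace.single (i 0) 1
    have ht : (fun x : EuclideanSpace ℝ (Fin d) => (inner ℝ x e : ℝ)).HasTemperateGrowth :=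
      Function.hasTemperateGrowth_inner_left e
    have h1 := SchwartzMap.lineDerivOp_fourier_eq φ e
    rw [FourierTransform.fourier_smul] at h1
    have h2 : ∀ᶠ k in 𝓝 0, 𝓕 (SchwartzMap.smulLeftCLM ℂ (fun x => inner ℝ x e) φ) k = 0 := by
      filter_upwards [h.eventually_nhds] with k hk
      have h3 := DFunLike.congr_fun h1 k
      rw [smul_apply, SchwartzMap.lineDerivOp_apply_eq_fderiv] at h3
      have h4 : ((𝓕 φ : 𝓢(EuclideanSpace ℝ (Fin d), ℂ)) : EuclideanSpace ℝ (Fin d) → ℂ) =ᶠ[𝓝 k] fun _ => 0 := hk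
      rw [h4.fderiv_eq, fderiv_const_apply] at h3
      simpa [Real.pi_ne_zero] using h3.symm
    have h3 := ih h2 (fun l => i l.succ)
    rw [← h3]
    refine integral_congr_ae (Eventually.of_forall fun x => ?_)
    simp only [Fin.prod_univ_succ]
    rw [SchwartzMap.smulLeftCLM_apply_apply ht]
    have : (inner ℝ x e : ℝ) = x (i 0) := by simp [e, EuclideanSpace.inner_single_right]
    rw [this, Complex.real_smul]
    ring

/-- The Schwartz function `highPass ε * ζ`. -/
noncomputable def highPassSchwartz (ε : ℝ) (ζ : 𝓢(EuclideanSpace ℝ (Fin d), ℂ)) :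
    𝓢(EuclideanSpace ℝ (Fin d), ℂ) :=
  SchwartzMap.smulLeftCLM ℂ (fun k => (highPass ε k : ℂ)) ζ

theorem highPassSchwartz_apply (ε : ℝ) (ζ : 𝓢(EuclideanSpace ℝ (Fin d), ℂ))
    (k : EuclideanSpace ℝ (Fin d)) : highPassSchwartz ε ζ k = highPass ε k * ζ k := by
  rw [highPassSchwartz, SchwartzMap.smulLeftCLM_apply_apply (hasTemperateGrowth_highPass ε),
    smul_eq_mul]

theorem SchwartzMap.fourier_fourier_apply (ζ : 𝓢(EuclideanSpace ℝ (Fin d), ℂ))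
    (k : EuclideanSpace ℝ (Fin d)) : 𝓕 (𝓕 ζ) k = ζ (-k) := by
  have h1 : 𝓕⁻ (𝓕 ζ) (-k) = ζ (-k) := by rw [FourierTransform.fourierInv_fourier_eq]
  rw [← h1, SchwartzMap.fourierInv_apply_eq]
  simp

/-- The Fourier transform of 𝓕(highPass · ζ) is the reflection of highPass · ζ, which vanishes near
0. Every Schwartz ζ thus yields a test function, and the symbol acts on it as a multiplier. -/
theorem exists_isTestFracLaplacian {ε : ℝ} (hε : 0 < ε) (s : ℝ)
    (ζ : 𝓢(EuclideanSpace ℝ (Fin d), ℂ)) :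
    ∃ ζ' : 𝓢(EuclideanSpace ℝ (Fin d), ℂ),
      (∀ k, ζ' k = (((2 * Real.pi * ‖k‖) ^ s * highPass ε k : ℝ) : ℂ) * ζ k) ∧
      IsTestFracLaplacian s (𝓕 (highPassSchwartz ε ζ)) (𝓕 ζ') := by
  have ht := hasTemperateGrowth_symbol_mul_highPass (E := EuclideanSpace ℝ (Fin d)) hε s
  have hz := highPass_eventually_eq_zero (E := EuclideanSpace ℝ (Fin d)) (ε := ε)
  refine ⟨SchwartzMap.smulLeftCLM ℂ
    (fun k => (((2 * Real.pi * ‖k‖) ^ s * highPass ε k : ℝ) : ℂ)) ζ, fun k => ?_, ?_, ?_, ?_⟩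
  · rw [SchwartzMap.smulLeftCLM_apply_apply ht, smul_eq_mul]
  · apply mem_lizorkin_of_fourier_eventually_zero
    filter_upwards [hz] with k hk
    rw [SchwartzMap.fourier_fourier_apply, highPassSchwartz_apply, highPass_neg, hk]
    simp
  · apply mem_lizorkin_of_fourier_eventually_zero
    filter_upwards [hz] with k hk
    rw [SchwartzMap.fourier_fourier_apply, SchwartzMap.smulLeftCLM_apply_apply ht, highPass_neg, hk]
    simp
  · intro ξ
    have e1 := SchwartzMap.fourier_fourier_apply (SchwartzMap.smulLeftCLM ℂ
      (fun k => (((2 * Real.pi * ‖k‖) ^ s * highPass ε k : ℝ) : ℂ)) ζ) ξ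
    have e2 := SchwartzMap.fourier_fourier_apply (highPassSchwartz ε ζ) ξ
    rw [e1, e2, SchwartzMap.smulLeftCLM_apply_apply ht, highPassSchwartz_apply, highPass_neg,
      norm_neg, smul_eq_mul]
    push_cast
    ring

end Lizorkin

/-! ### The fractional Laplacian as a Fourier multiplier, and its uniqueness. -/

section FracLaplacian

variable {d : ℕ}

/-- The test functions above prove the identity multiplied by the cutoff at scale ε. As ε → 0 the
cutoff is eventually 1 at every k ≠ 0, and the origin is a null set since d ≥ 1. -/
theorem ae_eq_of_isFracLaplacian {s : ℝ} (hs : 0 ≤ s) {f g fh gh : EuclideanSpace ℝ (Fin d) → ℂ}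
    (hd : 1 ≤ d) (hfl : LocallyIntegrable fh) (hgl : LocallyIntegrable gh)
    (hf : ∀ φ : 𝓢(EuclideanSpace ℝ (Fin d), ℂ), ∫ x, f x * φ x = ∫ x, fh x * 𝓕⁻ φ x)
    (hg : ∀ φ : 𝓢(EuclideanSpace ℝ (Fin d), ℂ), ∫ x, g x * φ x = ∫ x, gh x * 𝓕⁻ φ x)
    (h : IsFracLaplacian s f g) :
    gh =ᵐ[volume] fun k => (((2 * Real.pi * ‖k‖) ^ s : ℝ) : ℂ) * fh k := by
  have key : ∀ ε : ℝ, 0 < ε → (fun k => (highPass ε k : ℂ) * gh k) =ᵐ[volume]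
      fun k => (((2 * Real.pi * ‖k‖) ^ s * highPass ε k : ℝ) : ℂ) * fh k := by
    intro ε hε
    have c1 : Continuous fun k : EuclideanSpace ℝ (Fin d) => (highPass ε k : ℂ) :=
      Complex.continuous_ofReal.comp (continuous_highPass ε)
    have c2 : Continuous fun k : EuclideanSpace ℝ (Fin d) =>
        (((2 * Real.pi * ‖k‖) ^ s * highPass ε k : ℝ) : ℂ) :=
      Complex.continuous_ofReal.comp
        (((continuous_const.mul continuous_norm).rpow_const (fun _ => Or.inr hs)).mul
          (continuous_highPass ε))
    refine ae_eq_of_integral_mul_schwartz_eq (hgl.continuous_mul c1) (hfl.continuous_mul c2)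
      fun ζ _ => ?_
    obtain ⟨ζ', hζ', ht⟩ := exists_isTestFracLaplacian hε s ζ
    have := h _ _ ht
    rw [hf, hg, FourierTransform.fourierInv_fourier_eq, FourierTransform.fourierInv_fourier_eq]
      at this
    convert this using 2
    · ext k; rw [highPassSchwartz_apply]; ring
    · ext k; rw [hζ']; ring
  -- A countable family of scales, so that a single null set serves them all.
  have key' : ∀ᵐ k : EuclideanSpace ℝ (Fin d), ∀ m : ℕ, (highPass (1 / ((m : ℝ) + 1)) k : ℂ) * gh k =
      (((2 * Real.pi * ‖k‖) ^ s * highPass (1 / ((m : ℝ) + 1)) k : ℝ) : ℂ) * fh k :=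
    ae_all_iff.2 fun m => key _ (by positivity)
  have : Nonempty (Fin d) := ⟨⟨0, hd⟩⟩
  have hne : ∀ᵐ k : EuclideanSpace ℝ (Fin d), k ≠ 0 := by
    simp [ae_iff]
  filter_upwards [key', hne] with k hk hk0
  have hm : Tendsto (fun m : ℕ => 1 / ((m : ℝ) + 1)) atTop (𝓝[>] 0) :=
    tendsto_nhdsWithin_iff.2 ⟨tendsto_one_div_add_atTop_nhds_zero_nat,
      Eventually.of_forall fun m => by simp only [mem_Ioi]; positivity⟩
  obtain ⟨m, hm⟩ := (hm.eventually (highPass_pos_eq_one_of_ne_zero hk0)).exists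
  have := hk m
  rw [hm] at this
  simpa using this

theorem isFracLaplacian_of_ae_eq {s : ℝ} {f g fh gh : EuclideanSpace ℝ (Fin d) → ℂ}
    (hf : ∀ φ : 𝓢(EuclideanSpace ℝ (Fin d), ℂ), ∫ x, f x * φ x = ∫ x, fh x * 𝓕⁻ φ x)
    (hg : ∀ φ : 𝓢(EuclideanSpace ℝ (Fin d), ℂ), ∫ x, g x * φ x = ∫ x, gh x * 𝓕⁻ φ x)
    (h : gh =ᵐ[volume] fun k => (((2 * Real.pi * ‖k‖) ^ s : ℝ) : ℂ) * fh k) :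
    IsFracLaplacian s f g := by
  intro φ φ' ht
  rw [hf, hg]
  refine integral_congr_ae ?_
  filter_upwards [h] with k hk
  have e1 : ∀ ψ : 𝓢(EuclideanSpace ℝ (Fin d), ℂ), 𝓕⁻ ψ k = 𝓕 ψ (-k) := fun ψ => by
    rw [SchwartzMap.fourierInv_apply_eq]; rfl
  have := ht.2.2 (-k)
  rw [norm_neg] at this
  rw [hk, e1, e1, this]
  ring

/-- The complementary cutoff `1 - highPass 1`, as a Schwartz function. -/
noncomputable def lowPassSchwartz (d : ℕ) : 𝓢(EuclideanSpace ℝ (Fin d), ℂ) :=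
  HasCompactSupport.toSchwartzMap (f := fun k => 1 - (highPass 1 k : ℂ))
    (HasCompactSupport.intro (isCompact_closedBall (0 : EuclideanSpace ℝ (Fin d)) 2) fun k hk => by
      rw [Metric.mem_closedBall, dist_zero_right, not_le] at hk
      rw [highPass_eq_one (by rw [inv_one, one_smul]; nlinarith)]
      simp)
    (contDiff_const.sub (hasTemperateGrowth_highPass 1).1)

theorem lowPassSchwartz_apply (k : EuclideanSpace ℝ (Fin d)) :
    lowPassSchwartz d k = 1 - (highPass 1 k : ℂ) := rfl

/-- Dilating a function dilates its Fourier transform with the Jacobian that preserves the L¹ norm;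
this is the source of bounds uniform in ε. -/
theorem integral_norm_fourier_comp_smul {ε : ℝ} (hε : 0 < ε)
    (f : EuclideanSpace ℝ (Fin d) → ℂ) :
    ∫ x, ‖𝓕 (fun k => f (ε⁻¹ • k)) x‖ = ∫ x, ‖𝓕 f x‖ := by
  have h1 : ∀ x, 𝓕 (fun k => f (ε⁻¹ • k)) x = (ε ^ d : ℝ) • 𝓕 f (ε • x) := by
    intro x
    rw [Real.fourier_eq, Real.fourier_eq]
    have := Measure.integral_comp_inv_smul_of_nonneg (volume : Measure (EuclideanSpace ℝ (Fin d)))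
      (fun v => Real.fourierChar (-(inner ℝ v (ε • x))) • f v) hε.le
    simp only [finrank_euclideanSpace, Fintype.card_fin] at this
    rw [← this]
    refine integral_congr_ae (Eventually.of_forall fun v => ?_)
    simp only [inner_smul_left, inner_smul_right]
    congr 3
    simp only [conj_trivial]
    field_simp
  simp_rw [h1, norm_smul]
  rw [integral_const_mul, Measure.integral_comp_smul volume (fun x => ‖𝓕 f x‖) ε]
  simp only [finrank_euclideanSpace, Fintype.card_fin, smul_eq_mul, ← mul_assoc]
  rw [abs_of_pos (by positivity), Real.norm_of_nonneg (by positivity), mul_inv_cancel₀ (by positivity),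
    one_mul]

/-- The transform of the low-frequency part is the convolution of 𝓕 ζ with a dilate of
𝓕(`lowPassSchwartz d`), so Young's inequality in L¹ gives a bound in which ε does not appear. -/
theorem integral_norm_fourier_sub_highPassSchwartz_le {ε : ℝ} (hε : 0 < ε)
    (ζ : 𝓢(EuclideanSpace ℝ (Fin d), ℂ)) :
    ∫ x, ‖𝓕 (ζ - highPassSchwartz ε ζ) x‖ ≤
      (∫ x, ‖𝓕 (lowPassSchwartz d) x‖) * ∫ x, ‖𝓕 ζ x‖ := by
  set χ : 𝓢(EuclideanSpace ℝ (Fin d), ℂ) := SchwartzMap.compCLMOfContinuousLinearEquiv ℂ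
    (ContinuousLinearEquiv.smulLeft (M₁ := EuclideanSpace ℝ (Fin d)) (R₁ := ℝ)
      (Units.mk0 ε⁻¹ (inv_ne_zero hε.ne'))) (lowPassSchwartz d) with hχ
  have hχa : ∀ k, χ k = lowPassSchwartz d (ε⁻¹ • k) := fun k => rfl
  have h1 : SchwartzMap.convolution (ContinuousLinearMap.mul ℂ ℂ) (𝓕 χ) (𝓕 ζ) =
      𝓕 (ζ - highPassSchwartz ε ζ) := by
    -- The convolution identity is checked after one more Fourier transform, where convolution
    -- becomes a product and a double transform is a reflection.
    apply (FourierTransform.fourierEquiv ℂ 𝓢(EuclideanSpace ℝ (Fin d), ℂ)).injective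
    change 𝓕 (SchwartzMap.convolution (ContinuousLinearMap.mul ℂ ℂ) (𝓕 χ) (𝓕 ζ)) =
      𝓕 (𝓕 (ζ - highPassSchwartz ε ζ))
    rw [SchwartzMap.fourier_convolution]
    ext k
    rw [SchwartzMap.pairing_apply_apply, SchwartzMap.fourier_fourier_apply,
      SchwartzMap.fourier_fourier_apply, SchwartzMap.fourier_fourier_apply, hχa,
      lowPassSchwartz_apply, sub_apply, highPassSchwartz_apply]
    have : highPass 1 (ε⁻¹ • -k) = highPass ε (-k) := by simp [highPass]
    rw [this, ContinuousLinearMap.mul_apply']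
    ring
  have h2 : ∫ x, ‖𝓕 χ x‖ = ∫ x, ‖𝓕 (lowPassSchwartz d) x‖ := by
    rw [SchwartzMap.fourier_coe, SchwartzMap.fourier_coe]
    exact integral_norm_fourier_comp_smul hε (lowPassSchwartz d : EuclideanSpace ℝ (Fin d) → ℂ)
  rw [← h1, ← h2]
  have h3 := integral_convolution (ContinuousLinearMap.mul ℝ ℝ) (𝓕 χ).integrable.norm
    (𝓕 ζ).integrable.norm (μ := volume) (ν := volume)
  rw [ContinuousLinearMap.mul_apply'] at h3
  rw [← h3]
  refine integral_mono (SchwartzMap.integrable _).norm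
    ((𝓕 χ).integrable.norm.integrable_convolution _ (𝓕 ζ).integrable.norm) fun x => ?_
  rw [SchwartzMap.convolution_apply, convolution_def, convolution_def]
  refine (norm_integral_le_integral_norm _).trans (le_of_eq ?_)
  simp

/-- A functional killed by these test functions only sees the low frequencies of ζ, at any scale ε.
The L² part of g pairs with them to 0 as ε → 0, and the part bounded by δ contributes at most δ C
with C independent of ε. The splitting hypothesis for every δ is what excludes nonzero constants and
other polynomials. -/
theorem ae_eq_zero_of_forall_isTestFracLaplacian (hd : 1 ≤ d) {s : ℝ}
    {g : EuclideanSpace ℝ (Fin d) → ℂ} (hg : LocallyIntegrable g)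
    (hdec : ∀ δ : ℝ, 0 < δ → ∃ g₁ g₂ : EuclideanSpace ℝ (Fin d) → ℂ, MemLp g₁ 2 ∧
      AEStronglyMeasurable g₂ ∧ (∀ᵐ x, ‖g₂ x‖ ≤ δ) ∧ g =ᵐ[volume] g₁ + g₂)
    (h : ∀ φ φ' : 𝓢(EuclideanSpace ℝ (Fin d), ℂ), IsTestFracLaplacian s φ φ' →
      ∫ x, g x * φ x = 0) : g =ᵐ[volume] 0 := by
  have : Nonempty (Fin d) := ⟨⟨0, hd⟩⟩
  have hne : ∀ᵐ k : EuclideanSpace ℝ (Fin d), k ≠ 0 := by simp [ae_iff]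
  refine ae_eq_of_integral_mul_schwartz_eq hg (locallyIntegrable_const 0) fun ψ _ => ?_
  simp only [Pi.zero_apply, zero_mul, integral_zero]
  obtain ⟨ζ, rfl⟩ : ∃ ζ : 𝓢(EuclideanSpace ℝ (Fin d), ℂ), 𝓕 ζ = ψ :=
    ⟨𝓕⁻ ψ, FourierTransform.fourier_fourierInv_eq _⟩
  set C : ℝ := (∫ x, ‖𝓕 (lowPassSchwartz d) x‖) * ∫ x, ‖𝓕 ζ x‖
  have hC : 0 ≤ C := by positivity
  have hint : ∀ φ : 𝓢(EuclideanSpace ℝ (Fin d), ℂ), Integrable fun x => g x * φ x := by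
    intro φ
    obtain ⟨g₁, g₂, h1, h2m, h2, he⟩ := hdec 1 one_pos
    have i1 : Integrable fun x => g₁ x * φ x := h1.integrable_mul (φ.memLp 2)
    have i2 : Integrable fun x => g₂ x * φ x := φ.integrable.bdd_mul h2m h2
    refine (i1.add i2).congr ?_
    filter_upwards [he] with x hx
    simp only [Pi.add_apply, hx]
    ring
  -- Subtracting the pairing with the high-frequency part, which is 0 by hypothesis, leaves the
  -- low-frequency part.
  have hlow : ∀ ε : ℝ, 0 < ε → ∫ x, g x * 𝓕 ζ x = ∫ x, g x * 𝓕 (ζ - highPassSchwartz ε ζ) x := by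
    intro ε hε
    obtain ⟨ζ', -, ht⟩ := exists_isTestFracLaplacian hε s ζ
    have := h _ _ ht
    rw [← sub_zero (∫ x, g x * 𝓕 ζ x), ← this, ← integral_sub (hint _) (hint _)]
    refine integral_congr_ae (Eventually.of_forall fun x => ?_)
    have : 𝓕 (ζ - highPassSchwartz ε ζ) = 𝓕 ζ - 𝓕 (highPassSchwartz ε ζ) :=
      map_sub (FourierTransform.fourierCLM ℂ 𝓢(EuclideanSpace ℝ (Fin d), ℂ)) _ _
    simp only [this, sub_apply, mul_sub]
  have hle : ∀ δ : ℝ, 0 < δ → ‖∫ x, g x * 𝓕 ζ x‖ ≤ δ * C := by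
    intro δ hδ
    obtain ⟨g₁, g₂, h1, h2m, h2, he⟩ := hdec δ hδ
    obtain ⟨gh, hgh, -, hp⟩ := exists_fourier_memLp_two h1
    have hsplit : ∀ ε : ℝ, 0 < ε → ‖∫ x, g x * 𝓕 ζ x‖ ≤
        ‖∫ x, gh x * ((1 - (highPass ε x : ℂ)) * ζ x)‖ + δ * C := by
      intro ε hε
      have i1 : Integrable fun x => g₁ x * 𝓕 (ζ - highPassSchwartz ε ζ) x :=
        h1.integrable_mul (SchwartzMap.memLp _ 2 volume)
      have i2 : Integrable fun x => g₂ x * 𝓕 (ζ - highPassSchwartz ε ζ) x :=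
        (SchwartzMap.integrable _).bdd_mul h2m h2
      have e1 : ∫ x, g x * 𝓕 ζ x = (∫ x, g₁ x * 𝓕 (ζ - highPassSchwartz ε ζ) x) +
          ∫ x, g₂ x * 𝓕 (ζ - highPassSchwartz ε ζ) x := by
        rw [hlow ε hε, ← integral_add i1 i2]
        refine integral_congr_ae ?_
        filter_upwards [he] with x hx
        simp only [Pi.add_apply, hx]
        ring
      rw [e1, hp, FourierTransform.fourierInv_fourier_eq]
      refine (norm_add_le _ _).trans (add_le_add (le_of_eq ?_) ?_)
      · congr 2
        ext x
        rw [sub_apply, highPassSchwartz_apply]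
        ring
      · refine (norm_integral_le_of_norm_le
          ((SchwartzMap.integrable (𝓕 (ζ - highPassSchwartz ε ζ))).norm.const_mul δ) ?_).trans ?_
        · filter_upwards [h2] with x hx
          rw [norm_mul]
          exact mul_le_mul_of_nonneg_right hx (norm_nonneg _)
        · rw [integral_const_mul]
          exact mul_le_mul_of_nonneg_left
            (integral_norm_fourier_sub_highPassSchwartz_le hε ζ) hδ.le
    have hlim : Tendsto (fun ε : ℝ => ∫ x, gh x * ((1 - (highPass ε x : ℂ)) * ζ x)) (𝓝[>] 0)
        (𝓝 (∫ x : EuclideanSpace ℝ (Fin d), (0 : ℂ))) := by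
      refine tendsto_integral_filter_of_dominated_convergence (fun x => ‖gh x * ζ x‖) ?_ ?_ ?_ ?_
      · refine Eventually.of_forall fun ε => hgh.1.mul (Continuous.aestronglyMeasurable ?_)
        have := continuous_highPass (E := EuclideanSpace ℝ (Fin d)) ε
        have := ζ.continuous
        fun_prop
      · refine Eventually.of_forall fun ε => Eventually.of_forall fun x => ?_
        rw [norm_mul, norm_mul, norm_mul]
        have : ‖(1 - (highPass ε x : ℂ))‖ ≤ 1 := by
          rw [← Complex.ofReal_one, ← Complex.ofReal_sub, Complex.norm_real, Real.norm_of_nonneg]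
          · linarith [highPass_nonneg ε x]
          · linarith [highPass_le_one ε x]
        gcongr
        exact mul_le_of_le_one_left (norm_nonneg _) this
      · exact (hgh.integrable_mul (ζ.memLp 2)).norm
      · filter_upwards [hne] with x hx
        refine tendsto_const_nhds.congr' ?_
        filter_upwards [highPass_pos_eq_one_of_ne_zero hx] with ε hε
        simp [hε]
    rw [integral_zero] at hlim
    have hlim' := hlim.norm.add_const (δ * C)
    rw [norm_zero, zero_add] at hlim'
    refine ge_of_tendsto hlim' ?_
    filter_upwards [self_mem_nhdsWithin] with ε hε
    exact hsplit ε hε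
  have hlim : Tendsto (fun δ : ℝ => δ * C) (𝓝[>] 0) (𝓝 0) := by
    have : Tendsto (fun δ : ℝ => δ * C) (𝓝 0) (𝓝 (0 * C)) := tendsto_id.mul_const C
    rw [zero_mul] at this
    exact this.mono_left nhdsWithin_le_nhds
  have h0 : ‖∫ x, g x * 𝓕 ζ x‖ ≤ 0 := by
    refine ge_of_tendsto hlim ?_
    filter_upwards [self_mem_nhdsWithin] with δ hδ
    exact hle δ hδ
  exact norm_le_zero_iff.1 h0

end FracLaplacian

/-! ### Polar coordinates for complex integrands. -/

section Polar

variable {E : Type*} [NormedAddCommGroup E] [InnerProductSpace ℝ E] [FiniteDimensional ℝ E]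
  [MeasurableSpace E] [BorelSpace E] [Nontrivial E]

-- The measure factors on the punctured space as sphere measure times r^{dim-1} dr; Fubini then
-- applies, with the radial integral outside.
open Module in
theorem integral_eq_integral_polar {f : E → ℂ} (hf : Integrable f) :
    ∫ x, f x = ∫ r in Ioi (0 : ℝ), ((r ^ (finrank ℝ E - 1) : ℝ) : ℂ) *
      ∫ ω : Metric.sphere (0 : E) 1, f (r • (ω : E)) ∂(volume : Measure E).toSphere := by
  set g : Metric.sphere (0 : E) 1 × Ioi (0 : ℝ) → ℂ := fun p => f ((p.2 : ℝ) • (p.1 : E))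
  have hmp := (volume : Measure E).measurePreserving_homeomorphUnitSphereProd
  have hemb := (homeomorphUnitSphereProd E).measurableEmbedding
  have hg : ∀ x : ({0}ᶜ : Set E), g (homeomorphUnitSphereProd E x) = f x := by
    intro x
    have hx : ‖(x : E)‖ ≠ 0 := norm_ne_zero_iff.2 x.2
    simp [g, homeomorphUnitSphereProd_apply_snd_coe, homeomorphUnitSphereProd_apply_fst_coe,
      smul_smul, mul_inv_cancel₀ hx]
  have hint : Integrable g ((volume : Measure E).toSphere.prod
      (Measure.volumeIoiPow (finrank ℝ E - 1))) := by
    rw [← hmp.integrable_comp_emb hemb]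
    have : g ∘ homeomorphUnitSphereProd E = f ∘ Subtype.val := funext hg
    rw [this, ← integrableOn_iff_comap_subtypeVal (measurableSet_singleton _).compl]
    exact hf.integrableOn
  calc ∫ x, f x = ∫ x : ({(0)}ᶜ : Set E), f x ∂(volume.comap (Subtype.val : ({0}ᶜ : Set E) → E)) := by
        rw [integral_subtype_comap (measurableSet_singleton _).compl f, restrict_compl_singleton]
    _ = ∫ p, g p ∂((volume : Measure E).toSphere.prod (Measure.volumeIoiPow (finrank ℝ E - 1))) := by
        rw [← hmp.integral_comp hemb]
        simp_rw [hg]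
    _ = ∫ r : Ioi (0 : ℝ), ∫ ω, g (ω, r) ∂(volume : Measure E).toSphere
          ∂Measure.volumeIoiPow (finrank ℝ E - 1) := integral_prod_symm _ hint
    _ = _ := by
        simp only [Measure.volumeIoiPow, ENNReal.ofReal]
        rw [integral_withDensity_eq_integral_smul,
          integral_subtype_comap measurableSet_Ioi fun a : ℝ => Real.toNNReal (a ^ (finrank ℝ E - 1)) •
            ∫ ω : Metric.sphere (0 : E) 1, f (a • (ω : E)) ∂(volume : Measure E).toSphere]
        · refine setIntegral_congr_fun measurableSet_Ioi fun x hx => ?_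
          simp only [NNReal.smul_def, Real.coe_toNNReal _ (pow_nonneg (le_of_lt hx) _)]
          rfl
        · exact (measurable_subtype_coe.pow_const _).real_toNNReal

end Polar

/-! ### Power series: uniqueness of coefficients and even reindexing. -/

theorem HasSum.of_forall_eq {α β : Type*} [AddCommMonoid α] [TopologicalSpace α] {f g : β → α} {a : α}
    (h : HasSum g a) (e : ∀ b, f b = g b) : HasSum f a :=
  (funext e : f = g) ▸ h

theorem coeff_eq_of_hasSum_pow {a b : ℕ → ℝ} {f : ℝ → ℝ} (ha : ∀ s, HasSum (fun m => a m * s ^ m) (f s))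
    (hb : ∀ s, HasSum (fun m => b m * s ^ m) (f s)) : a = b := by
  have key : ∀ c : ℕ → ℝ, (∀ s, HasSum (fun m => c m * s ^ m) (f s)) →
      HasFPowerSeriesAt f (FormalMultilinearSeries.ofScalars ℝ c) 0 := by
    intro c hc
    rw [hasFPowerSeriesAt_iff]
    refine Eventually.of_forall fun z => ?_
    simpa [FormalMultilinearSeries.coeff_ofScalars, mul_comm] using hc z
  have := (key a ha).eq_formalMultilinearSeries (key b hb)
  ext m
  have h := congrArg (fun p => FormalMultilinearSeries.coeff p m) this
  simpa [FormalMultilinearSeries.coeff_ofScalars] using h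

theorem hasSum_even_iff_extend {α : Type*} [AddCommMonoid α] [TopologicalSpace α] {c : ℕ → α} {S : α} :
    HasSum (fun m => if Even m then c (m / 2) else 0) S ↔ HasSum c S := by
  have hinj : Function.Injective fun m : ℕ => 2 * m := fun a b h => by simpa using h
  rw [← hinj.hasSum_iff]
  · simp [Function.comp_def]
  · intro m hm
    rw [if_neg]
    rintro ⟨k, rfl⟩
    exact hm ⟨k, by ring⟩

/-! ### The Fourier transform of the surface measure of the unit sphere. -/

section SphereFourier

variable {d : ℕ}

theorem integrable_exp_neg_sq_add_inner (x : EuclideanSpace ℝ (Fin d)) (s : ℝ) :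
    Integrable fun v : EuclideanSpace ℝ (Fin d) => Real.exp (-‖v‖ ^ 2 + s * inner ℝ x v) := by
  have h := (GaussianFourier.integrable_cexp_neg_mul_sq_norm_add (b := 1) (by simp) (s : ℂ) x).re
  refine h.congr (Eventually.of_forall fun v => ?_)
  simp only
  rw [show (-1 * (‖v‖ : ℂ) ^ 2 + s * (inner ℝ x v : ℝ)) = ((-‖v‖ ^ 2 + s * inner ℝ x v : ℝ) : ℂ) by
    push_cast; ring, ← Complex.ofReal_exp]
  rfl

theorem integral_exp_neg_sq_add_inner (x : EuclideanSpace ℝ (Fin d)) (s : ℝ) :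
    ∫ v : EuclideanSpace ℝ (Fin d), Real.exp (-‖v‖ ^ 2 + s * inner ℝ x v) =
      Real.pi ^ ((d : ℝ) / 2) * Real.exp (s ^ 2 * ‖x‖ ^ 2 / 4) := by
  have h := GaussianFourier.integral_cexp_neg_mul_sq_norm_add (b := 1) (by simp) (s : ℂ) x
  apply Complex.ofReal_injective
  rw [← integral_complex_ofReal]
  convert h using 1
  · refine integral_congr_ae (Eventually.of_forall fun v => ?_)
    push_cast
    simp
  · rw [finrank_euclideanSpace, Fintype.card_fin, div_one]
    push_cast
    rw [Complex.ofReal_cpow Real.pi_pos.le]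
    simp

theorem hasSum_moments (x : EuclideanSpace ℝ (Fin d)) (s : ℝ) :
    HasSum (fun m : ℕ => (∫ v : EuclideanSpace ℝ (Fin d),
        Real.exp (-‖v‖ ^ 2) * (inner ℝ x v) ^ m) / m.factorial * s ^ m)
      (∫ v : EuclideanSpace ℝ (Fin d), Real.exp (-‖v‖ ^ 2 + s * inner ℝ x v)) := by
  have hs : ∀ y : ℝ, HasSum (fun m : ℕ => y ^ m / m.factorial) (Real.exp y) := fun y => by
    have := NormedSpace.expSeries_div_hasSum_exp y
    rwa [← Real.exp_eq_exp_ℝ] at this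
  have h := hasSum_integral_of_dominated_convergence (μ := volume)
    (F := fun (m : ℕ) (v : EuclideanSpace ℝ (Fin d)) =>
      Real.exp (-‖v‖ ^ 2) * ((s * inner ℝ x v) ^ m / m.factorial))
    (f := fun v => Real.exp (-‖v‖ ^ 2 + s * inner ℝ x v))
    (fun m v => Real.exp (-‖v‖ ^ 2) * (|s * inner ℝ x v| ^ m / m.factorial)) ?_ ?_ ?_ ?_ ?_
  · refine h.of_forall_eq fun m => ?_
    rw [div_mul_eq_mul_div, ← integral_mul_const, ← integral_div]
    refine integral_congr_ae (Eventually.of_forall fun v => ?_)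
    simp only
    rw [mul_pow]
    ring
  · intro m
    refine Continuous.aestronglyMeasurable ?_
    fun_prop
  · intro m
    refine Eventually.of_forall fun v => ?_
    simp [abs_of_pos (Real.exp_pos _)]
  · exact Eventually.of_forall fun v => ((hs _).summable.mul_left _)
  · have hi := (integrable_exp_neg_sq_add_inner x s).add (integrable_exp_neg_sq_add_inner x (-s))
    refine hi.mono' ?_ ?_
    · refine Continuous.aestronglyMeasurable ?_
      have : (fun v : EuclideanSpace ℝ (Fin d) => ∑' m : ℕ, Real.exp (-‖v‖ ^ 2) *
          (|s * inner ℝ x v| ^ m / m.factorial)) =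
          fun v => Real.exp (-‖v‖ ^ 2) * Real.exp |s * inner ℝ x v| := by
        ext v; rw [tsum_mul_left, (hs _).tsum_eq]
      rw [this]
      fun_prop
    · refine Eventually.of_forall fun v => ?_
      rw [tsum_mul_left, (hs _).tsum_eq, Real.norm_of_nonneg (by positivity)]
      simp only [Pi.add_apply, Real.exp_add]
      rcases abs_cases (s * inner ℝ x v) with h | h
      · rw [h.1]
        have := Real.exp_pos (-s * inner ℝ x v)
        have := Real.exp_pos (-‖v‖ ^ 2)
        nlinarith
      · rw [h.1, neg_mul]
        have := Real.exp_pos (s * inner ℝ x v)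
        have := Real.exp_pos (-‖v‖ ^ 2)
        nlinarith
  · refine Eventually.of_forall fun v => ?_
    rw [Real.exp_add]
    exact (hs _).mul_left _

/-- Both sides are the coefficient of s^m in ∫ e^{-|v|² + s x·v} dv = π^{d/2} e^{s²|x|²/4}. -/
theorem gaussian_moments (x : EuclideanSpace ℝ (Fin d)) (m : ℕ) :
    (∫ v : EuclideanSpace ℝ (Fin d), Real.exp (-‖v‖ ^ 2) * (inner ℝ x v) ^ m) / m.factorial =
      if Even m then Real.pi ^ ((d : ℝ) / 2) * (‖x‖ / 2) ^ (2 * (m / 2)) / (m / 2).factorial else 0 := by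
  refine congrFun (coeff_eq_of_hasSum_pow (hasSum_moments x) (b := fun m => if Even m then
    Real.pi ^ ((d : ℝ) / 2) * (‖x‖ / 2) ^ (2 * (m / 2)) / (m / 2).factorial else 0) fun s => ?_) m
  rw [integral_exp_neg_sq_add_inner]
  have h1 := (NormedSpace.expSeries_div_hasSum_exp (s ^ 2 * ‖x‖ ^ 2 / 4)).mul_left
    (Real.pi ^ ((d : ℝ) / 2))
  rw [← Real.exp_eq_exp_ℝ] at h1
  rw [← hasSum_even_iff_extend] at h1
  refine h1.of_forall_eq fun m => ?_
  split_ifs with hm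
  · obtain ⟨k, rfl⟩ := hm
    rw [show (k + k) / 2 = k by omega, ← two_mul k, pow_mul s, pow_mul (‖x‖ / 2),
      show s ^ 2 * ‖x‖ ^ 2 / 4 = s ^ 2 * (‖x‖ / 2) ^ 2 by ring, mul_pow]
    ring
  · simp

/-- The entire function `∑ (-1)^m (x/2)^(2m) / (m! Γ(m + d/2))`. -/
noncomputable def besselEntire (d : ℕ) (x : ℝ) : ℝ :=
  ∑' m : ℕ, (-1) ^ m / ((m.factorial : ℝ) * Real.Gamma (m + d / 2)) * (x / 2) ^ (2 * m)

theorem integral_rpow_mul_exp_neg_sq {q : ℝ} (hq : -1 < q) :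
    ∫ r in Ioi (0 : ℝ), r ^ q * Real.exp (-r ^ 2) = Real.Gamma ((q + 1) / 2) / 2 := by
  have := integral_rpow_mul_exp_neg_rpow (p := 2) (q := q) (by norm_num) hq
  rw [← one_div_mul_eq_div] at *
  simpa using this

theorem integrable_exp_neg_sq_mul_inner_pow (x : EuclideanSpace ℝ (Fin d)) (m : ℕ) :
    Integrable fun v : EuclideanSpace ℝ (Fin d) => Real.exp (-‖v‖ ^ 2) * (inner ℝ x v) ^ m := by
  have hi := ((integrable_exp_neg_sq_add_inner x 1).add
    (integrable_exp_neg_sq_add_inner x (-1))).mul_const (m.factorial : ℝ)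
  refine hi.mono' (Continuous.aestronglyMeasurable (by fun_prop)) (Eventually.of_forall fun v => ?_)
  simp only [Pi.add_apply, Real.exp_add, norm_mul, norm_pow, Real.norm_eq_abs, Real.abs_exp,
    neg_mul, one_mul]
  have h1 : |inner ℝ x v| ^ m / m.factorial ≤ Real.exp |inner ℝ x v| :=
    Real.pow_div_factorial_le_exp _ (abs_nonneg _) _
  rw [div_le_iff₀ (by positivity)] at h1
  have h2 : Real.exp |inner ℝ x v| ≤ Real.exp (inner ℝ x v) + Real.exp (-inner ℝ x v) := by
    rcases abs_cases (inner ℝ x v) with h | h <;> rw [h.1]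
    · linarith [Real.exp_pos (-inner ℝ x v)]
    · linarith [Real.exp_pos (inner ℝ x v)]
  have h3 := Real.exp_pos (-‖v‖ ^ 2)
  calc Real.exp (-‖v‖ ^ 2) * |inner ℝ x v| ^ m
      ≤ Real.exp (-‖v‖ ^ 2) * ((Real.exp (inner ℝ x v) + Real.exp (-inner ℝ x v)) * m.factorial) := by
        gcongr
        exact h1.trans (by gcongr)
    _ = _ := by ring

/-- In polar coordinates a Gaussian moment is a radial Gamma integral times the spherical moment, so
the spherical moment is obtained by division. -/
theorem sphere_moments (hd : 1 ≤ d) (x : EuclideanSpace ℝ (Fin d)) (m : ℕ) :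
    (∫ ω : Metric.sphere (0 : EuclideanSpace ℝ (Fin d)) 1, (inner ℝ x (ω : EuclideanSpace ℝ (Fin d))) ^ m
      ∂(volume : Measure (EuclideanSpace ℝ (Fin d))).toSphere) / m.factorial =
    if Even m then 2 * Real.pi ^ ((d : ℝ) / 2) * (‖x‖ / 2) ^ (2 * (m / 2)) /
      ((m / 2).factorial * Real.Gamma ((m / 2 : ℕ) + d / 2)) else 0 := by
  have : Nonempty (Fin d) := ⟨⟨0, hd⟩⟩
  have h0 := gaussian_moments x m
  set β := ∫ ω : Metric.sphere (0 : EuclideanSpace ℝ (Fin d)) 1,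
    (inner ℝ x (ω : EuclideanSpace ℝ (Fin d))) ^ m
      ∂(volume : Measure (EuclideanSpace ℝ (Fin d))).toSphere with hβ
  have h1 : ∫ v : EuclideanSpace ℝ (Fin d), Real.exp (-‖v‖ ^ 2) * (inner ℝ x v) ^ m =
      Real.Gamma (((m : ℝ) + d) / 2) / 2 * β := by
    apply Complex.ofReal_injective
    have hI : Integrable fun v : EuclideanSpace ℝ (Fin d) =>
        ((Real.exp (-‖v‖ ^ 2) * (inner ℝ x v) ^ m : ℝ) : ℂ) :=
      (integrable_exp_neg_sq_mul_inner_pow x m).ofReal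
    rw [← integral_complex_ofReal, integral_eq_integral_polar hI]
    have h2 := integral_rpow_mul_exp_neg_sq (q := (m : ℝ) + d - 1) (by
      have : (1 : ℝ) ≤ d := by exact_mod_cast hd
      linarith [(Nat.cast_nonneg m : (0 : ℝ) ≤ m)])
    rw [sub_add_cancel] at h2
    rw [← h2, Complex.ofReal_mul, ← integral_complex_ofReal, ← integral_mul_const]
    refine setIntegral_congr_fun measurableSet_Ioi fun r hr => ?_
    simp only [finrank_euclideanSpace, Fintype.card_fin]
    rw [integral_complex_ofReal, ← Complex.ofReal_mul, ← Complex.ofReal_mul]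
    congr 1
    have : ∀ ω : Metric.sphere (0 : EuclideanSpace ℝ (Fin d)) 1,
        Real.exp (-‖r • (ω : EuclideanSpace ℝ (Fin d))‖ ^ 2) *
          inner ℝ x (r • (ω : EuclideanSpace ℝ (Fin d))) ^ m =
        (Real.exp (-r ^ 2) * r ^ m) * inner ℝ x (ω : EuclideanSpace ℝ (Fin d)) ^ m := by
      intro ω
      have hω : ‖(ω : EuclideanSpace ℝ (Fin d))‖ = 1 := by simp
      rw [norm_smul, hω, mul_one, Real.norm_eq_abs, sq_abs, inner_smul_right, mul_pow]
      ring
    simp_rw [this]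
    rw [integral_const_mul, ← hβ]
    have e : r ^ ((m : ℝ) + d - 1) = r ^ (d - 1) * r ^ m := by
      rw [show (m : ℝ) + d - 1 = ((d - 1 + m : ℕ) : ℝ) by push_cast [hd]; ring, Real.rpow_natCast,
        pow_add]
    rw [e]
    ring
  rw [h1] at h0
  have hG : 0 < Real.Gamma (((m : ℝ) + d) / 2) := by
    apply Real.Gamma_pos_of_pos
    have : (1 : ℝ) ≤ d := by exact_mod_cast hd
    positivity
  split_ifs at h0 ⊢ with hm
  · obtain ⟨k, rfl⟩ := hm
    rw [show (k + k) / 2 = k by omega] at h0 ⊢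
    rw [show ((k + k : ℕ) + (d : ℝ)) / 2 = (k : ℝ) + d / 2 by push_cast; ring] at h0 hG
    have hk : (0 : ℝ) < k.factorial := by positivity
    have hk2 : (0 : ℝ) < (k + k).factorial := by positivity
    field_simp at h0 ⊢
    linarith
  · rcases div_eq_zero_iff.1 h0 with h | h
    · rcases mul_eq_zero.1 h with h | h
      · exfalso; linarith
      · rw [h, zero_div]
    · rw [h, div_zero]

/-- Expansion of the exponential under the integral over the sphere. Odd moments vanish and even
ones carry the sign i^{2k} = (-1)^k. -/
theorem hasSum_sphere_fourier (hd : 1 ≤ d) (x : EuclideanSpace ℝ (Fin d)) :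
    HasSum (fun m : ℕ => ((2 * Real.pi ^ ((d : ℝ) / 2) *
        ((-1) ^ m / ((m.factorial : ℝ) * Real.Gamma (m + d / 2)) * (‖x‖ / 2) ^ (2 * m)) : ℝ) : ℂ))
      (∫ ω : Metric.sphere (0 : EuclideanSpace ℝ (Fin d)) 1,
        Complex.exp (Complex.I * (inner ℝ x (ω : EuclideanSpace ℝ (Fin d)) : ℝ))
        ∂(volume : Measure (EuclideanSpace ℝ (Fin d))).toSphere) := by
  have : Nonempty (Fin d) := ⟨⟨0, hd⟩⟩
  rw [← hasSum_even_iff_extend]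
  have hcont : Continuous fun ω : Metric.sphere (0 : EuclideanSpace ℝ (Fin d)) 1 =>
      (inner ℝ x (ω : EuclideanSpace ℝ (Fin d)) : ℝ) := by fun_prop
  have hb : ∀ ω : Metric.sphere (0 : EuclideanSpace ℝ (Fin d)) 1,
      |(inner ℝ x (ω : EuclideanSpace ℝ (Fin d)) : ℝ)| ≤ ‖x‖ := fun ω => by
    simpa using abs_real_inner_le_norm x (ω : EuclideanSpace ℝ (Fin d))
  have hexp : Summable fun m : ℕ => ‖x‖ ^ m / m.factorial := Real.summable_pow_div_factorial _
  have h := hasSum_integral_of_dominated_convergence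
    (μ := (volume : Measure (EuclideanSpace ℝ (Fin d))).toSphere)
    (F := fun (m : ℕ) (ω : Metric.sphere (0 : EuclideanSpace ℝ (Fin d)) 1) =>
      (Complex.I * (inner ℝ x (ω : EuclideanSpace ℝ (Fin d)) : ℝ)) ^ m / m.factorial)
    (f := fun ω => Complex.exp (Complex.I * (inner ℝ x (ω : EuclideanSpace ℝ (Fin d)) : ℝ)))
    (fun m _ => ‖x‖ ^ m / m.factorial) ?_ ?_ ?_ ?_ ?_
  · refine h.of_forall_eq fun m => ?_
    have e1 : ∫ ω : Metric.sphere (0 : EuclideanSpace ℝ (Fin d)) 1,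
        (Complex.I * (inner ℝ x (ω : EuclideanSpace ℝ (Fin d)) : ℝ)) ^ m / (m.factorial : ℂ)
          ∂(volume : Measure (EuclideanSpace ℝ (Fin d))).toSphere =
        Complex.I ^ m * (((∫ ω : Metric.sphere (0 : EuclideanSpace ℝ (Fin d)) 1,
          (inner ℝ x (ω : EuclideanSpace ℝ (Fin d))) ^ m
          ∂(volume : Measure (EuclideanSpace ℝ (Fin d))).toSphere) / m.factorial : ℝ) : ℂ) := by
      rw [Complex.ofReal_div, ← integral_complex_ofReal, integral_div]
      simp_rw [mul_pow]
      rw [integral_const_mul]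
      push_cast
      rw [mul_div_assoc]
    rw [e1, sphere_moments hd]
    split_ifs with hm
    · obtain ⟨k, rfl⟩ := hm
      rw [show (k + k) / 2 = k by omega, ← two_mul, pow_mul Complex.I, Complex.I_sq]
      push_cast
      ring
    · simp
  · intro m
    exact Continuous.aestronglyMeasurable (by fun_prop)
  · intro m
    refine Eventually.of_forall fun ω => ?_
    simp only [norm_div, norm_pow, norm_mul, Complex.norm_I, one_mul, Complex.norm_real,
      Real.norm_eq_abs, RCLike.norm_natCast]
    gcongr
    exact hb ω
  · exact Eventually.of_forall fun _ => hexp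
  · exact integrable_const _
  · refine Eventually.of_forall fun ω => ?_
    have := NormedSpace.expSeries_div_hasSum_exp
      (Complex.I * ((inner ℝ x (ω : EuclideanSpace ℝ (Fin d)) : ℝ) : ℂ))
    rwa [← Complex.exp_eq_exp_ℂ] at this

theorem sphere_fourier (hd : 1 ≤ d) (x : EuclideanSpace ℝ (Fin d)) :
    ∫ ω : Metric.sphere (0 : EuclideanSpace ℝ (Fin d)) 1,
        Complex.exp (Complex.I * (inner ℝ x (ω : EuclideanSpace ℝ (Fin d)) : ℝ))
        ∂(volume : Measure (EuclideanSpace ℝ (Fin d))).toSphere =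
      ((2 * Real.pi ^ ((d : ℝ) / 2) * besselEntire d ‖x‖ : ℝ) : ℂ) := by
  rw [← (hasSum_sphere_fourier hd x).tsum_eq, besselEntire, ← Complex.ofReal_tsum, tsum_mul_left]

end SphereFourier

/-! ### The entire function x^{-(d/2-1)} J_{d/2-1}(x), up to a constant, and radial Fourier
transforms. -/

section BesselEntire

variable {d : ℕ}

theorem Gamma_half_dim_pos (hd : 1 ≤ d) : 0 < Real.Gamma ((d : ℝ) / 2) :=
  Real.Gamma_pos_of_pos (by have : (1 : ℝ) ≤ d := by exact_mod_cast hd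
                            positivity)

theorem besselEntire_zero (d : ℕ) : besselEntire d 0 = (Real.Gamma ((d : ℝ) / 2))⁻¹ := by
  rw [besselEntire, tsum_eq_single 0]
  · simp
  · intro m hm
    simp [hm]

theorem besselEntire_abs (d : ℕ) (x : ℝ) : besselEntire d |x| = besselEntire d x := by
  simp only [besselEntire, pow_mul, div_pow, sq_abs]

/-- The value at x = 0 of the sphere's Fourier transform. -/
theorem toSphere_real_univ (hd : 1 ≤ d) :
    (volume : Measure (EuclideanSpace ℝ (Fin d))).toSphere.real univ =
      2 * Real.pi ^ ((d : ℝ) / 2) / Real.Gamma ((d : ℝ) / 2) := by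
  have h := sphere_fourier hd 0
  simp only [inner_zero_left, Complex.ofReal_zero, mul_zero, Complex.exp_zero, norm_zero,
    besselEntire_zero, integral_const, Complex.real_smul, mul_one] at h
  rw [← div_eq_mul_inv] at h
  exact_mod_cast h

theorem besselEntire_eq_integral (hd : 1 ≤ d) {e : EuclideanSpace ℝ (Fin d)} (he : ‖e‖ = 1) (x : ℝ) :
    ∫ ω : Metric.sphere (0 : EuclideanSpace ℝ (Fin d)) 1,
        Complex.exp (Complex.I * (x * inner ℝ e (ω : EuclideanSpace ℝ (Fin d)) : ℝ))
        ∂(volume : Measure (EuclideanSpace ℝ (Fin d))).toSphere =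
      ((2 * Real.pi ^ ((d : ℝ) / 2) * besselEntire d x : ℝ) : ℂ) := by
  have h := sphere_fourier hd (x • e)
  rw [norm_smul, he, mul_one, Real.norm_eq_abs, besselEntire_abs] at h
  rw [← h]
  simp only [inner_smul_left, conj_trivial]

theorem exists_norm_eq_one_euclidean (hd : 1 ≤ d) : ∃ e : EuclideanSpace ℝ (Fin d), ‖e‖ = 1 :=
  ⟨EuclideanSpace.single ⟨0, hd⟩ 1, by simp⟩

/-- Up to the factor 2π^{d/2} the function integrates unimodular exponentials over the sphere, so it
is bounded by the total mass, that is, by its value at 0. -/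
theorem abs_besselEntire_le (hd : 1 ≤ d) (x : ℝ) :
    |besselEntire d x| ≤ (Real.Gamma ((d : ℝ) / 2))⁻¹ := by
  obtain ⟨e, he⟩ := exists_norm_eq_one_euclidean hd
  have h := norm_integral_le_of_norm_le_const (μ := (volume : Measure (EuclideanSpace ℝ (Fin d))).toSphere)
    (f := fun ω : Metric.sphere (0 : EuclideanSpace ℝ (Fin d)) 1 =>
      Complex.exp (Complex.I * (x * inner ℝ e (ω : EuclideanSpace ℝ (Fin d)) : ℝ))) (C := 1)
    (Eventually.of_forall fun ω => by rw [mul_comm, Complex.norm_exp_ofReal_mul_I])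
  rw [besselEntire_eq_integral hd he, one_mul, toSphere_real_univ hd, Complex.norm_real, norm_mul,
    Real.norm_of_nonneg (by positivity), Real.norm_eq_abs, div_eq_mul_inv] at h
  exact le_of_mul_le_mul_left h (by positivity)

theorem continuous_besselEntire (hd : 1 ≤ d) : Continuous (besselEntire d) := by
  obtain ⟨e, he⟩ := exists_norm_eq_one_euclidean hd
  have h : Continuous fun x : ℝ => ∫ ω : Metric.sphere (0 : EuclideanSpace ℝ (Fin d)) 1,
        Complex.exp (Complex.I * (x * inner ℝ e (ω : EuclideanSpace ℝ (Fin d)) : ℝ))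
        ∂(volume : Measure (EuclideanSpace ℝ (Fin d))).toSphere := by
    refine continuous_of_dominated (bound := fun _ => 1) (fun x => ?_) (fun x => ?_)
      (integrable_const _) ?_
    · exact Continuous.aestronglyMeasurable (by fun_prop)
    · exact Eventually.of_forall fun ω => by rw [mul_comm, Complex.norm_exp_ofReal_mul_I]
    · exact Eventually.of_forall fun ω => by fun_prop
  simp_rw [besselEntire_eq_integral hd he] at h
  have h2 := (Complex.continuous_re.comp h).div_const (2 * Real.pi ^ ((d : ℝ) / 2))
  refine h2.congr fun x => ?_
  simp only [Function.comp_apply, Complex.ofReal_re]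
  have := Real.pi_pos
  field_simp

theorem besselJ_div_rpow {x : ℝ} (hx : 0 < x) :
    besselJ ((d : ℝ) / 2 - 1) x / x ^ ((d : ℝ) / 2 - 1) =
      2 ^ (1 - (d : ℝ) / 2) * besselEntire d x := by
  rw [besselJ, besselEntire, ← tsum_div_const, ← tsum_mul_left]
  refine tsum_congr fun m => ?_
  rw [Real.rpow_add (by positivity), show (m : ℝ) + ((d : ℝ) / 2 - 1) + 1 = m + d / 2 by ring,
    show (2 * (m : ℝ)) = ((2 * m : ℕ) : ℝ) by push_cast; ring, Real.rpow_natCast,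
    Real.div_rpow hx.le (by norm_num), show 1 - (d : ℝ) / 2 = -((d : ℝ) / 2 - 1) by ring,
    Real.rpow_neg (by norm_num)]
  have h1 : x ^ ((d : ℝ) / 2 - 1) ≠ 0 := (Real.rpow_pos_of_pos hx _).ne'
  have h2 : (2 : ℝ) ^ ((d : ℝ) / 2 - 1) ≠ 0 := (Real.rpow_pos_of_pos (by norm_num) _).ne'
  field_simp

/-- In polar coordinates the angular integral is the Fourier transform of the sphere at 2πr x. -/
theorem fourierInv_radial (hd : 1 ≤ d) {H : ℝ → ℂ}
    (hH : Integrable fun k : EuclideanSpace ℝ (Fin d) => H ‖k‖) (x : EuclideanSpace ℝ (Fin d)) :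
    𝓕⁻ (fun k : EuclideanSpace ℝ (Fin d) => H ‖k‖) x =
      ((2 * Real.pi ^ ((d : ℝ) / 2) : ℝ) : ℂ) * ∫ r in Ioi (0 : ℝ),
        ((r ^ (d - 1) * besselEntire d (2 * Real.pi * ‖x‖ * r) : ℝ) : ℂ) * H r := by
  have : Nonempty (Fin d) := ⟨⟨0, hd⟩⟩
  rw [Real.fourierInv_eq']
  have hi : Integrable fun k : EuclideanSpace ℝ (Fin d) =>
      Complex.exp (((2 * Real.pi * inner ℝ k x : ℝ) : ℂ) * Complex.I) • H ‖k‖ := by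
    have hc : Continuous fun k : EuclideanSpace ℝ (Fin d) =>
        Complex.exp (((2 * Real.pi * inner ℝ k x : ℝ) : ℂ) * Complex.I) := by fun_prop
    refine hH.mono (hc.aestronglyMeasurable.smul hH.1) ?_
    refine Eventually.of_forall fun k => ?_
    rw [norm_smul, Complex.norm_exp_ofReal_mul_I, one_mul]
  rw [integral_eq_integral_polar hi, ← integral_const_mul]
  refine setIntegral_congr_fun measurableSet_Ioi fun r hr => ?_
  have hr' : 0 < r := hr
  simp only [finrank_euclideanSpace, Fintype.card_fin, smul_eq_mul]
  have e1 : ∀ ω : Metric.sphere (0 : EuclideanSpace ℝ (Fin d)) 1,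
      Complex.exp (((2 * Real.pi * inner ℝ (r • (ω : EuclideanSpace ℝ (Fin d))) x : ℝ) : ℂ) *
        Complex.I) * H ‖r • (ω : EuclideanSpace ℝ (Fin d))‖ =
      Complex.exp (Complex.I * (inner ℝ ((2 * Real.pi * r) • x) (ω : EuclideanSpace ℝ (Fin d)) : ℝ)) *
        H r := by
    intro ω
    have hω : ‖(ω : EuclideanSpace ℝ (Fin d))‖ = 1 := by simp
    rw [norm_smul, hω, mul_one, Real.norm_of_nonneg hr'.le, inner_smul_left, inner_smul_left,
      real_inner_comm, mul_comm Complex.I]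
    simp [mul_assoc]
  simp_rw [e1]
  rw [integral_mul_const, sphere_fourier hd, norm_smul, Real.norm_of_nonneg (by positivity)]
  push_cast
  rw [show 2 * Real.pi * ‖x‖ * r = 2 * Real.pi * r * ‖x‖ by ring]
  ring

end BesselEntire

/-! ### Mellin transforms of (1 + x^a)^{-q}. -/

section BetaIntegrals

theorem image_div_one_add_Ioi : (fun x : ℝ => x / (1 + x)) '' Ioi 0 = Ioo 0 1 := by
  ext t
  constructor
  · rintro ⟨x, hx, rfl⟩
    have hx' : 0 < x := hx
    refine ⟨by positivity, ?_⟩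
    simp only
    rw [div_lt_one (by positivity)]
    linarith
  · rintro ⟨h0, h1⟩
    have h2 : 0 < 1 - t := by linarith
    refine ⟨t / (1 - t), div_pos h0 h2, ?_⟩
    simp only
    field_simp
    ring

/-- The substitution t = x/(1 + x) maps (0, ∞) onto (0, 1) and turns Euler's beta integral into this
one. The exponents q = 1 (for L_{jn}) and q = 2 (for the trial energies) are those used. -/
theorem hasMellin_inv_one_add_pow (q : ℕ) {w : ℂ} (hw : 0 < w.re) (hq : w.re < q) :
    HasMellin (fun x : ℝ => ((((1 + x) ^ q)⁻¹ : ℝ) : ℂ)) w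
      (Complex.Gamma w * Complex.Gamma (q - w) / Complex.Gamma q) := by
  have hq' : 0 < ((q : ℂ) - w).re := by simp [hq]
  have hder : ∀ x ∈ Ioi (0 : ℝ), HasDerivWithinAt (fun x : ℝ => x / (1 + x)) (((1 + x) ^ 2)⁻¹)
      (Ioi 0) x := by
    intro x hx
    have hx' : 0 < x := hx
    have hne : (1 + x) ≠ 0 := by positivity
    have h := (hasDerivAt_id x).div ((hasDerivAt_id x).const_add 1) hne
    refine HasDerivAt.hasDerivWithinAt (h.congr_deriv ?_)
    simp only [id]
    field_simp
    ring
  have hinj : InjOn (fun x : ℝ => x / (1 + x)) (Ioi 0) := by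
    intro x hx y hy hxy
    have hx' : 0 < x := hx
    have hy' : 0 < y := hy
    simp only at hxy
    rw [div_eq_div_iff (by positivity) (by positivity)] at hxy
    linarith
  have hpt : ∀ x ∈ Ioi (0 : ℝ), |((1 + x) ^ 2)⁻¹| •
      (((x / (1 + x) : ℝ) : ℂ) ^ (w - 1) * (1 - ((x / (1 + x) : ℝ) : ℂ)) ^ ((q : ℂ) - w - 1)) =
      (x : ℂ) ^ (w - 1) • ((((1 + x) ^ q)⁻¹ : ℝ) : ℂ) := by
    intro x hx
    have hx' : 0 < x := hx
    have h1 : 0 < 1 + x := by positivity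
    have e1 : 1 - ((x / (1 + x) : ℝ) : ℂ) = ((1 + x)⁻¹ : ℝ) := by
      rw [← Complex.ofReal_one, ← Complex.ofReal_sub]
      congr 1
      field_simp
      ring
    have hpow : ∀ m : ℕ, ((((1 + x) ^ m)⁻¹ : ℝ) : ℂ) = Complex.exp (-(m * (Real.log (1 + x) : ℂ))) := by
      intro m
      rw [← Complex.ofReal_natCast, ← Complex.ofReal_mul, ← Complex.ofReal_neg, ← Complex.ofReal_exp,
        Real.exp_neg, Real.exp_nat_mul, Real.exp_log h1]
    rw [e1, abs_of_pos (by positivity), Complex.real_smul, smul_eq_mul, hpow, hpow,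
      Complex.cpow_def_of_ne_zero (by exact_mod_cast (div_pos hx' h1).ne'),
      Complex.cpow_def_of_ne_zero (by exact_mod_cast (inv_pos.2 h1).ne'),
      Complex.cpow_def_of_ne_zero (by exact_mod_cast hx'.ne'),
      ← Complex.ofReal_log (div_pos hx' h1).le, ← Complex.ofReal_log (inv_pos.2 h1).le,
      ← Complex.ofReal_log hx'.le, Real.log_div hx'.ne' h1.ne', Real.log_inv, ← Complex.exp_add,
      ← Complex.exp_add, ← Complex.exp_add]
    congr 1
    push_cast
    ring
  have hconv := Complex.betaIntegral_convergent hw hq'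
  have hbeta := Complex.betaIntegral_eq_Gamma_mul_div w (q - w) hw hq'
  rw [add_sub_cancel] at hbeta
  rw [intervalIntegrable_iff_integrableOn_Ioo_of_le zero_le_one, ← image_div_one_add_Ioi,
    integrableOn_image_iff_integrableOn_abs_deriv_smul measurableSet_Ioi hder hinj] at hconv
  rw [Complex.betaIntegral, intervalIntegral.integral_of_le zero_le_one, integral_Ioc_eq_integral_Ioo,
    ← image_div_one_add_Ioi, integral_image_eq_integral_abs_deriv_smul measurableSet_Ioi hder hinj] at hbeta
  refine ⟨hconv.congr_fun hpt measurableSet_Ioi, ?_⟩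
  rw [mellin, ← hbeta]
  exact setIntegral_congr_fun measurableSet_Ioi fun x hx => (hpt x hx).symm

theorem hasMellin_inv_one_add_rpow_pow (q : ℕ) {a : ℝ} (ha : 0 < a) {s : ℂ} (hs : 0 < s.re)
    (hq : s.re < a * q) :
    HasMellin (fun x : ℝ => ((((1 + x ^ a) ^ q)⁻¹ : ℝ) : ℂ)) s
      (Complex.Gamma (s / a) * Complex.Gamma (q - s / a) / (a * Complex.Gamma q)) := by
  have hre : (s / (a : ℂ)).re = s.re / a := Complex.div_ofReal_re _ _
  have h := hasMellin_inv_one_add_pow q (w := s / a) (by rw [hre]; positivity)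
    (by rw [hre, div_lt_iff₀ ha]; linarith)
  refine ⟨(MellinConvergent.comp_rpow (f := fun x : ℝ => ((((1 + x) ^ q)⁻¹ : ℝ) : ℂ)) ha.ne').2 h.1, ?_⟩
  have := mellin_comp_rpow (fun x : ℝ => ((((1 + x) ^ q)⁻¹ : ℝ) : ℂ)) s a
  rw [h.2, abs_of_pos ha] at this
  rw [this, Complex.real_smul]
  push_cast
  rw [div_mul_eq_div_div_swap, inv_mul_eq_div]

theorem integrableOn_rpow_div_one_add_rpow_pow (q : ℕ) {a σ : ℝ} (ha : 0 < a) (hs : 0 < σ)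
    (hq : σ < a * q) : IntegrableOn (fun x : ℝ => x ^ (σ - 1) / (1 + x ^ a) ^ q) (Ioi 0) := by
  have h := (hasMellin_inv_one_add_rpow_pow q ha (s := σ) (by simpa) (by simpa)).1
  refine IntegrableOn.congr_fun h.re (fun x hx => ?_) measurableSet_Ioi
  have hx' : 0 < x := hx
  simp only [smul_eq_mul]
  rw [← Complex.ofReal_one, ← Complex.ofReal_sub, ← Complex.ofReal_cpow hx'.le, ← Complex.ofReal_mul,
    div_eq_mul_inv]
  rfl

theorem integral_rpow_div_one_add_rpow_pow (q : ℕ) {a σ : ℝ} (ha : 0 < a) (hs : 0 < σ)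
    (hq : σ < a * q) : ∫ x in Ioi (0 : ℝ), x ^ (σ - 1) / (1 + x ^ a) ^ q =
      Real.Gamma (σ / a) * Real.Gamma (q - σ / a) / (a * Real.Gamma q) := by
  have h := (hasMellin_inv_one_add_rpow_pow q ha (s := σ) (by simpa) (by simpa)).2
  apply Complex.ofReal_injective
  rw [← integral_complex_ofReal]
  refine Eq.trans ?_ (h.trans ?_)
  · rw [mellin]
    refine setIntegral_congr_fun measurableSet_Ioi fun x hx => ?_
    have hx' : 0 < x := hx
    simp only [smul_eq_mul]
    rw [← Complex.ofReal_one, ← Complex.ofReal_sub, ← Complex.ofReal_cpow hx'.le, ← Complex.ofReal_mul,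
      div_eq_mul_inv]
  · push_cast
    rw [← Complex.Gamma_ofReal, ← Complex.Gamma_ofReal, ← Complex.Gamma_ofReal]
    push_cast
    rfl

end BetaIntegrals

/-! ### Convergence, continuity and a uniform formula for L_{jn}. -/

section BesselL

variable {d : ℕ} {j n : ℝ}

theorem two_mul_add_dim_lt (hn : 0 < n) (hlt : j / n + d / (2 * n) < 1) : 2 * j + d < 2 * n := by
  have : j / n + d / (2 * n) = (2 * j + d) / (2 * n) := by field_simp
  rw [this, div_lt_one (by positivity)] at hlt
  exact hlt

theorem two_mul_add_dim_pos (hd : 1 ≤ d) (hj : 0 ≤ j) : 0 < 2 * j + d := by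
  have : (1 : ℝ) ≤ d := by exact_mod_cast hd
  linarith

theorem integrableOn_besselWeight (hd : 1 ≤ d) (hn : 0 < n) (hj : 0 ≤ j)
    (hlt : j / n + d / (2 * n) < 1) :
    IntegrableOn (fun ξ : ℝ => ξ ^ ((d : ℝ) + 2 * j - 1) / (1 + ξ ^ (2 * n))) (Ioi 0) := by
  have h := integrableOn_rpow_div_one_add_rpow_pow 1 (a := 2 * n) (σ := d + 2 * j) (by positivity)
    (by linarith [two_mul_add_dim_pos hd hj]) (by push_cast; linarith [two_mul_add_dim_lt hn hlt])
  simpa using h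

theorem sin_pi_mul_pos {a : ℝ} (h0 : 0 < a) (h1 : a < 1) : 0 < Real.sin (Real.pi * a) :=
  Real.sin_pos_of_pos_of_lt_pi (by have := Real.pi_pos; positivity)
    (by have := Real.pi_pos; nlinarith)

theorem integral_besselWeight (hd : 1 ≤ d) (hn : 0 < n) (hj : 0 ≤ j)
    (hlt : j / n + d / (2 * n) < 1) :
    ∫ ξ in Ioi (0 : ℝ), ξ ^ ((d : ℝ) + 2 * j - 1) / (1 + ξ ^ (2 * n)) =
      Real.pi / (2 * n * Real.sin (Real.pi * ((2 * j + d) / (2 * n)))) := by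
  have h := integral_rpow_div_one_add_rpow_pow 1 (a := 2 * n) (σ := d + 2 * j) (by positivity)
    (by linarith [two_mul_add_dim_pos hd hj]) (by push_cast; linarith [two_mul_add_dim_lt hn hlt])
  simp only [pow_one, Nat.cast_one, Real.Gamma_one, mul_one] at h
  rw [h, Real.Gamma_mul_Gamma_one_sub, add_comm (d : ℝ), div_div, mul_comm (2 * n)]

theorem integrableOn_besselEntire_mul_weight (hd : 1 ≤ d) (hn : 0 < n) (hj : 0 ≤ j)
    (hlt : j / n + d / (2 * n) < 1) (ρ : ℝ) :
    IntegrableOn (fun ξ : ℝ => besselEntire d (ρ * ξ) *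
      (ξ ^ ((d : ℝ) + 2 * j - 1) / (1 + ξ ^ (2 * n)))) (Ioi 0) := by
  refine (integrableOn_besselWeight hd hn hj hlt).bdd_mul (c := (Real.Gamma ((d : ℝ) / 2))⁻¹) ?_ ?_
  · exact ((continuous_besselEntire hd).comp (continuous_const.mul continuous_id)).aestronglyMeasurable
  · exact Eventually.of_forall fun ξ => abs_besselEntire_le hd _

theorem besselL_integrand_eq {ρ : ℝ} (hρ : 0 < ρ) {ξ : ℝ} (hξ : 0 < ξ) :
    besselJ ((d : ℝ) / 2 - 1) (ρ * ξ) / (ρ * ξ) ^ ((d : ℝ) / 2 - 1)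
        * (ξ ^ ((d : ℝ) + 2 * j - 1) / (1 + ξ ^ (2 * n))) =
      2 ^ (1 - (d : ℝ) / 2) * (besselEntire d (ρ * ξ) *
      (ξ ^ ((d : ℝ) + 2 * j - 1) / (1 + ξ ^ (2 * n)))) := by
  rw [besselJ_div_rpow (mul_pos hρ hξ), mul_assoc]

theorem integrableOn_besselL_integrand (hd : 1 ≤ d) (hn : 0 < n) (hj : 0 ≤ j)
    (hlt : j / n + d / (2 * n) < 1) {ρ : ℝ} (hρ : 0 < ρ) :
    IntegrableOn (fun ξ : ℝ =>
      besselJ ((d : ℝ) / 2 - 1) (ρ * ξ) / (ρ * ξ) ^ ((d : ℝ) / 2 - 1)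
        * (ξ ^ ((d : ℝ) + 2 * j - 1) / (1 + ξ ^ (2 * n)))) (Ioi 0) := by
  refine IntegrableOn.congr_fun ((integrableOn_besselEntire_mul_weight hd hn hj hlt ρ).const_mul
    (2 ^ (1 - (d : ℝ) / 2))) (fun ξ hξ => ?_) measurableSet_Ioi
  exact (besselL_integrand_eq hρ hξ).symm

/-- One formula valid up to ρ = 0: there `besselEntire` is 1/Γ(d/2), and the remaining beta integral
gives exactly the value prescribed for L_{jn}(0). -/
theorem besselL_eq_integral (hd : 1 ≤ d) (hn : 0 < n) (hj : 0 ≤ j)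
    (hlt : j / n + d / (2 * n) < 1) {ρ : ℝ} (hρ : 0 ≤ ρ) :
    besselL d j n ρ = 2 ^ (1 - (d : ℝ) / 2) * ∫ ξ in Ioi (0 : ℝ), besselEntire d (ρ * ξ) *
      (ξ ^ ((d : ℝ) + 2 * j - 1) / (1 + ξ ^ (2 * n))) := by
  rcases hρ.eq_or_lt with rfl | hρ
  · simp only [besselL, if_true, zero_mul, besselEntire_zero]
    rw [integral_const_mul, integral_besselWeight hd hn hj hlt, Real.rpow_sub (by norm_num), Real.rpow_one]
    field_simp
  · rw [besselL, if_neg hρ.ne', ← integral_const_mul]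
    exact setIntegral_congr_fun measurableSet_Ioi fun ξ hξ => besselL_integrand_eq hρ hξ

/-- Dominated convergence: the Bessel factor is bounded and the weight is integrable. -/
theorem continuousOn_besselL (hd : 1 ≤ d) (hn : 0 < n) (hj : 0 ≤ j)
    (hlt : j / n + d / (2 * n) < 1) : ContinuousOn (besselL d j n) (Ici 0) := by
  have h : Continuous fun ρ : ℝ => 2 ^ (1 - (d : ℝ) / 2) * ∫ ξ in Ioi (0 : ℝ), besselEntire d (ρ * ξ) *
      (ξ ^ ((d : ℝ) + 2 * j - 1) / (1 + ξ ^ (2 * n))) := by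
    refine continuous_const.mul (continuous_of_dominated (bound := fun ξ =>
      (Real.Gamma ((d : ℝ) / 2))⁻¹ * ‖ξ ^ ((d : ℝ) + 2 * j - 1) / (1 + ξ ^ (2 * n))‖)
      (fun ρ => (integrableOn_besselEntire_mul_weight hd hn hj hlt ρ).1) (fun ρ => ?_) ?_ ?_)
    · refine Eventually.of_forall fun ξ => ?_
      rw [norm_mul]
      exact mul_le_mul_of_nonneg_right (abs_besselEntire_le hd _) (norm_nonneg _)
    · exact (integrableOn_besselWeight hd hn hj hlt).norm.const_mul _
    · refine Eventually.of_forall fun ξ => ?_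
      exact ((continuous_besselEntire hd).comp (continuous_id.mul continuous_const)).mul
        continuous_const
  exact h.continuousOn.congr fun ρ hρ => besselL_eq_integral hd hn hj hlt hρ

theorem integrable_radial_iff (hd : 1 ≤ d) {f : ℝ → ℝ} :
    Integrable (fun k : EuclideanSpace ℝ (Fin d) => f ‖k‖) ↔
      IntegrableOn (fun r : ℝ => r ^ ((d : ℝ) - 1) * f r) (Ioi 0) := by
  have : Nonempty (Fin d) := ⟨⟨0, hd⟩⟩
  rw [integrable_fun_norm_addHaar (volume : Measure (EuclideanSpace ℝ (Fin d)))]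
  refine integrableOn_congr_fun (fun r hr => ?_) measurableSet_Ioi
  simp only [finrank_euclideanSpace, Fintype.card_fin, smul_eq_mul]
  rw [← Real.rpow_natCast, Nat.cast_sub hd, Nat.cast_one]

theorem integral_radial (hd : 1 ≤ d) (f : ℝ → ℝ) :
    ∫ k : EuclideanSpace ℝ (Fin d), f ‖k‖ = 2 * Real.pi ^ ((d : ℝ) / 2) / Real.Gamma ((d : ℝ) / 2) *
      ∫ r in Ioi (0 : ℝ), r ^ ((d : ℝ) - 1) * f r := by
  have : Nonempty (Fin d) := ⟨⟨0, hd⟩⟩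
  have h1 := toSphere_real_univ hd
  rw [Measure.toSphere_real_apply_univ] at h1
  rw [integral_fun_norm_addHaar (volume : Measure (EuclideanSpace ℝ (Fin d))), ← h1, nsmul_eq_mul,
    smul_eq_mul, mul_assoc]
  congr 2
  refine setIntegral_congr_fun measurableSet_Ioi fun r hr => ?_
  simp only [finrank_euclideanSpace, Fintype.card_fin, smul_eq_mul]
  rw [← Real.rpow_natCast, Nat.cast_sub hd, Nat.cast_one]

end BesselL

/-! ### Cauchy–Schwarz and squared L² norms. -/

theorem integral_mul_le_sqrt_mul_sqrt {α : Type*} [MeasurableSpace α] {μ : Measure α} {u v : α → ℝ}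
    (hu0 : ∀ x, 0 ≤ u x) (hv0 : ∀ x, 0 ≤ v x) (hu : MemLp u 2 μ) (hv : MemLp v 2 μ) :
    ∫ x, u x * v x ∂μ ≤ Real.sqrt (∫ x, u x ^ 2 ∂μ) * Real.sqrt (∫ x, v x ^ 2 ∂μ) := by
  have h := integral_mul_le_Lp_mul_Lq_of_nonneg (μ := μ) Real.HolderConjugate.two_two
    (Eventually.of_forall hu0) (Eventually.of_forall hv0) (by simpa using hu) (by simpa using hv)
  simpa [Real.sqrt_eq_rpow] using h

theorem sq_toReal_eLpNorm_two {α : Type*} [MeasurableSpace α] {μ : Measure α} {f : α → ℂ}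
    (hf : MemLp f 2 μ) : (eLpNorm f 2 μ).toReal ^ 2 = ∫ x, ‖f x‖ ^ 2 ∂μ := by
  have h0 : 0 ≤ ∫ x, ‖f x‖ ^ 2 ∂μ := integral_nonneg fun _ => by positivity
  rw [hf.eLpNorm_eq_integral_rpow_norm two_ne_zero ENNReal.ofNat_ne_top,
    ENNReal.toReal_ofReal (by positivity)]
  simp only [ENNReal.toReal_ofNat, Real.rpow_ofNat]
  rw [← one_div, ← Real.sqrt_eq_rpow, Real.sq_sqrt h0]

/-! ### Integrals of dilated radial functions of the wave number 2π‖k‖. -/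

section Scaling

variable {d : ℕ}

theorem integrable_radial_scaled (hd : 1 ≤ d) {lam : ℝ} (hl : 0 < lam) {G : ℝ → ℝ}
    (hG : IntegrableOn (fun ξ : ℝ => ξ ^ ((d : ℝ) - 1) * G ξ) (Ioi 0)) :
    Integrable fun k : EuclideanSpace ℝ (Fin d) => G (2 * Real.pi * ‖k‖ / lam) := by
  have hc : 0 < 2 * Real.pi / lam := by have := Real.pi_pos; positivity
  rw [integrable_radial_iff hd (f := fun t => G (2 * Real.pi * t / lam))]
  have h := (integrableOn_Ioi_comp_mul_left_iff (fun ξ : ℝ => ξ ^ ((d : ℝ) - 1) * G ξ) 0 hc).2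
    (by rwa [mul_zero])
  refine IntegrableOn.congr_fun (h.const_mul ((2 * Real.pi / lam) ^ (-((d : ℝ) - 1)))) (fun r hr => ?_)
    measurableSet_Ioi
  have hr' : 0 < r := hr
  rw [Real.mul_rpow hc.le hr'.le, Real.rpow_neg hc.le, show 2 * Real.pi * r / lam =
    2 * Real.pi / lam * r by ring]
  have := (Real.rpow_pos_of_pos hc ((d : ℝ) - 1)).ne'
  field_simp

theorem setIntegral_scaled (d : ℕ) {E : Type*} [NormedAddCommGroup E] [NormedSpace ℝ E]
    {lam : ℝ} (hl : 0 < lam) (G : ℝ → E) :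
    ∫ r in Ioi (0 : ℝ), r ^ ((d : ℝ) - 1) • G (2 * Real.pi * r / lam) =
      (lam / (2 * Real.pi)) ^ (d : ℝ) • ∫ ξ in Ioi (0 : ℝ), ξ ^ ((d : ℝ) - 1) • G ξ := by
  have hc : 0 < 2 * Real.pi / lam := by have := Real.pi_pos; positivity
  have h := integral_comp_mul_left_Ioi (fun ξ : ℝ => ξ ^ ((d : ℝ) - 1) • G ξ) 0 hc
  rw [mul_zero] at h
  have h2 : (lam / (2 * Real.pi)) ^ (d : ℝ) =
      (2 * Real.pi / lam) ^ (-((d : ℝ) - 1)) * (2 * Real.pi / lam)⁻¹ := by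
    rw [← Real.rpow_neg_one (2 * Real.pi / lam), ← Real.rpow_add hc, ← inv_div, Real.inv_rpow hc.le,
      ← Real.rpow_neg hc.le]
    congr 1
    ring
  rw [h2, mul_smul, ← h, ← integral_smul]
  refine setIntegral_congr_fun measurableSet_Ioi fun r hr => ?_
  have hr' : 0 < r := hr
  rw [Real.mul_rpow hc.le hr'.le, Real.rpow_neg hc.le, show 2 * Real.pi * r / lam =
    2 * Real.pi / lam * r by ring, smul_smul, ← mul_assoc, inv_mul_cancel₀
    (Real.rpow_pos_of_pos hc ((d : ℝ) - 1)).ne', one_mul]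

theorem integral_radial_scaled (hd : 1 ≤ d) {lam : ℝ} (hl : 0 < lam) (G : ℝ → ℝ) :
    ∫ k : EuclideanSpace ℝ (Fin d), G (2 * Real.pi * ‖k‖ / lam) =
      2 * Real.pi ^ ((d : ℝ) / 2) / Real.Gamma ((d : ℝ) / 2) * ((lam / (2 * Real.pi)) ^ (d : ℝ) *
      ∫ ξ in Ioi (0 : ℝ), ξ ^ ((d : ℝ) - 1) * G ξ) := by
  rw [integral_radial hd (fun t => G (2 * Real.pi * t / lam))]
  have := setIntegral_scaled d hl G
  simp only [smul_eq_mul] at this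
  rw [this]

end Scaling

/-! ### Construction of D^j f with its L² and sup bounds. -/

section UpperBound

variable {d : ℕ} {j n : ℝ}

theorem rpow_sq_le_one_add (hj : 0 ≤ j) (hjn : j ≤ n) {t : ℝ} (ht : 0 ≤ t) :
    (t ^ j) ^ 2 ≤ 1 + (t ^ n) ^ 2 := by
  have h1 : 0 ≤ t ^ j := Real.rpow_nonneg ht _
  have h2 : 0 ≤ t ^ n := Real.rpow_nonneg ht _
  rcases le_total t 1 with h | h
  · have : t ^ j ≤ 1 := Real.rpow_le_one ht h hj
    nlinarith
  · have : t ^ j ≤ t ^ n := Real.rpow_le_rpow_of_exponent_le h hjn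
    nlinarith

theorem continuous_symbol (hj : 0 ≤ j) :
    Continuous fun k : EuclideanSpace ℝ (Fin d) => (2 * Real.pi * ‖k‖) ^ j :=
  (continuous_const.mul continuous_norm).rpow_const fun _ => Or.inr hj

theorem integrable_symbol_ratio (hd : 1 ≤ d) (hn : 0 < n) (hj : 0 ≤ j)
    (hlt : j / n + d / (2 * n) < 1) :
    Integrable fun k : EuclideanSpace ℝ (Fin d) =>
      ((2 * Real.pi * ‖k‖) ^ j) ^ 2 / (1 + ((2 * Real.pi * ‖k‖) ^ n) ^ 2) := by
  have h := integrable_radial_scaled hd one_pos (G := fun t => (t ^ j) ^ 2 / (1 + (t ^ n) ^ 2))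
    (IntegrableOn.congr_fun (integrableOn_besselWeight hd hn hj hlt) (fun ξ hξ => ?_) measurableSet_Ioi)
  · simpa using h
  · have hξ' : 0 < ξ := hξ
    rw [← Real.rpow_mul_natCast hξ'.le, ← Real.rpow_mul_natCast hξ'.le, ← mul_div_assoc,
      ← Real.rpow_add hξ']
    push_cast
    congr 2
    · ring
    · rw [mul_comm]

theorem integral_symbol_ratio (hd : 1 ≤ d) (hn : 0 < n) (hj : 0 ≤ j)
    (hlt : j / n + d / (2 * n) < 1) :
    ∫ k : EuclideanSpace ℝ (Fin d),
      ((2 * Real.pi * ‖k‖) ^ j) ^ 2 / (1 + ((2 * Real.pi * ‖k‖) ^ n) ^ 2) =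
    2 * Real.pi ^ ((d : ℝ) / 2) / Real.Gamma ((d : ℝ) / 2) * ((1 / (2 * Real.pi)) ^ (d : ℝ) *
      (Real.pi / (2 * n * Real.sin (Real.pi * ((2 * j + d) / (2 * n)))))) := by
  have h := integral_radial_scaled hd one_pos (fun t => (t ^ j) ^ 2 / (1 + (t ^ n) ^ 2))
  simp only [div_one] at h
  rw [h, ← integral_besselWeight hd hn hj hlt]
  congr 2
  refine setIntegral_congr_fun measurableSet_Ioi fun ξ hξ => ?_
  have hξ' : 0 < ξ := hξ
  rw [← Real.rpow_mul_natCast hξ'.le, ← Real.rpow_mul_natCast hξ'.le, ← mul_div_assoc,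
    ← Real.rpow_add hξ']
  push_cast
  congr 2
  · ring
  · rw [mul_comm]

/-- The function is 𝓕⁻¹(T f̂) with T = |2πk|^j. The energy is ∫ W |f̂|² with W = 1 + |2πk|^{2n}; T²
≤ W gives the L² bound and Cauchy–Schwarz gives the L¹ bound on T f̂, hence continuity, decay and
the sup bound. -/
theorem exists_fracLaplacian_of_le (hd : 1 ≤ d) (hn : 0 < n) (hj : 0 ≤ j) (hjn : j ≤ n)
    (hlt : j / n + d / (2 * n) < 1) {f Dnf : EuclideanSpace ℝ (Fin d) → ℂ} (hf : MemLp f 2)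
    (hDnf : MemLp Dnf 2) (h : IsFracLaplacian n f Dnf) :
    ∃ Djf : EuclideanSpace ℝ (Fin d) → ℂ, Continuous Djf ∧
      Tendsto Djf (cocompact (EuclideanSpace ℝ (Fin d))) (𝓝 0) ∧ MemLp Djf 2 ∧
      IsFracLaplacian j f Djf ∧
      boldNorm 2 Djf ≤ Real.sqrt (boldNorm 2 f ^ 2 + boldNorm 2 Dnf ^ 2) ∧
      ∀ x, ‖Djf x‖ ≤ Real.sqrt (∫ k : EuclideanSpace ℝ (Fin d),
          ((2 * Real.pi * ‖k‖) ^ j) ^ 2 / (1 + ((2 * Real.pi * ‖k‖) ^ n) ^ 2)) *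
        Real.sqrt (boldNorm 2 f ^ 2 + boldNorm 2 Dnf ^ 2) := by
  obtain ⟨fh, hfh, hfn, hfp⟩ := exists_fourier_memLp_two hf
  obtain ⟨gh, hgh, hgn, hgp⟩ := exists_fourier_memLp_two hDnf
  have hae := ae_eq_of_isFracLaplacian hn.le hd (hfh.locallyIntegrable (by norm_num))
    (hgh.locallyIntegrable (by norm_num)) hfp hgp h
  set W : EuclideanSpace ℝ (Fin d) → ℝ := fun k => 1 + ((2 * Real.pi * ‖k‖) ^ n) ^ 2 with hW
  set T : EuclideanSpace ℝ (Fin d) → ℝ := fun k => (2 * Real.pi * ‖k‖) ^ j with hT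
  have hWpos : ∀ k, 0 < W k := fun k => by positivity
  have hTnn : ∀ k, 0 ≤ T k := fun k => by positivity
  have hTc : Continuous T := continuous_symbol hj
  have hWc : Continuous W := continuous_const.add ((continuous_symbol hn.le).pow 2)
  have hTW : ∀ k, T k ^ 2 ≤ W k := fun k => rpow_sq_le_one_add hj hjn (by positivity)
  have i1 : Integrable fun k => ‖fh k‖ ^ 2 := (memLp_two_iff_integrable_sq_norm hfh.1).1 hfh
  have i2 : Integrable fun k => ‖gh k‖ ^ 2 := (memLp_two_iff_integrable_sq_norm hgh.1).1 hgh
  have hWae : (fun k => ‖fh k‖ ^ 2 + ‖gh k‖ ^ 2) =ᵐ[volume] fun k => W k * ‖fh k‖ ^ 2 := by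
    filter_upwards [hae] with k hk
    rw [hk, norm_mul, Complex.norm_real, Real.norm_of_nonneg (by positivity)]
    simp only [hW]
    ring
  have iW : Integrable fun k => W k * ‖fh k‖ ^ 2 := (i1.add i2).congr hWae
  have hE : ∫ k, W k * ‖fh k‖ ^ 2 = boldNorm 2 f ^ 2 + boldNorm 2 Dnf ^ 2 := by
    rw [boldNorm, boldNorm, ← hfn, ← hgn, sq_toReal_eLpNorm_two hfh, sq_toReal_eLpNorm_two hgh,
      ← integral_add i1 i2]
    exact (integral_congr_ae hWae).symm
  rw [← hE]
  set p : EuclideanSpace ℝ (Fin d) → ℂ := fun k => (T k : ℂ) * fh k with hp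
  have hpm : AEStronglyMeasurable p := (Complex.continuous_ofReal.comp hTc).aestronglyMeasurable.mul hfh.1
  have hpsq : ∀ k, ‖p k‖ ^ 2 ≤ W k * ‖fh k‖ ^ 2 := fun k => by
    rw [hp, norm_mul, Complex.norm_real, Real.norm_of_nonneg (hTnn k), mul_pow]
    exact mul_le_mul_of_nonneg_right (hTW k) (by positivity)
  have hp2i : Integrable fun k => ‖p k‖ ^ 2 :=
    iW.mono' (hpm.norm.pow 2) (Eventually.of_forall fun k => by
      rw [Real.norm_of_nonneg (by positivity)]; exact hpsq k)
  have hp2 : MemLp p 2 := (memLp_two_iff_integrable_sq_norm hpm).2 hp2i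
  -- The factorisation |T f̂| = (T/√W)(√W |f̂|): the first factor is in L² because a < 1, the second
  -- because the energy is finite.
  set u : EuclideanSpace ℝ (Fin d) → ℝ := fun k => T k / Real.sqrt (W k)
  set v : EuclideanSpace ℝ (Fin d) → ℝ := fun k => Real.sqrt (W k) * ‖fh k‖
  have husq : ∀ k, u k ^ 2 = T k ^ 2 / W k := fun k => by
    simp only [u, div_pow, Real.sq_sqrt (hWpos k).le]
  have hvsq : ∀ k, v k ^ 2 = W k * ‖fh k‖ ^ 2 := fun k => by
    simp only [v, mul_pow, Real.sq_sqrt (hWpos k).le]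
  have huv : ∀ k, u k * v k = ‖p k‖ := fun k => by
    simp only [u, v, hp, norm_mul, Complex.norm_real, Real.norm_of_nonneg (hTnn k)]
    have := Real.sqrt_pos.2 (hWpos k)
    field_simp
  have hum : MemLp u 2 := by
    refine (memLp_two_iff_integrable_sq (Continuous.aestronglyMeasurable ?_)).2 ?_
    · exact hTc.div (Real.continuous_sqrt.comp hWc) fun k => (Real.sqrt_pos.2 (hWpos k)).ne'
    · simp_rw [husq]
      exact integrable_symbol_ratio hd hn hj hlt
  have hvm : MemLp v 2 := by
    refine (memLp_two_iff_integrable_sq ?_).2 ?_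
    · exact (Real.continuous_sqrt.comp hWc).aestronglyMeasurable.mul hfh.1.norm
    · simp_rw [hvsq]
      exact iW
  have hp1 : Integrable p := by
    rw [← integrable_norm_iff hpm]
    simp_rw [← huv]
    exact hum.integrable_mul hvm
  have hbound : ∫ k, ‖p k‖ ≤ Real.sqrt (∫ k, T k ^ 2 / W k) * Real.sqrt (∫ k, W k * ‖fh k‖ ^ 2) := by
    have := integral_mul_le_sqrt_mul_sqrt (μ := volume) (u := u) (v := v)
      (fun k => div_nonneg (hTnn k) (Real.sqrt_nonneg _))
      (fun k => mul_nonneg (Real.sqrt_nonneg _) (norm_nonneg _)) hum hvm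
    simpa only [huv, husq, hvsq] using this
  obtain ⟨hm, hmn⟩ := memLp_two_fourierInv hp1 hp2
  refine ⟨𝓕⁻ p, continuous_fourierInv hp1, tendsto_fourierInv_cocompact p, hm, ?_, ?_, fun x => ?_⟩
  · exact isFracLaplacian_of_ae_eq hfp (integral_fourierInv_mul_schwartz hp1) (EventuallyEq.refl _ _)
  · apply Real.le_sqrt_of_sq_le
    rw [boldNorm, hmn, sq_toReal_eLpNorm_two hp2]
    exact integral_mono hp2i iW hpsq
  · exact (norm_fourierInv_le x).trans hbound

end UpperBound

/-! ### The exponent r. -/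

section Exponent

variable {d : ℕ} {j n θ : ℝ}

theorem sobolev_inv_exponent_nonneg (hd : 1 ≤ d) (hn : 0 < n) (hθ₂ : θ ≤ j / n + d / (2 * n)) :
    0 ≤ 1 / 2 - (θ * n - j) / d := by
  have hd' : (1 : ℝ) ≤ d := by exact_mod_cast hd
  have : j / n + d / (2 * n) = (2 * j + d) / (2 * n) := by field_simp
  rw [this, le_div_iff₀ (by positivity)] at hθ₂
  rw [sub_nonneg, div_le_iff₀ (by linarith)]
  linarith

theorem sobolev_inv_exponent_pos (hd : 1 ≤ d) (hn : 0 < n) (hθ₂ : θ < j / n + d / (2 * n)) :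
    0 < 1 / 2 - (θ * n - j) / d := by
  have hd' : (1 : ℝ) ≤ d := by exact_mod_cast hd
  have : j / n + d / (2 * n) = (2 * j + d) / (2 * n) := by field_simp
  rw [this, lt_div_iff₀ (by positivity)] at hθ₂
  rw [sub_pos, div_lt_iff₀ (by linarith)]
  linarith

theorem sobolev_inv_exponent_le (hn : 0 < n) (hθ₁ : j / n ≤ θ) :
    1 / 2 - (θ * n - j) / d ≤ 1 / 2 := by
  rw [div_le_iff₀ hn] at hθ₁
  have : 0 ≤ (θ * n - j) / d := div_nonneg (by linarith) (Nat.cast_nonneg d)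
  linarith

theorem two_le_sobolevExponent (hn : 0 < n) (hθ₁ : j / n ≤ θ) : 2 ≤ sobolevExponent d j n θ := by
  rw [sobolevExponent, ENNReal.le_inv_iff_le_inv]
  refine (ENNReal.ofReal_le_ofReal (sobolev_inv_exponent_le (d := d) hn hθ₁)).trans ?_
  rw [one_div, ENNReal.ofReal_inv_of_pos (by norm_num)]
  simp

theorem sobolevExponent_eq_top (hd : 1 ≤ d) (hn : 0 < n) (hθ : θ = j / n + d / (2 * n)) :
    sobolevExponent d j n θ = ∞ := by
  have hd' : (1 : ℝ) ≤ d := by exact_mod_cast hd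
  have : (θ * n - j) / d = 1 / 2 := by rw [hθ]; field_simp; ring
  rw [sobolevExponent, this]
  simp

theorem sobolevExponent_ne_top (hd : 1 ≤ d) (hn : 0 < n) (hθ₂ : θ < j / n + d / (2 * n)) :
    sobolevExponent d j n θ ≠ ∞ := by
  have := sobolev_inv_exponent_pos hd hn hθ₂
  rw [sobolevExponent]
  simpa using this

theorem toReal_sobolevExponent (hd : 1 ≤ d) (hn : 0 < n) (hθ₂ : θ ≤ j / n + d / (2 * n)) :
    (sobolevExponent d j n θ).toReal = (1 / 2 - (θ * n - j) / d)⁻¹ := by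
  rw [sobolevExponent, ENNReal.toReal_inv,
    ENNReal.toReal_ofReal (sobolev_inv_exponent_nonneg hd hn hθ₂)]

theorem sobolevExponent_zero (hn : 0 < n) (hj : 0 ≤ j) (hθ₁ : j / n ≤ θ) (hθ : θ = 0) :
    j = 0 ∧ sobolevExponent d j n θ = 2 := by
  have hj0 : j = 0 := by
    rw [hθ, div_le_iff₀ hn, zero_mul] at hθ₁
    exact le_antisymm hθ₁ hj
  refine ⟨hj0, ?_⟩
  rw [sobolevExponent, hθ, hj0]
  simp only [zero_mul, sub_zero, zero_div]
  rw [one_div, ENNReal.ofReal_inv_of_pos (by norm_num)]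
  simp

end Exponent

/-! ### Admissible constants. -/

section SobolevConstants

variable {d : ℕ} {j n θ : ℝ}

/-- Interpolation between L² and L^∞: for finite r, ∫|D|^r ≤ M^{r-2} ∫|D|² ≤ B^r. -/
theorem memBoldL_of_bounded {p : ℝ≥0∞} (hp : 2 ≤ p) {D : EuclideanSpace ℝ (Fin d) → ℂ} {M B : ℝ}
    (hc : Continuous D) (ht : Tendsto D (cocompact (EuclideanSpace ℝ (Fin d))) (𝓝 0))
    (h2 : MemLp D 2) (hM : ∀ x, ‖D x‖ ≤ M) (hMB : M ≤ B) (h2B : boldNorm 2 D ≤ B) :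
    MemBoldL p D ∧ boldNorm p D ≤ B := by
  have hM0 : 0 ≤ M := (norm_nonneg _).trans (hM 0)
  have hB0 : 0 ≤ B := hM0.trans hMB
  by_cases hpt : p = ∞
  · subst hpt
    refine ⟨⟨memLp_top_of_bound hc.aestronglyMeasurable M (Eventually.of_forall hM), fun _ => ⟨hc, ht⟩⟩, ?_⟩
    refine ENNReal.toReal_le_of_le_ofReal hB0 ?_
    rw [eLpNorm_exponent_top]
    refine eLpNormEssSup_le_of_ae_bound (Eventually.of_forall fun x => (hM x).trans hMB)
  have hp0 : p ≠ 0 := fun h => by simp [h] at hp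
  set r := p.toReal
  have hr : 2 ≤ r := by
    have := (ENNReal.toReal_le_toReal ENNReal.ofNat_ne_top hpt).2 hp
    simpa using this
  have hi2 : Integrable fun x => ‖D x‖ ^ 2 :=
    (memLp_two_iff_integrable_sq_norm hc.aestronglyMeasurable).1 h2
  have hle : ∀ x, ‖D x‖ ^ r ≤ M ^ (r - 2) * ‖D x‖ ^ 2 := fun x => by
    rw [← Real.rpow_natCast, ← sub_add_cancel r 2, Nat.cast_ofNat,
      Real.rpow_add_of_nonneg (norm_nonneg _) (by linarith) (by norm_num), add_sub_cancel_right]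
    gcongr
    exact hM x
  have hir : Integrable fun x => ‖D x‖ ^ r := by
    refine (hi2.const_mul (M ^ (r - 2))).mono' ?_ ?_
    · exact (hc.norm.rpow_const fun _ => Or.inr (by linarith)).aestronglyMeasurable
    · refine Eventually.of_forall fun x => ?_
      rw [Real.norm_of_nonneg (by positivity)]
      exact hle x
  have hmem : MemLp D p := (integrable_norm_rpow_iff hc.aestronglyMeasurable hp0 hpt).1 hir
  refine ⟨⟨hmem, fun h => absurd h hpt⟩, ?_⟩
  rw [boldNorm, hmem.eLpNorm_eq_integral_rpow_norm hp0 hpt, ENNReal.toReal_ofReal (by positivity)]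
  have h2B' : ∫ x, ‖D x‖ ^ 2 ≤ B ^ 2 := by
    rw [← sq_toReal_eLpNorm_two h2]
    exact pow_le_pow_left₀ ENNReal.toReal_nonneg h2B 2
  have hint : ∫ x, ‖D x‖ ^ r ≤ B ^ r := by
    calc ∫ x, ‖D x‖ ^ r ≤ ∫ x, M ^ (r - 2) * ‖D x‖ ^ 2 := integral_mono hir (hi2.const_mul _) hle
      _ = M ^ (r - 2) * ∫ x, ‖D x‖ ^ 2 := integral_const_mul _ _
      _ ≤ B ^ (r - 2) * B ^ 2 := by
          gcongr
      _ = B ^ r := by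
          rw [← Real.rpow_natCast, Nat.cast_ofNat, ← Real.rpow_add_of_nonneg hB0 (by linarith) (by norm_num),
            sub_add_cancel]
  calc (∫ x, ‖D x‖ ^ r) ^ r⁻¹ ≤ (B ^ r) ^ r⁻¹ := by gcongr
    _ = B := Real.rpow_rpow_inv hB0 (by linarith)

/-- `‖𝓕⁻¹ (|k|^j f̂)‖_∞` is controlled by the square root of this integral. -/
noncomputable def symbolRatioIntegral (d : ℕ) (j n : ℝ) : ℝ :=
  ∫ k : EuclideanSpace ℝ (Fin d),
    ((2 * Real.pi * ‖k‖) ^ j) ^ 2 / (1 + ((2 * Real.pi * ‖k‖) ^ n) ^ 2)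

theorem mem_sobolevConstants_of_le (hd : 1 ≤ d) (hn : 0 < n) (hj : 0 ≤ j) (hjn : j ≤ n)
    (hθ₁ : j / n ≤ θ) (hlt : j / n + d / (2 * n) < 1) {C : ℝ} (h1 : 1 ≤ C)
    (hA : Real.sqrt (symbolRatioIntegral d j n) ≤ C) : C ∈ sobolevConstants d j n θ := by
  refine ⟨by linarith, fun f Dnf hf hDnf h => ?_⟩
  obtain ⟨Djf, hc, ht, h2, hfrac, hn2, hb⟩ := exists_fracLaplacian_of_le hd hn hj hjn hlt hf.1 hDnf.1 h
  have := memBoldL_of_bounded (two_le_sobolevExponent (d := d) hn hθ₁) hc ht h2 hb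
    (mul_le_mul_of_nonneg_right hA (Real.sqrt_nonneg _))
    (hn2.trans (le_mul_of_one_le_left (Real.sqrt_nonneg _) h1))
  exact ⟨Djf, this.1, hfrac, this.2⟩

theorem sobolevConstants_nonempty (hd : 1 ≤ d) (hn : 0 < n) (hj : 0 ≤ j) (hjn : j ≤ n)
    (hθ₁ : j / n ≤ θ) (hlt : j / n + d / (2 * n) < 1) : (sobolevConstants d j n θ).Nonempty :=
  ⟨max 1 _, mem_sobolevConstants_of_le hd hn hj hjn hθ₁ hlt (le_max_left _ _) (le_max_right _ _)⟩

theorem one_mem_sobolevConstants (hd : 1 ≤ d) (hn : 0 < n) (hj : 0 ≤ j) (hjn : j ≤ n)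
    (hlt : j / n + d / (2 * n) < 1) (hp : sobolevExponent d j n θ = 2) :
    1 ∈ sobolevConstants d j n θ := by
  refine ⟨zero_le_one, fun f Dnf hf hDnf h => ?_⟩
  obtain ⟨Djf, hc, ht, h2, hfrac, hn2, hb⟩ := exists_fracLaplacian_of_le hd hn hj hjn hlt hf.1 hDnf.1 h
  refine ⟨Djf, ?_, hfrac, ?_⟩
  · rw [hp]
    exact ⟨h2, fun h => by simp at h⟩
  · rwa [hp, one_mul]

theorem sqrt_mem_sobolevConstants (hd : 1 ≤ d) (hn : 0 < n) (hj : 0 ≤ j) (hjn : j ≤ n)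
    (hlt : j / n + d / (2 * n) < 1) (hp : sobolevExponent d j n θ = ∞) :
    Real.sqrt (symbolRatioIntegral d j n) ∈ sobolevConstants d j n θ := by
  refine ⟨Real.sqrt_nonneg _, fun f Dnf hf hDnf h => ?_⟩
  obtain ⟨Djf, hc, ht, h2, hfrac, hn2, hb⟩ := exists_fracLaplacian_of_le hd hn hj hjn hlt hf.1 hDnf.1 h
  refine ⟨Djf, ?_, hfrac, ?_⟩
  · rw [hp]
    exact ⟨memLp_top_of_bound hc.aestronglyMeasurable _ (Eventually.of_forall hb), fun _ => ⟨hc, ht⟩⟩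
  · rw [hp]
    refine ENNReal.toReal_le_of_le_ofReal ((norm_nonneg _).trans (hb 0)) ?_
    rw [eLpNorm_exponent_top]
    exact eLpNormEssSup_le_of_ae_bound (Eventually.of_forall hb)

end SobolevConstants

/-! ### Uniqueness of D^s f within 𝐋^r. -/

section Uniqueness

variable {d : ℕ}

/-- Truncation at height δ. If p < ∞ with r = p, then |g|² ≤ δ^{2-r} |g|^r where |g| > δ; if p = ∞,
decay at infinity puts that set in a compact one, where g is bounded. -/
theorem exists_add_of_memBoldL {p : ℝ≥0∞} (hp : 2 ≤ p) {g : EuclideanSpace ℝ (Fin d) → ℂ}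
    (hg : MemBoldL p g) {δ : ℝ} (hδ : 0 < δ) : ∃ g₁ g₂ : EuclideanSpace ℝ (Fin d) → ℂ,
      MemLp g₁ 2 ∧ AEStronglyMeasurable g₂ ∧ (∀ᵐ x, ‖g₂ x‖ ≤ δ) ∧ g =ᵐ[volume] g₁ + g₂ := by
  have main : ∀ u : EuclideanSpace ℝ (Fin d) → ℂ, StronglyMeasurable u →
      MemLp ({x | δ < ‖u x‖}.indicator u) 2 → u =ᵐ[volume] g → ∃ g₁ g₂ : EuclideanSpace ℝ (Fin d) → ℂ,
      MemLp g₁ 2 ∧ AEStronglyMeasurable g₂ ∧ (∀ᵐ x, ‖g₂ x‖ ≤ δ) ∧ g =ᵐ[volume] g₁ + g₂ := by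
    intro u hu hm hug
    have hS : MeasurableSet {x | δ < ‖u x‖} := measurableSet_lt measurable_const hu.norm.measurable
    refine ⟨_, {x | δ < ‖u x‖}ᶜ.indicator u, hm, (hu.indicator hS.compl).aestronglyMeasurable,
      Eventually.of_forall fun x => ?_, ?_⟩
    · by_cases hx : δ < ‖u x‖
      · rw [indicator_of_notMem (by simpa using hx)]
        simpa using hδ.le
      · rw [indicator_of_mem (by simpa using hx)]
        exact not_lt.1 hx
    · rw [indicator_self_add_compl]
      exact hug.symm
  by_cases hpt : p = ∞
  · obtain ⟨hc, ht⟩ := hg.2 hpt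
    refine main g hc.stronglyMeasurable ?_ (EventuallyEq.refl _ _)
    have hev : ∀ᶠ x in cocompact (EuclideanSpace ℝ (Fin d)), ‖g x‖ < δ := by
      have := ht.norm
      rw [norm_zero] at this
      exact this.eventually (gt_mem_nhds hδ)
    obtain ⟨K, hK, hKδ⟩ := mem_cocompact.1 hev
    obtain ⟨B, hB⟩ := hK.exists_bound_of_continuousOn hc.continuousOn
    have hSK : {x | δ < ‖g x‖} ⊆ K := fun x hx => by
      by_contra hxK
      have : ‖g x‖ < δ := hKδ hxK
      exact lt_asymm this hx
    have hS : MeasurableSet {x | δ < ‖g x‖} := measurableSet_lt measurable_const hc.norm.measurable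
    have hfin : IsFiniteMeasure ((volume : Measure (EuclideanSpace ℝ (Fin d))).restrict {x | δ < ‖g x‖}) :=
      ⟨by rw [Measure.restrict_apply_univ]; exact (measure_mono hSK).trans_lt hK.measure_lt_top⟩
    rw [memLp_indicator_iff_restrict hS]
    refine MemLp.of_bound hc.aestronglyMeasurable B ?_
    exact (ae_restrict_iff' hS).2 (Eventually.of_forall fun x hx => hB x (hSK hx))
  · have hp0 : p ≠ 0 := fun h => by simp [h] at hp
    set r := p.toReal
    have hr : 2 ≤ r := by
      have := (ENNReal.toReal_le_toReal ENNReal.ofNat_ne_top hpt).2 hp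
      simpa using this
    -- A strongly measurable representative, so that the superlevel set is measurable.
    set u := hg.1.1.mk g
    have hu : StronglyMeasurable u := hg.1.1.stronglyMeasurable_mk
    have hug : u =ᵐ[volume] g := hg.1.1.ae_eq_mk.symm
    refine main u hu ?_ hug
    have hS : MeasurableSet {x | δ < ‖u x‖} := measurableSet_lt measurable_const hu.norm.measurable
    have hup : MemLp u p := hg.1.ae_eq hug.symm
    have hir : Integrable fun x => ‖u x‖ ^ r := hup.integrable_norm_rpow hp0 hpt
    rw [memLp_two_iff_integrable_sq_norm (hu.indicator hS).aestronglyMeasurable]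
    refine (hir.const_mul (δ ^ (2 - r))).mono' ((hu.indicator hS).norm.pow 2).aestronglyMeasurable
      (Eventually.of_forall fun x => ?_)
    rw [Real.norm_of_nonneg (by positivity)]
    by_cases hx : δ < ‖u x‖
    · rw [indicator_of_mem (by simpa using hx)]
      have hux : 0 < ‖u x‖ := hδ.trans hx
      have e1 : ‖u x‖ ^ 2 = ‖u x‖ ^ (2 - r) * ‖u x‖ ^ r := by
        rw [← Real.rpow_add hux, sub_add_cancel, Real.rpow_ofNat]
      rw [e1]
      exact mul_le_mul_of_nonneg_right
        (Real.rpow_le_rpow_of_nonpos hδ hx.le (by linarith)) (by positivity)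
    · rw [indicator_of_notMem (by simpa using hx)]
      simp only [norm_zero, ne_eq, OfNat.ofNat_ne_zero, not_false_eq_true, zero_pow]
      positivity

/-- The difference g - D pairs to 0 with all admissible test functions and inherits the
L²-plus-small splitting of g, since D itself is in L². -/
theorem ae_eq_of_isFracLaplacian_of_memBoldL (hd : 1 ≤ d) {s : ℝ} {p : ℝ≥0∞} (hp : 2 ≤ p)
    {f g D : EuclideanSpace ℝ (Fin d) → ℂ} (hg : MemBoldL p g) (hD : MemLp D 2)
    (h1 : IsFracLaplacian s f g) (h2 : IsFracLaplacian s f D) : g =ᵐ[volume] D := by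
  have hgl : LocallyIntegrable g := hg.1.locallyIntegrable (le_trans (by norm_num) hp)
  have hDl : LocallyIntegrable D := hD.locallyIntegrable (by norm_num)
  have hint : ∀ φ : 𝓢(EuclideanSpace ℝ (Fin d), ℂ), Integrable fun x => g x * φ x := by
    intro φ
    obtain ⟨g₁, g₂, h1, h2m, h2, he⟩ := exists_add_of_memBoldL hp hg one_pos
    have i1 : Integrable fun x => g₁ x * φ x := h1.integrable_mul (φ.memLp 2)
    have i2 : Integrable fun x => g₂ x * φ x := φ.integrable.bdd_mul h2m h2
    refine (i1.add i2).congr ?_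
    filter_upwards [he] with x hx
    simp only [Pi.add_apply, hx]
    ring
  have h0 : (g - D) =ᵐ[volume] 0 := by
    refine ae_eq_zero_of_forall_isTestFracLaplacian (s := s) hd (hgl.sub hDl) (fun δ hδ => ?_)
      fun φ φ' ht => ?_
    · obtain ⟨g₁, g₂, h1, h2m, h2, he⟩ := exists_add_of_memBoldL hp hg hδ
      refine ⟨g₁ - D, g₂, h1.sub hD, h2m, h2, ?_⟩
      filter_upwards [he] with x hx
      simp only [Pi.add_apply, Pi.sub_apply, hx]
      ring
    · have e1 := h1 φ φ' ht
      have e2 := h2 φ φ' ht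
      have i2 : Integrable fun x => D x * φ x := hD.integrable_mul (φ.memLp 2)
      simp only [Pi.sub_apply, sub_mul]
      rw [integral_sub (hint φ) i2, e1, e2, sub_self]
  filter_upwards [h0] with x hx
  exact sub_eq_zero.1 hx

end Uniqueness

/-! ### The trial functions. -/

section Trial

variable {d : ℕ} {j n : ℝ}

/-- The radial symbol `ξ ^ s * ξ ^ j / (1 + ξ ^ (2 n))`. -/
noncomputable def trialSymbol (j n s ξ : ℝ) : ℝ := ξ ^ s * (ξ ^ j / (1 + ξ ^ (2 * n)))

/-- The constant `K` with `‖f‖² = (2 π)^(-d) λ^d K (1 - a)` for the trial functions. -/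
noncomputable def trialConst (d : ℕ) (j n : ℝ) : ℝ :=
  Real.pi ^ ((d : ℝ) / 2 + 1) /
    (Real.Gamma ((d : ℝ) / 2) * n * Real.sin (Real.pi * (j / n + d / (2 * n))))

theorem div_add_div_eq (hn : 0 < n) : j / n + d / (2 * n) = (2 * j + d) / (2 * n) := by
  field_simp

theorem div_add_div_pos (hd : 1 ≤ d) (hn : 0 < n) (hj : 0 ≤ j) : 0 < j / n + d / (2 * n) := by
  rw [div_add_div_eq hn]
  exact div_pos (two_mul_add_dim_pos hd hj) (by positivity)

theorem trialConst_pos (hd : 1 ≤ d) (hn : 0 < n) (hj : 0 ≤ j) (hlt : j / n + d / (2 * n) < 1) :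
    0 < trialConst d j n := by
  have h1 := Gamma_half_dim_pos hd
  have h2 := sin_pi_mul_pos (div_add_div_pos hd hn hj) hlt
  have := Real.pi_pos
  unfold trialConst
  positivity

theorem continuous_trialSymbol (hn : 0 < n) (hj : 0 ≤ j) {s : ℝ} (hs : 0 ≤ s) {lam : ℝ} (hl : 0 < lam) :
    Continuous fun k : EuclideanSpace ℝ (Fin d) => trialSymbol j n s (2 * Real.pi * ‖k‖ / lam) := by
  have hT : Continuous fun k : EuclideanSpace ℝ (Fin d) => 2 * Real.pi * ‖k‖ / lam :=
    (continuous_const.mul continuous_norm).div_const _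
  unfold trialSymbol
  refine (hT.rpow_const fun _ => Or.inr hs).mul ((hT.rpow_const fun _ => Or.inr hj).div
    (continuous_const.add (hT.rpow_const fun _ => Or.inr (by linarith))) fun k => ?_)
  have : 0 ≤ (2 * Real.pi * ‖k‖ / lam) ^ (2 * n) :=
    Real.rpow_nonneg (by have := Real.pi_pos; positivity) _
  linarith

theorem rpow_mul_trialSymbol_sq {s ξ : ℝ} (hξ : 0 < ξ) :
    ξ ^ ((d : ℝ) - 1) * trialSymbol j n s ξ ^ 2 =
      ξ ^ ((d : ℝ) + 2 * j + 2 * s - 1) / (1 + ξ ^ (2 * n)) ^ 2 := by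
  unfold trialSymbol
  rw [mul_pow, div_pow, ← Real.rpow_mul_natCast hξ.le, ← Real.rpow_mul_natCast hξ.le,
    ← mul_div_assoc, ← mul_div_assoc, ← Real.rpow_add hξ, ← Real.rpow_add hξ]
  congr 2
  push_cast
  ring

/-- A beta integral with q = 2. It converges because 0 ≤ s ≤ n and a < 1 keep d + 2j + 2s between 0
and 4n. -/
theorem integral_trialSymbol_sq (hd : 1 ≤ d) (hn : 0 < n) (hj : 0 ≤ j)
    (hlt : j / n + d / (2 * n) < 1) {s : ℝ} (hs : 0 ≤ s) (hsn : s ≤ n) {lam : ℝ} (hl : 0 < lam) :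
    MemLp (fun k : EuclideanSpace ℝ (Fin d) =>
        ((trialSymbol j n s (2 * Real.pi * ‖k‖ / lam) : ℝ) : ℂ)) 2 ∧
      ∫ k : EuclideanSpace ℝ (Fin d), trialSymbol j n s (2 * Real.pi * ‖k‖ / lam) ^ 2 =
        2 * Real.pi ^ ((d : ℝ) / 2) / Real.Gamma ((d : ℝ) / 2) * ((lam / (2 * Real.pi)) ^ (d : ℝ) *
          (Real.Gamma ((d + 2 * j + 2 * s) / (2 * n)) *
            Real.Gamma (2 - (d + 2 * j + 2 * s) / (2 * n)) / (2 * n))) := by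
  have h1 := two_mul_add_dim_pos hd hj
  have h2 := two_mul_add_dim_lt hn hlt
  have hI := integrableOn_rpow_div_one_add_rpow_pow 2 (a := 2 * n) (σ := d + 2 * j + 2 * s)
    (by positivity) (by linarith) (by push_cast; linarith)
  have hV := integral_rpow_div_one_add_rpow_pow 2 (a := 2 * n) (σ := d + 2 * j + 2 * s)
    (by positivity) (by linarith) (by push_cast; linarith)
  constructor
  · have hc : Continuous fun k : EuclideanSpace ℝ (Fin d) =>
        ((trialSymbol j n s (2 * Real.pi * ‖k‖ / lam) : ℝ) : ℂ) :=
      Complex.continuous_ofReal.comp (continuous_trialSymbol hn hj hs hl)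
    rw [memLp_two_iff_integrable_sq_norm hc.aestronglyMeasurable]
    simp only [Complex.norm_real, Real.norm_eq_abs, sq_abs]
    refine integrable_radial_scaled hd hl (G := fun ξ => trialSymbol j n s ξ ^ 2)
      (hI.congr_fun (fun ξ hξ => ?_) measurableSet_Ioi)
    exact (rpow_mul_trialSymbol_sq hξ).symm
  · rw [integral_radial_scaled hd hl (fun ξ => trialSymbol j n s ξ ^ 2)]
    congr 2
    rw [setIntegral_congr_fun measurableSet_Ioi (fun ξ hξ => rpow_mul_trialSymbol_sq hξ), hV]
    norm_num

theorem integrable_trialSymbol (hd : 1 ≤ d) (hn : 0 < n) (hj : 0 ≤ j)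
    (hlt : j / n + d / (2 * n) < 1) {lam : ℝ} (hl : 0 < lam) :
    Integrable fun k : EuclideanSpace ℝ (Fin d) => trialSymbol j n j (2 * Real.pi * ‖k‖ / lam) := by
  refine integrable_radial_scaled hd hl (G := fun ξ => trialSymbol j n j ξ)
    ((integrableOn_besselWeight hd hn hj hlt).congr_fun (fun ξ hξ => ?_) measurableSet_Ioi)
  have hξ' : 0 < ξ := hξ
  simp only [trialSymbol]
  rw [← mul_div_assoc, ← mul_div_assoc, ← Real.rpow_add hξ', ← Real.rpow_add hξ']
  congr 2
  ring

theorem fourierInv_trialSymbol (hd : 1 ≤ d) (hn : 0 < n) (hj : 0 ≤ j)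
    (hlt : j / n + d / (2 * n) < 1) {lam : ℝ} (hl : 0 < lam) (x : EuclideanSpace ℝ (Fin d)) :
    𝓕⁻ (fun k : EuclideanSpace ℝ (Fin d) =>
        ((trialSymbol j n j (2 * Real.pi * ‖k‖ / lam) : ℝ) : ℂ)) x =
      (((2 * Real.pi) ^ (-((d : ℝ) / 2)) * lam ^ (d : ℝ) * besselL d j n (lam * ‖x‖) : ℝ) : ℂ) := by
  have hpi := Real.pi_pos
  rw [fourierInv_radial hd (H := fun t => ((trialSymbol j n j (2 * Real.pi * t / lam) : ℝ) : ℂ))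
    (integrable_trialSymbol hd hn hj hlt hl).ofReal x]
  have e1 : ∀ r ∈ Ioi (0 : ℝ), ((r ^ (d - 1) * besselEntire d (2 * Real.pi * ‖x‖ * r) : ℝ) : ℂ) *
      ((trialSymbol j n j (2 * Real.pi * r / lam) : ℝ) : ℂ) =
      ((r ^ ((d : ℝ) - 1) • (fun ξ => besselEntire d (lam * ‖x‖ * ξ) * trialSymbol j n j ξ)
        (2 * Real.pi * r / lam) : ℝ) : ℂ) := by
    intro r hr
    have e : lam * ‖x‖ * (2 * Real.pi * r / lam) = 2 * Real.pi * ‖x‖ * r := by field_simp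
    simp only [e, smul_eq_mul]
    rw [← Real.rpow_natCast, Nat.cast_sub hd, Nat.cast_one]
    push_cast
    ring
  rw [setIntegral_congr_fun measurableSet_Ioi e1, integral_complex_ofReal,
    setIntegral_scaled d hl (fun ξ => besselEntire d (lam * ‖x‖ * ξ) * trialSymbol j n j ξ),
    besselL_eq_integral hd hn hj hlt (mul_nonneg hl.le (norm_nonneg x)), ← Complex.ofReal_mul]
  congr 1
  have e2 : ∀ ξ ∈ Ioi (0 : ℝ), ξ ^ ((d : ℝ) - 1) • (besselEntire d (lam * ‖x‖ * ξ) * trialSymbol j n j ξ) =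
      besselEntire d (lam * ‖x‖ * ξ) * (ξ ^ ((d : ℝ) + 2 * j - 1) / (1 + ξ ^ (2 * n))) := by
    intro ξ hξ
    have hξ' : 0 < ξ := hξ
    have e3 : ξ ^ ((d : ℝ) + 2 * j - 1) = ξ ^ ((d : ℝ) - 1) * ξ ^ j * ξ ^ j := by
      rw [← Real.rpow_add hξ', ← Real.rpow_add hξ']
      congr 1
      ring
    rw [e3, trialSymbol, smul_eq_mul]
    ring
  rw [setIntegral_congr_fun measurableSet_Ioi e2, smul_eq_mul, Real.div_rpow hl.le (by positivity),
    Real.rpow_neg (by positivity), Real.rpow_sub (by norm_num), Real.rpow_one,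
    show (2 * Real.pi) ^ (d : ℝ) = (2 * Real.pi) ^ ((d : ℝ) / 2) * (2 * Real.pi) ^ ((d : ℝ) / 2) by
      rw [← Real.rpow_add (by positivity)]; congr 1; ring,
    Real.mul_rpow (by norm_num) hpi.le]
  have h2 : (0 : ℝ) < 2 ^ ((d : ℝ) / 2) := by positivity
  have h3 : (0 : ℝ) < Real.pi ^ ((d : ℝ) / 2) := by positivity
  field_simp

/-- The functional equation extracts 1 - a and a respectively from a common factor Γ(a)Γ(1 - a);
these are the weights of ‖f‖² and ‖D^n f‖² in the energy. -/
theorem Gamma_two_sub (hd : 1 ≤ d) (hn : 0 < n) (hj : 0 ≤ j) (hlt : j / n + d / (2 * n) < 1) :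
    Real.Gamma ((d + 2 * j + 2 * 0) / (2 * n)) * Real.Gamma (2 - (d + 2 * j + 2 * 0) / (2 * n)) =
      (1 - (j / n + d / (2 * n))) * (Real.pi / Real.sin (Real.pi * (j / n + d / (2 * n)))) ∧
    Real.Gamma ((d + 2 * j + 2 * n) / (2 * n)) * Real.Gamma (2 - (d + 2 * j + 2 * n) / (2 * n)) =
      (j / n + d / (2 * n)) * (Real.pi / Real.sin (Real.pi * (j / n + d / (2 * n)))) := by
  have h0 := div_add_div_pos hd hn hj
  rw [← Real.Gamma_mul_Gamma_one_sub]
  have e1 : (d + 2 * j + 2 * 0) / (2 * n) = j / n + d / (2 * n) := by field_simp; ring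
  have e2 : (d + 2 * j + 2 * n) / (2 * n) = j / n + d / (2 * n) + 1 := by field_simp; ring
  rw [e1, e2]
  set a := j / n + d / (2 * n)
  constructor
  · rw [show 2 - a = (1 - a) + 1 by ring, Real.Gamma_add_one (by linarith)]
    ring
  · rw [show 2 - (a + 1) = 1 - a by ring, Real.Gamma_add_one h0.ne']
    ring

/-- The transform of f is the λ-dilate of ξ^j/(1 + ξ^{2n}), which for λ = 1 is the equality case of
Cauchy–Schwarz for the value of D^j f at the origin. The scale is left free for a later
optimisation; the last clause serves the case θ = 0. -/
theorem exists_trial (hd : 1 ≤ d) (hn : 0 < n) (hj : 0 ≤ j) (hjn : j ≤ n)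
    (hlt : j / n + d / (2 * n) < 1) {lam : ℝ} (hl : 0 < lam) :
    ∃ f Dnf Djf : EuclideanSpace ℝ (Fin d) → ℂ, MemLp f 2 ∧ MemLp Dnf 2 ∧ MemLp Djf 2 ∧
      IsFracLaplacian n f Dnf ∧ IsFracLaplacian j f Djf ∧
      boldNorm 2 f ^ 2 = (2 * Real.pi) ^ (-(d : ℝ)) * lam ^ (d : ℝ) *
        (trialConst d j n * (1 - (j / n + d / (2 * n)))) ∧
      boldNorm 2 Dnf ^ 2 = (2 * Real.pi) ^ (-(d : ℝ)) * lam ^ (d : ℝ) *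
        (trialConst d j n * (lam ^ (2 * n) * (j / n + d / (2 * n)))) ∧
      Continuous Djf ∧ Tendsto Djf (cocompact _) (𝓝 0) ∧ (∃ M, ∀ x, ‖Djf x‖ ≤ M) ∧
      (∀ x, Djf x = (((2 * Real.pi) ^ (-((d : ℝ) / 2)) * lam ^ (j + d) *
        besselL d j n (lam * ‖x‖) : ℝ) : ℂ)) ∧
      (j = 0 → boldNorm 2 Djf = boldNorm 2 f) := by
  have hpi := Real.pi_pos
  have hG := Gamma_half_dim_pos hd
  have hsin := sin_pi_mul_pos (div_add_div_pos hd hn hj) hlt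
  -- `S s` is the Fourier transform of D^s f; the factor λ^s compensates the dilation, since |2πk|^s
  -- = λ^s (2π|k|/λ)^s.
  set S : ℝ → EuclideanSpace ℝ (Fin d) → ℂ := fun s k =>
    ((lam ^ s * trialSymbol j n s (2 * Real.pi * ‖k‖ / lam) : ℝ) : ℂ) with hS
  have hSmul : ∀ s k, S s k = ((lam ^ s : ℝ) : ℂ) *
      ((trialSymbol j n s (2 * Real.pi * ‖k‖ / lam) : ℝ) : ℂ) := fun s k => by simp [hS]
  have hSm : ∀ s, 0 ≤ s → s ≤ n → MemLp (S s) 2 := fun s h0 h1 =>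
    ((integral_trialSymbol_sq hd hn hj hlt h0 h1 hl).1.const_mul ((lam ^ s : ℝ) : ℂ)).congr_norm
      (Complex.continuous_ofReal.comp (continuous_const.mul
        (continuous_trialSymbol hn hj h0 hl))).aestronglyMeasurable
      (Eventually.of_forall fun k => by rw [hSmul])
  have hSn : ∀ s, 0 ≤ s → s ≤ n → (eLpNorm (S s) 2 volume).toReal ^ 2 = (lam ^ s) ^ 2 *
      ∫ k : EuclideanSpace ℝ (Fin d), trialSymbol j n s (2 * Real.pi * ‖k‖ / lam) ^ 2 :=
    fun s h0 h1 => by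
      rw [sq_toReal_eLpNorm_two (hSm s h0 h1), ← integral_const_mul]
      refine integral_congr_ae (Eventually.of_forall fun k => ?_)
      simp only [hS, Complex.norm_real, Real.norm_eq_abs, sq_abs, mul_pow]
  have hrel : ∀ s, 0 ≤ s → ∀ k, S s k = (((2 * Real.pi * ‖k‖) ^ s : ℝ) : ℂ) * S 0 k := fun s h0 k => by
    simp only [hS, trialSymbol, Real.rpow_zero, one_mul]
    rw [← Complex.ofReal_mul, Real.div_rpow (by positivity) hl.le s]
    congr 1
    have := (Real.rpow_pos_of_pos hl s).ne'
    field_simp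
  obtain ⟨f, hf, hfn, hfp⟩ := exists_fourierInv_memLp_two (hSm 0 le_rfl hn.le)
  obtain ⟨g, hg, hgn, hgp⟩ := exists_fourierInv_memLp_two (hSm n hn.le le_rfl)
  have hj1 : Integrable (S j) := by
    have h := (integrable_trialSymbol hd hn hj hlt hl).const_mul (lam ^ j)
    exact h.ofReal
  have hj2 := hSm j hj hjn
  obtain ⟨hD2, hDn⟩ := memLp_two_fourierInv hj1 hj2
  obtain ⟨hΓ1, hΓ2⟩ := Gamma_two_sub hd hn hj hlt
  have hd2 : (2 * Real.pi) ^ (d : ℝ) ≠ 0 := by positivity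
  refine ⟨f, g, 𝓕⁻ (S j), hf, hg, hD2, isFracLaplacian_of_ae_eq hfp hgp
    (Eventually.of_forall (hrel n hn.le)), isFracLaplacian_of_ae_eq hfp
    (integral_fourierInv_mul_schwartz hj1) (Eventually.of_forall (hrel j hj)), ?_, ?_,
    continuous_fourierInv hj1, tendsto_fourierInv_cocompact _, ⟨_, fun x => norm_fourierInv_le x⟩,
    fun x => ?_, fun h0 => ?_⟩
  · rw [boldNorm, hfn, hSn 0 le_rfl hn.le, (integral_trialSymbol_sq hd hn hj hlt le_rfl hn.le hl).2,
      hΓ1, Real.rpow_zero, trialConst, Real.div_rpow hl.le (by positivity), Real.rpow_neg (by positivity),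
      Real.rpow_add hpi, Real.rpow_one]
    field_simp
  · rw [boldNorm, hgn, hSn n hn.le le_rfl, (integral_trialSymbol_sq hd hn hj hlt hn.le le_rfl hl).2,
      hΓ2, trialConst, Real.div_rpow hl.le (by positivity), Real.rpow_neg (by positivity),
      Real.rpow_add hpi, Real.rpow_one, ← Real.rpow_mul_natCast hl.le, mul_comm n, Nat.cast_ofNat]
    field_simp
  · have e : S j = fun k => ((lam ^ j : ℝ) : ℂ) • ((trialSymbol j n j (2 * Real.pi * ‖k‖ / lam) : ℝ) : ℂ) := by
      funext k
      rw [hSmul, smul_eq_mul]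
    have e2 : 𝓕⁻ (S j) x = ((lam ^ j : ℝ) : ℂ) * 𝓕⁻ (fun k : EuclideanSpace ℝ (Fin d) =>
        ((trialSymbol j n j (2 * Real.pi * ‖k‖ / lam) : ℝ) : ℂ)) x := by
      rw [e, Real.fourierInv_eq, Real.fourierInv_eq, ← integral_const_mul]
      refine integral_congr_ae (Eventually.of_forall fun k => ?_)
      simp only [Circle.smul_def, smul_eq_mul]
      ring
    rw [e2, fourierInv_trialSymbol hd hn hj hlt hl, ← Complex.ofReal_mul, Real.rpow_add hl]
    congr 1
    ring
  · rw [boldNorm, boldNorm, hDn, hfn, h0]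

end Trial

/-! ### The lower bound, and the two cases of equality. -/

section LowerBound

variable {d : ℕ} {j n θ : ℝ}

/-- The quotient `(1-θ)^(1-θ) θ^θ / ((1-a)^(1-θ) a^θ)` with `a = j/n + d/(2n)`. -/
noncomputable def sobolevQuotient (d : ℕ) (j n θ : ℝ) : ℝ :=
  ((1 - θ) ^ (1 - θ) * θ ^ θ) /
    ((1 - (j / n + d / (2 * n))) ^ (1 - θ) * (j / n + d / (2 * n)) ^ θ)

theorem sobolevLower_eq (hd : 1 ≤ d) (hn : 0 < n) (hj : 0 ≤ j) (hlt : j / n + d / (2 * n) < 1) :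
    sobolevLower d j n θ =
      sobolevI d j n θ * Real.sqrt (sobolevQuotient d j n θ / trialConst d j n) := by
  have h1 := Gamma_half_dim_pos hd
  have hpi := Real.pi_pos
  have h2 := sin_pi_mul_pos (div_add_div_pos hd hn hj) hlt
  have e : Real.pi ^ ((d : ℝ) / 4 + 1 / 2) = Real.sqrt (Real.pi ^ ((d : ℝ) / 2 + 1)) := by
    rw [Real.sqrt_eq_rpow, ← Real.rpow_mul hpi.le]
    congr 1
    ring
  rw [sobolevLower, div_mul_eq_mul_div, mul_div_assoc, e, ← Real.sqrt_div' _ (by positivity)]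
  congr 2
  rw [sobolevQuotient, trialConst, sub_sub]
  field_simp

theorem sobolevQuotient_pos (hθ0 : 0 ≤ θ) (hd : 1 ≤ d) (hn : 0 < n) (hj : 0 ≤ j)
    (hlt : j / n + d / (2 * n) < 1) (hθ : θ < 1) : 0 < sobolevQuotient d j n θ := by
  have h0 := div_add_div_pos hd hn hj
  have : 0 < θ ^ θ := by
    rcases hθ0.eq_or_lt with h | h
    · rw [← h]; simp
    · positivity
  have h1 : 0 < 1 - θ := by linarith
  have h2 : 0 < 1 - (j / n + d / (2 * n)) := by linarith
  unfold sobolevQuotient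
  positivity

/-- Dilation by λ multiplies the L^r norm by λ^{-d/r}, and j + d - d/r = d/2 + θn by definition of
r. At θ = a only the value at the origin is used. -/
theorem le_boldNorm_trial (hd : 1 ≤ d) (hn : 0 < n)
    (hθ₁ : j / n ≤ θ) (hθ₂ : θ ≤ j / n + d / (2 * n)) {lam : ℝ} (hl : 0 < lam) {D : EuclideanSpace ℝ (Fin d) → ℂ}
    (hD : MemBoldL (sobolevExponent d j n θ) D) (hc : Continuous D)
    (he : ∀ x, D x = (((2 * Real.pi) ^ (-((d : ℝ) / 2)) * lam ^ (j + d) *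
        besselL d j n (lam * ‖x‖) : ℝ) : ℂ)) :
    (2 * Real.pi) ^ (-((d : ℝ) / 2)) * lam ^ ((d : ℝ) / 2 + θ * n) * sobolevI d j n θ ≤
      boldNorm (sobolevExponent d j n θ) D := by
  have hpi := Real.pi_pos
  have hd' : (0 : ℝ) < d := by exact_mod_cast hd
  by_cases hθ : θ = j / n + d / (2 * n)
  · have hp := sobolevExponent_eq_top hd hn hθ
    rw [hp] at hD ⊢
    have h0 : (2 * Real.pi) ^ (-((d : ℝ) / 2)) * lam ^ ((d : ℝ) / 2 + θ * n) * sobolevI d j n θ ≤ ‖D 0‖ := by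
      rw [he 0, norm_zero, mul_zero, Complex.norm_real]
      refine le_of_eq_of_le ?_ (le_abs_self _)
      rw [besselL, if_pos rfl, sobolevI, if_pos hθ, ← div_add_div_eq hn, ← hθ]
      congr 3
      rw [hθ]
      field_simp
      ring
    refine h0.trans ?_
    -- An almost everywhere bound holds everywhere for a continuous function, as the bound defines a
    -- closed dense set.
    have hbd : ∀ x, ‖D x‖ ≤ boldNorm ∞ D := by
      intro x
      have hae : ∀ᵐ x, ‖D x‖ ≤ boldNorm ∞ D := by
        have := ae_le_eLpNormEssSup (f := D) (μ := volume)
        filter_upwards [this] with x hx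
        rw [boldNorm, eLpNorm_exponent_top, ← toReal_enorm]
        refine ENNReal.toReal_mono ?_ hx
        rw [← eLpNorm_exponent_top]
        exact hD.1.2.ne
      have hcl : IsClosed {x | ‖D x‖ ≤ boldNorm ∞ D} := isClosed_le hc.norm continuous_const
      have hde : Dense {x | ‖D x‖ ≤ boldNorm ∞ D} := Measure.dense_of_ae hae
      have := hcl.closure_eq ▸ hde x
      exact this
    exact hbd 0
  · have hlt' := lt_of_le_of_ne hθ₂ hθ
    have hp := sobolevExponent_ne_top hd hn hlt'
    have hp2 := two_le_sobolevExponent (d := d) hn hθ₁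
    have hp0 : sobolevExponent d j n θ ≠ 0 := fun h => by simp [h] at hp2
    have hq := toReal_sobolevExponent hd hn hθ₂
    have hqp := sobolev_inv_exponent_pos hd hn hlt'
    rw [boldNorm, hD.1.eLpNorm_eq_integral_rpow_norm hp0 hp, ENNReal.toReal_ofReal (by positivity),
      sobolevI, if_neg hθ]
    set q := (sobolevExponent d j n θ).toReal
    have hq0 : 0 < q := by rw [hq]; exact inv_pos.2 hqp
    set c := (2 * Real.pi) ^ (-((d : ℝ) / 2)) * lam ^ (j + d) with hcdef
    have hc0 : 0 < c := by positivity
    have e1 : ∫ x : EuclideanSpace ℝ (Fin d), ‖D x‖ ^ q =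
        c ^ q * (2 * Real.pi ^ ((d : ℝ) / 2) / Real.Gamma ((d : ℝ) / 2) * ((1 / lam) ^ (d : ℝ) *
          ∫ ξ in Ioi (0 : ℝ), ξ ^ ((d : ℝ) - 1) * |besselL d j n ξ| ^ q)) := by
      -- With this scale the argument 2π|x|/(2π/λ) is λ|x|.
      have h := integral_radial_scaled hd (lam := 2 * Real.pi / lam) (by positivity)
        (fun ξ => |besselL d j n ξ| ^ q)
      rw [show 2 * Real.pi / lam / (2 * Real.pi) = 1 / lam by field_simp] at h
      rw [← h, ← integral_const_mul]
      refine integral_congr_ae (Eventually.of_forall fun x => ?_)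
      simp only
      rw [he x, Complex.norm_real, Real.norm_eq_abs, abs_mul, abs_of_pos hc0,
        Real.mul_rpow hc0.le (abs_nonneg _)]
      congr 3
      field_simp
    have hI0 : 0 ≤ 2 * Real.pi ^ ((d : ℝ) / 2) / Real.Gamma ((d : ℝ) / 2) *
        ∫ ξ in Ioi (0 : ℝ), ξ ^ ((d : ℝ) - 1) * |besselL d j n ξ| ^ q := by
      have := Gamma_half_dim_pos hd
      refine mul_nonneg (by positivity) (setIntegral_nonneg measurableSet_Ioi fun r hr => ?_)
      have : 0 < r := hr
      positivity
    rw [e1, mul_left_comm _ ((1 / lam) ^ (d : ℝ)),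
      Real.mul_rpow (x := c ^ q) (by positivity) (mul_nonneg (by positivity) hI0),
      Real.rpow_rpow_inv hc0.le hq0.ne', Real.mul_rpow (by positivity) hI0, ← mul_assoc, one_div q]
    refine le_of_eq ?_
    congr 1
    rw [hcdef, mul_assoc]
    congr 1
    rw [one_div, Real.inv_rpow hl.le, ← Real.rpow_neg hl.le, ← Real.rpow_mul hl.le, ← Real.rpow_add hl]
    congr 1
    rw [hq, inv_inv]
    field_simp
    ring

theorem memBoldL_trial (hn : 0 < n) (hθ₁ : j / n ≤ θ)
    {D : EuclideanSpace ℝ (Fin d) → ℂ} (h2 : MemLp D 2) (hc : Continuous D)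
    (ht : Tendsto D (cocompact _) (𝓝 0)) (hM : ∃ M, ∀ x, ‖D x‖ ≤ M) :
    MemBoldL (sobolevExponent d j n θ) D := by
  obtain ⟨M, hM⟩ := hM
  exact (memBoldL_of_bounded (B := max M (boldNorm 2 D)) (two_le_sobolevExponent (d := d) hn hθ₁) hc ht
    h2 hM (le_max_left _ _) (le_max_right _ _)).1

/-- The Sobolev inequality for a trial function. Uniqueness identifies the representative it
provides with the explicit D^j f; the common factor (2π)^{-d/2} λ^{d/2} then cancels. -/
theorem rpow_mul_sobolevI_le (hd : 1 ≤ d) (hn : 0 < n) (hj : 0 ≤ j) (hjn : j ≤ n)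
    (hθ₁ : j / n ≤ θ) (hθ₂ : θ ≤ j / n + d / (2 * n)) (hlt : j / n + d / (2 * n) < 1)
    {C : ℝ} (hC : C ∈ sobolevConstants d j n θ) {lam : ℝ} (hl : 0 < lam) :
    lam ^ (θ * n) * sobolevI d j n θ ≤ C * Real.sqrt (trialConst d j n *
      ((1 - (j / n + d / (2 * n))) + lam ^ (2 * n) * (j / n + d / (2 * n)))) := by
  have hpi := Real.pi_pos
  obtain ⟨f, Dnf, Djf, hf, hDnf, hDjf, hfn, hfj, hnf, hnD, hc, ht, hM, he, -⟩ :=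
    exists_trial hd hn hj hjn hlt hl
  have hB := memBoldL_trial hn hθ₁ hDjf hc ht hM (d := d)
  obtain ⟨-, hC⟩ := hC
  obtain ⟨g, hg, hfg, hgn⟩ := hC f Dnf ⟨hf, fun h => by simp at h⟩ ⟨hDnf, fun h => by simp at h⟩ hfn
  have hae := ae_eq_of_isFracLaplacian_of_memBoldL hd (two_le_sobolevExponent (d := d) hn hθ₁) hg hDjf
    hfg hfj
  have hge : boldNorm (sobolevExponent d j n θ) g = boldNorm (sobolevExponent d j n θ) Djf := by
    rw [boldNorm, boldNorm, eLpNorm_congr_ae hae]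
  have h1 := le_boldNorm_trial hd hn hθ₁ hθ₂ hl hB hc he
  rw [← hge] at h1
  have h2 := h1.trans hgn
  rw [hnf, hnD, ← mul_add, ← mul_add, Real.sqrt_mul (by positivity)] at h2
  have e : Real.sqrt ((2 * Real.pi) ^ (-(d : ℝ)) * lam ^ (d : ℝ)) =
      (2 * Real.pi) ^ (-((d : ℝ) / 2)) * lam ^ ((d : ℝ) / 2) := by
    rw [Real.sqrt_eq_rpow, Real.mul_rpow (by positivity) (by positivity),
      ← Real.rpow_mul (by positivity), ← Real.rpow_mul hl.le]
    congr 2 <;> ring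
  rw [e, Real.rpow_add hl] at h2
  have hpos : 0 < (2 * Real.pi) ^ (-((d : ℝ) / 2)) * lam ^ ((d : ℝ) / 2) := by positivity
  refine le_of_mul_le_mul_left ?_ hpos
  calc _ = (2 * Real.pi) ^ (-((d : ℝ) / 2)) * (lam ^ ((d : ℝ) / 2) * lam ^ (θ * n)) * sobolevI d j n θ := by
        ring
    _ ≤ _ := h2
    _ = _ := by ring

/-- Optimisation of the trial inequality over the scale λ. -/
theorem sobolevLower_le_of_mem (hd : 1 ≤ d) (hn : 0 < n) (hj : 0 ≤ j) (hjn : j ≤ n)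
    (hθ₁ : j / n ≤ θ) (hθ₂ : θ ≤ j / n + d / (2 * n)) (hlt : j / n + d / (2 * n) < 1)
    {C : ℝ} (hC : C ∈ sobolevConstants d j n θ) : sobolevLower d j n θ ≤ C := by
  have hK := trialConst_pos hd hn hj hlt
  have hθ0 : 0 ≤ θ := (div_nonneg hj hn.le).trans hθ₁
  have hθ1 : θ < 1 := hθ₂.trans_lt hlt
  have hX := sobolevQuotient_pos hθ0 hd hn hj hlt hθ1
  have ha := div_add_div_pos hd hn hj
  have key : sobolevI d j n θ ≤ C * Real.sqrt (trialConst d j n / sobolevQuotient d j n θ) := by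
    rcases hθ0.eq_or_lt with h0 | h0
    -- For θ = 0 the power λ^{θn} is 1 and the right side decreases with λ, so the optimum is the
    -- limit λ → 0.
    · have hlim : Tendsto (fun lam : ℝ => C * Real.sqrt (trialConst d j n *
          ((1 - (j / n + d / (2 * n))) + lam ^ (2 * n) * (j / n + d / (2 * n))))) (𝓝[>] 0)
          (𝓝 (C * Real.sqrt (trialConst d j n *
          ((1 - (j / n + d / (2 * n))) + 0 ^ (2 * n) * (j / n + d / (2 * n)))))) := by
        refine Tendsto.mono_left (Continuous.tendsto ?_ 0) nhdsWithin_le_nhds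
        exact continuous_const.mul (Real.continuous_sqrt.comp (continuous_const.mul
          (continuous_const.add ((continuous_id.rpow_const fun _ => Or.inr (by positivity)).mul
            continuous_const))))
      have hle : sobolevI d j n θ ≤ C * Real.sqrt (trialConst d j n *
          ((1 - (j / n + d / (2 * n))) + 0 ^ (2 * n) * (j / n + d / (2 * n)))) := by
        refine ge_of_tendsto hlim (eventually_mem_nhdsWithin.mono fun lam hlam => ?_)
        have := rpow_mul_sobolevI_le hd hn hj hjn hθ₁ hθ₂ hlt hC hlam
        rwa [← h0, zero_mul, Real.rpow_zero, one_mul, h0] at this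
      refine hle.trans_eq ?_
      rw [sobolevQuotient, ← h0, Real.zero_rpow (by positivity)]
      simp
    · have hθ' : 0 < 1 - θ := by linarith
      have ha' : 0 < 1 - (j / n + d / (2 * n)) := by linarith
      set a := j / n + d / (2 * n) with hadef
      -- λ^{2n} = u minimises (1 - a + λ^{2n} a)/λ^{2θn}; at this point 1 - a + u a = (1 - a)/(1 -
      -- θ).
      set u := θ * (1 - a) / ((1 - θ) * a) with hu
      have hu0 : 0 < u := by positivity
      have h := rpow_mul_sobolevI_le hd hn hj hjn hθ₁ hθ₂ hlt hC (Real.rpow_pos_of_pos hu0 (1 / (2 * n)))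
      rw [← hadef, ← Real.rpow_mul hu0.le, ← Real.rpow_mul hu0.le,
        show 1 / (2 * n) * (θ * n) = θ / 2 by field_simp,
        show 1 / (2 * n) * (2 * n) = 1 by field_simp, Real.rpow_one,
        show 1 - a + u * a = (1 - a) / (1 - θ) by rw [hu]; field_simp; ring] at h
      have hs : u ^ (θ / 2) = Real.sqrt (u ^ θ) := by
        rw [Real.sqrt_eq_rpow, ← Real.rpow_mul hu0.le]
        congr 1
        ring
      have hup : 0 < u ^ θ := by positivity
      rw [hs, mul_comm, ← le_div_iff₀ (Real.sqrt_pos.2 hup), mul_div_assoc,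
        ← Real.sqrt_div' _ hup.le] at h
      refine h.trans_eq ?_
      congr 2
      rw [sobolevQuotient, ← hadef, hu, Real.div_rpow (by positivity) (by positivity),
        Real.mul_rpow h0.le ha'.le, Real.mul_rpow hθ'.le ha.le, Real.rpow_sub hθ', Real.rpow_sub ha',
        Real.rpow_one, Real.rpow_one]
      field_simp
  rw [sobolevLower_eq hd hn hj hlt]
  have hs : 0 < Real.sqrt (sobolevQuotient d j n θ / trialConst d j n) :=
    Real.sqrt_pos.2 (div_pos hX hK)
  calc _ ≤ C * Real.sqrt (trialConst d j n / sobolevQuotient d j n θ) *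
        Real.sqrt (sobolevQuotient d j n θ / trialConst d j n) := by gcongr
    _ = C := by
      rw [mul_assoc, ← Real.sqrt_mul (by positivity)]
      rw [div_mul_div_cancel₀ hX.ne', div_self hK.ne', Real.sqrt_one, mul_one]

theorem sobolevLower_le_sharpSobolev (hd : 1 ≤ d) (hn : 0 < n) (hj : 0 ≤ j) (hjn : j ≤ n)
    (hθ₁ : j / n ≤ θ) (hθ₂ : θ ≤ j / n + d / (2 * n)) (hlt : j / n + d / (2 * n) < 1) :
    sobolevLower d j n θ ≤ sharpSobolev d j n θ :=
  le_csInf (sobolevConstants_nonempty hd hn hj hjn hθ₁ hlt) fun _ hC =>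
    sobolevLower_le_of_mem hd hn hj hjn hθ₁ hθ₂ hlt hC

theorem sharpSobolev_le_of_mem {C : ℝ} (hC : C ∈ sobolevConstants d j n θ) :
    sharpSobolev d j n θ ≤ C :=
  csInf_le ⟨0, fun _ h => h.1⟩ hC

/-- L_{jn}(|x|) is, up to a constant, D^j f for the trial function with λ = 1, which lies in 𝐋^r; no
asymptotics of Bessel functions are needed. -/
theorem integrableOn_besselL_rpow (hd : 1 ≤ d) (hn : 0 < n) (hj : 0 ≤ j) (hjn : j ≤ n)
    (hθ₁ : j / n ≤ θ) (hθ₂ : θ ≤ j / n + d / (2 * n)) (hlt : j / n + d / (2 * n) < 1)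
    (hθ : θ ≠ j / n + d / (2 * n)) : IntegrableOn (fun ρ : ℝ =>
      ρ ^ ((d : ℝ) - 1) * |besselL d j n ρ| ^ (sobolevExponent d j n θ).toReal) (Ioi 0) := by
  obtain ⟨f, Dnf, Djf, hf, hDnf, hDjf, hfn, hfj, hnf, hnD, hc, ht, hM, he, -⟩ :=
    exists_trial hd hn hj hjn hlt one_pos
  have hB := memBoldL_trial hn hθ₁ hDjf hc ht hM (d := d)
  have hp := sobolevExponent_ne_top hd hn (lt_of_le_of_ne hθ₂ hθ)
  have hp2 := two_le_sobolevExponent (d := d) hn hθ₁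
  have hp0 : sobolevExponent d j n θ ≠ 0 := fun h => by simp [h] at hp2
  have hi := hB.1.integrable_norm_rpow hp0 hp
  refine (integrable_radial_iff hd
    (f := fun r => |besselL d j n r| ^ (sobolevExponent d j n θ).toReal)).1 ?_
  have hpi := Real.pi_pos
  set c := (2 * Real.pi) ^ (-((d : ℝ) / 2))
  have hc0 : 0 < c := by positivity
  refine (hi.const_mul ((c ^ (sobolevExponent d j n θ).toReal)⁻¹)).congr
    (Eventually.of_forall fun x => ?_)
  simp only
  rw [he x, Complex.norm_real, Real.one_rpow, mul_one, one_mul, Real.norm_eq_abs, abs_mul,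
    abs_of_pos hc0, Real.mul_rpow hc0.le (abs_nonneg _), inv_mul_cancel_left₀ (by positivity)]

/-- Here j = 0 and r = 2, so I² = ∫|L|² is read off from ‖D^0 f‖ = ‖f‖ for the trial function with λ
= 1. The lower bound then simplifies to 1, which is also an admissible constant. -/
theorem sharpSobolev_of_theta_eq_zero (hd : 1 ≤ d) (hn : 0 < n) (hj : 0 ≤ j) (hjn : j ≤ n)
    (hθ₁ : j / n ≤ θ) (hθ₂ : θ ≤ j / n + d / (2 * n)) (hlt : j / n + d / (2 * n) < 1)
    (hθ : θ = 0) : sharpSobolev d j n θ = sobolevLower d j n θ ∧ sharpSobolev d j n θ = 1 := by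
  obtain ⟨hj0, hp⟩ := sobolevExponent_zero (d := d) hn hj hθ₁ hθ
  have ha := div_add_div_pos hd hn hj
  have hK := trialConst_pos hd hn hj hlt
  have hpi := Real.pi_pos
  have h1 : sharpSobolev d j n θ ≤ 1 :=
    sharpSobolev_le_of_mem (one_mem_sobolevConstants hd hn hj hjn hlt hp)
  have h2 := sobolevLower_le_sharpSobolev hd hn hj hjn hθ₁ hθ₂ hlt
  have h3 : sobolevLower d j n θ = 1 := by
    obtain ⟨f, Dnf, Djf, hf, hDnf, hDjf, hfn, hfj, hnf, hnD, hc, ht, hM, he, h0⟩ :=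
      exists_trial hd hn hj hjn hlt one_pos
    have hnf' := hnf
    rw [← h0 hj0, boldNorm, sq_toReal_eLpNorm_two hDjf, Real.one_rpow, mul_one] at hnf'
    have e : ∀ x, ‖Djf x‖ ^ 2 = (2 * Real.pi) ^ (-(d : ℝ)) * |besselL d j n ‖x‖| ^ (2 : ℝ) := fun x => by
      rw [he x, Complex.norm_real, Real.one_rpow, mul_one, one_mul, Real.norm_eq_abs, sq_abs, mul_pow,
        ← Real.rpow_mul_natCast (by positivity), Real.rpow_ofNat, sq_abs]
      congr 2
      push_cast
      ring
    simp only [e] at hnf'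
    rw [integral_const_mul, mul_right_inj' (by positivity),
      integral_radial hd (fun r => |besselL d j n r| ^ (2 : ℝ))] at hnf'
    have hI : sobolevI d j n θ = Real.sqrt (trialConst d j n * (1 - (j / n + d / (2 * n)))) := by
      rw [sobolevI, if_neg (by rw [hθ]; exact ha.ne), hp, ENNReal.toReal_ofNat, hnf', Real.sqrt_eq_rpow]
    rw [sobolevLower_eq hd hn hj hlt, hI, ← Real.sqrt_mul (mul_nonneg hK.le (by linarith))]
    have : trialConst d j n * (1 - (j / n + d / (2 * n))) *
        (sobolevQuotient d j n θ / trialConst d j n) = 1 := by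
      have : 1 - (j / n + d / (2 * n)) ≠ 0 := by linarith
      rw [sobolevQuotient, hθ]
      simp only [sub_zero, Real.rpow_one, Real.rpow_zero, mul_one]
      generalize 1 - (j / n + d / (2 * n)) = z at this
      field_simp
    rw [this, Real.sqrt_one]
  constructor <;> linarith

/-- The lower bound and the Cauchy–Schwarz constant evaluate to the same number. -/
theorem sharpSobolev_of_theta_eq (hd : 1 ≤ d) (hn : 0 < n) (hj : 0 ≤ j) (hjn : j ≤ n)
    (hθ₁ : j / n ≤ θ) (hθ₂ : θ ≤ j / n + d / (2 * n)) (hlt : j / n + d / (2 * n) < 1)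
    (hθ : θ = j / n + d / (2 * n)) : sharpSobolev d j n θ = sobolevLower d j n θ ∧
      sharpSobolev d j n θ =
        1 / ((2 : ℝ) ^ ((d : ℝ) / 2) * Real.pi ^ ((d : ℝ) / 4 - 1 / 2)
          * Real.sqrt (Real.Gamma ((d : ℝ) / 2) * n * Real.sin (Real.pi * θ))) := by
  have hp := sobolevExponent_eq_top hd hn hθ
  have ha := div_add_div_pos hd hn hj
  have hpi := Real.pi_pos
  have hG := Gamma_half_dim_pos hd
  have hsin : 0 < Real.sin (Real.pi * θ) := hθ ▸ sin_pi_mul_pos ha hlt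
  have h1 : sharpSobolev d j n θ ≤ Real.sqrt (symbolRatioIntegral d j n) :=
    sharpSobolev_le_of_mem (sqrt_mem_sobolevConstants hd hn hj hjn hlt hp)
  have h2 := sobolevLower_le_sharpSobolev hd hn hj hjn hθ₁ hθ₂ hlt
  set y := Real.Gamma ((d : ℝ) / 2) * n * Real.sin (Real.pi * θ) with hy
  have hy0 : 0 < y := by positivity
  have e2 : Real.pi ^ ((d : ℝ) / 4 + 1 / 2) = Real.pi ^ ((d : ℝ) / 4 - 1 / 2) * Real.pi := by
    rw [← Real.rpow_add_one hpi.ne']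
    congr 1
    ring
  have h3 : sobolevLower d j n θ = 1 / ((2 : ℝ) ^ ((d : ℝ) / 2) * Real.pi ^ ((d : ℝ) / 4 - 1 / 2)
      * Real.sqrt y) := by
    rw [sobolevLower, sobolevI, if_pos hθ, sub_sub, ← hθ, div_self, mul_one, mul_assoc (2 ^ ((d : ℝ) / 2)),
      mul_assoc (2 ^ ((d : ℝ) / 2)), ← hy, e2]
    · have := Real.sqrt_pos.2 hy0
      nth_rewrite 2 [← Real.mul_self_sqrt hy0.le]
      field_simp
      rw [Real.sqrt_sq this.le, Real.mul_self_sqrt hy0.le]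
    · have h0 : 0 < θ := hθ ▸ ha
      have h01 : 0 < 1 - θ := by linarith
      positivity
  have h4 : Real.sqrt (symbolRatioIntegral d j n) =
      1 / ((2 : ℝ) ^ ((d : ℝ) / 2) * Real.pi ^ ((d : ℝ) / 4 - 1 / 2) * Real.sqrt y) := by
    rw [symbolRatioIntegral, integral_symbol_ratio hd hn hj hlt, ← div_add_div_eq hn, ← hθ]
    refine (Real.sqrt_eq_iff_mul_self_eq (by positivity) (by positivity)).2 ?_
    rw [div_mul_div_comm, one_mul, show (2 : ℝ) ^ ((d : ℝ) / 2) * Real.pi ^ ((d : ℝ) / 4 - 1 / 2) *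
      Real.sqrt y * (2 ^ ((d : ℝ) / 2) * Real.pi ^ ((d : ℝ) / 4 - 1 / 2) * Real.sqrt y) =
      (2 ^ ((d : ℝ) / 2) * 2 ^ ((d : ℝ) / 2)) * (Real.pi ^ ((d : ℝ) / 4 - 1 / 2) *
        Real.pi ^ ((d : ℝ) / 4 - 1 / 2)) * (Real.sqrt y * Real.sqrt y) by ring,
      Real.mul_self_sqrt hy0.le, ← Real.rpow_add (by norm_num), ← Real.rpow_add hpi, hy,
      one_div (2 * Real.pi), Real.inv_rpow (by positivity), Real.mul_rpow (by norm_num) hpi.le,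
      show (d : ℝ) / 2 + d / 2 = d by ring,
      show (d : ℝ) / 4 - 1 / 2 + (d / 4 - 1 / 2) = d / 2 - 1 by ring, Real.rpow_sub hpi, Real.rpow_one,
      show Real.pi ^ (d : ℝ) = Real.pi ^ ((d : ℝ) / 2) * Real.pi ^ ((d : ℝ) / 2) by
        rw [← Real.rpow_add hpi]; congr 1; ring]
    field_simp
  constructor <;> linarith

end LowerBound

/-! ### The Mellin transform of L_{jn}, computed by Gaussian superposition. -/

section GaussianMellin

theorem integral_Ioi_swap {f : ℝ → ℝ → ℂ}
    (hc : ContinuousOn (Function.uncurry f) (Ioi 0 ×ˢ Ioi 0))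
    (h1 : ∀ x, 0 < x → IntegrableOn (f x) (Ioi 0))
    (h2 : IntegrableOn (fun x => ∫ y in Ioi (0 : ℝ), ‖f x y‖) (Ioi 0)) :
    ∫ x in Ioi (0 : ℝ), ∫ y in Ioi (0 : ℝ), f x y = ∫ y in Ioi (0 : ℝ), ∫ x in Ioi (0 : ℝ), f x y := by
  refine integral_integral_swap ((integrable_prod_iff ?_).2 ⟨?_, h2⟩)
  · rw [Measure.prod_restrict]
    exact hc.aestronglyMeasurable (measurableSet_Ioi.prod measurableSet_Ioi)
  · exact (ae_restrict_iff' measurableSet_Ioi).2 (Eventually.of_forall fun x hx => h1 x hx)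

theorem hasMellin_exp_neg_mul {r : ℝ} (hr : 0 < r) {s : ℂ} (hs : 0 < s.re) :
    HasMellin (fun t : ℝ => ((Real.exp (-(r * t)) : ℝ) : ℂ)) s ((1 / r) ^ s * Complex.Gamma s) := by
  constructor
  · rw [MellinConvergent.comp_mul_left (f := fun t : ℝ => ((Real.exp (-t) : ℝ) : ℂ)) hr]
    refine (Complex.GammaIntegral_convergent hs).congr_fun (fun t _ => ?_) measurableSet_Ioi
    simp only [smul_eq_mul]
    rw [mul_comm]
  · rw [← Complex.integral_cpow_mul_exp_neg_mul_Ioi hs hr, mellin]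
    refine setIntegral_congr_fun measurableSet_Ioi fun t _ => ?_
    simp

/-- The Gamma integral after t → 1/t. -/
theorem hasMellin_exp_neg_div {r : ℝ} (hr : 0 < r) {s : ℂ} (hs : s.re < 0) :
    HasMellin (fun t : ℝ => ((Real.exp (-(r / t)) : ℝ) : ℂ)) s ((1 / r) ^ (-s) * Complex.Gamma (-s)) := by
  have h := hasMellin_exp_neg_mul hr (s := -s) (by simpa using hs)
  constructor
  · have h2 := (MellinConvergent.comp_rpow (f := fun t : ℝ => ((Real.exp (-(r * t)) : ℝ) : ℂ)) (s := s)
      (a := -1) (by norm_num)).2 (by simpa [div_neg] using h.1)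
    simpa only [Real.rpow_neg_one, div_eq_mul_inv] using! h2
  · rw [← h.2, ← mellin_comp_inv]
    rfl

theorem integral_rpow_mul_exp_neg_div {r : ℝ} (hr : 0 < r) {s : ℝ} (hs : s < 0) :
    ∫ t in Ioi (0 : ℝ), t ^ (s - 1) * Real.exp (-(r / t)) = (1 / r) ^ (-s) * Real.Gamma (-s) := by
  apply Complex.ofReal_injective
  have h := (hasMellin_exp_neg_div hr (s := (s : ℂ)) (by simpa using hs)).2
  rw [← integral_complex_ofReal, Complex.ofReal_mul, Complex.ofReal_cpow (by positivity),
    ← Complex.Gamma_ofReal]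
  push_cast
  rw [← h, mellin]
  refine setIntegral_congr_fun measurableSet_Ioi fun t ht => ?_
  have ht0 : 0 ≤ t := le_of_lt ht
  simp only [smul_eq_mul]
  rw [Complex.ofReal_cpow ht0]
  push_cast
  rfl

theorem norm_mellin_kernel {s : ℂ} {t : ℝ} (ht : 0 < t) (y : ℝ) (hy : 0 ≤ y) :
    ‖(t : ℂ) ^ (s - 1) • (y : ℂ)‖ = t ^ (s.re - 1) * y := by
  rw [norm_smul, Complex.norm_cpow_eq_rpow_re_of_pos ht, Complex.norm_real, Real.norm_of_nonneg hy]
  simp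

theorem ofReal_one_div_cpow {r : ℝ} (hr : 0 < r) (v : ℂ) :
    (1 / (r : ℂ)) ^ v = (r : ℂ) ^ (-v) := by
  rw [one_div, Complex.inv_cpow, Complex.cpow_neg]
  rw [Complex.arg_ofReal_of_nonneg hr.le]
  exact Real.pi_pos.ne

theorem ofReal_sq_cpow {r : ℝ} (hr : 0 < r) (v : ℂ) :
    ((r ^ 2 : ℝ) : ℂ) ^ v = (r : ℂ) ^ (2 * v) := by
  rw [Complex.cpow_ofNat_mul, Complex.ofReal_pow, sq, sq, ← Complex.ofReal_mul,
    Complex.ofReal_mul, Complex.mul_cpow_ofReal_nonneg hr.le hr.le]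

variable {d : ℕ} {j n : ℝ}

/-- The radial inversion formula applied to a Gaussian at a point of norm ξ/(2π), compared with the
known transform of the Gaussian. -/
theorem integral_exp_neg_sq_mul_besselEntire (hd : 1 ≤ d) {t : ℝ} (ht : 0 < t) {ξ : ℝ} (hξ : 0 < ξ) :
    ∫ ρ in Ioi (0 : ℝ), ρ ^ ((d : ℝ) - 1) * Real.exp (-t * ρ ^ 2) * besselEntire d (ρ * ξ) =
      1 / 2 * t ^ (-((d : ℝ) / 2)) * Real.exp (-(ξ ^ 2 / 4 / t)) := by
  have hpi := Real.pi_pos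
  obtain ⟨e, he⟩ := exists_norm_eq_one_euclidean hd
  have hb : 0 < (t : ℂ).re := by simpa using ht
  have hi : Integrable fun k : EuclideanSpace ℝ (Fin d) => Complex.exp (-(t : ℂ) * (‖k‖ : ℂ) ^ 2) := by
    simpa using GaussianFourier.integrable_cexp_neg_mul_sq_norm_add (b := (t : ℂ)) hb 0
      (0 : EuclideanSpace ℝ (Fin d))
  have h := fourierInv_radial hd (H := fun r => Complex.exp (-(t : ℂ) * (r : ℂ) ^ 2)) hi
    ((ξ / (2 * Real.pi)) • e)
  have hn : ‖(ξ / (2 * Real.pi)) • e‖ = ξ / (2 * Real.pi) := by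
    rw [norm_smul, he, mul_one, Real.norm_of_nonneg (by positivity)]
  rw [Real.fourierInv_eq_fourier_neg, fourier_gaussian_innerProductSpace hb, norm_neg, hn] at h
  have e1 : ∀ r ∈ Ioi (0 : ℝ), ((r ^ (d - 1) *
      besselEntire d (2 * Real.pi * (ξ / (2 * Real.pi)) * r) : ℝ) : ℂ) *
      Complex.exp (-(t : ℂ) * (r : ℂ) ^ 2) =
      ((r ^ ((d : ℝ) - 1) * Real.exp (-t * r ^ 2) * besselEntire d (r * ξ) : ℝ) : ℂ) := by
    intro r hr
    rw [show 2 * Real.pi * (ξ / (2 * Real.pi)) * r = r * ξ by field_simp, ← Real.rpow_natCast,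
      Nat.cast_sub hd, Nat.cast_one]
    push_cast
    ring
  rw [setIntegral_congr_fun measurableSet_Ioi e1, integral_complex_ofReal, ← Complex.ofReal_mul] at h
  have e2 : ((Real.pi : ℂ) / t) ^ ((Module.finrank ℝ (EuclideanSpace ℝ (Fin d)) : ℂ) / 2) *
      Complex.exp (-(Real.pi : ℂ) ^ 2 * ((ξ / (2 * Real.pi) : ℝ) : ℂ) ^ 2 / t) =
      (((Real.pi / t) ^ ((d : ℝ) / 2) * Real.exp (-(ξ ^ 2 / 4 / t)) : ℝ) : ℂ) := by
    rw [Complex.ofReal_mul, Complex.ofReal_cpow (by positivity), finrank_euclideanSpace_fin]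
    congr 1
    · push_cast; rfl
    · rw [Complex.ofReal_exp]
      congr 1
      have : (Real.pi : ℂ) ≠ 0 := by exact_mod_cast hpi.ne'
      push_cast
      field_simp
      ring
  rw [e2] at h
  have h' := Complex.ofReal_injective h
  have h3 : 0 < Real.pi ^ ((d : ℝ) / 2) := by positivity
  rw [Real.div_rpow hpi.le ht.le] at h'
  rw [Real.rpow_neg ht.le]
  have h4 : 0 < t ^ ((d : ℝ) / 2) := by positivity
  field_simp at h' ⊢
  linarith

theorem integral_exp_neg_sq_mul_besselL (hd : 1 ≤ d) (hn : 0 < n) (hj : 0 ≤ j)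
    (hlt : j / n + d / (2 * n) < 1) {t : ℝ} (ht : 0 < t) :
    ∫ ρ in Ioi (0 : ℝ), ρ ^ ((d : ℝ) - 1) * Real.exp (-t * ρ ^ 2) * besselL d j n ρ =
      2 ^ (-((d : ℝ) / 2)) * t ^ (-((d : ℝ) / 2)) * ∫ ξ in Ioi (0 : ℝ),
        ξ ^ ((d : ℝ) + 2 * j - 1) / (1 + ξ ^ (2 * n)) * Real.exp (-(ξ ^ 2 / 4 / t)) := by
  have hd' : (1 : ℝ) ≤ d := by exact_mod_cast hd
  have hg := integrableOn_rpow_mul_exp_neg_mul_sq ht (s := (d : ℝ) - 1) (by linarith)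
  have hw := integrableOn_besselWeight hd hn hj hlt
  have hprod := (hg.mul_prod hw).bdd_mul (f := fun z : ℝ × ℝ => besselEntire d (z.1 * z.2))
    (c := (Real.Gamma ((d : ℝ) / 2))⁻¹)
    ((continuous_besselEntire hd).comp (continuous_fst.mul continuous_snd)).aestronglyMeasurable
    (Eventually.of_forall fun z => abs_besselEntire_le hd _)
  have hsw := integral_integral_swap (f := fun ρ ξ : ℝ => besselEntire d (ρ * ξ) *
    (ρ ^ ((d : ℝ) - 1) * Real.exp (-t * ρ ^ 2) *
      (ξ ^ ((d : ℝ) + 2 * j - 1) / (1 + ξ ^ (2 * n))))) hprod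
  have e1 : ∀ ρ ∈ Ioi (0 : ℝ), ρ ^ ((d : ℝ) - 1) * Real.exp (-t * ρ ^ 2) * besselL d j n ρ =
      2 ^ (1 - (d : ℝ) / 2) * ∫ ξ in Ioi (0 : ℝ), besselEntire d (ρ * ξ) *
    (ρ ^ ((d : ℝ) - 1) * Real.exp (-t * ρ ^ 2) *
      (ξ ^ ((d : ℝ) + 2 * j - 1) / (1 + ξ ^ (2 * n)))) := by
    intro ρ hρ
    rw [besselL_eq_integral hd hn hj hlt (le_of_lt hρ), mul_left_comm, ← integral_const_mul]
    congr 1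
    refine integral_congr_ae (Eventually.of_forall fun ξ => ?_)
    simp only
    ring
  have e2 : ∀ ξ ∈ Ioi (0 : ℝ), ∫ ρ in Ioi (0 : ℝ), besselEntire d (ρ * ξ) *
      (ρ ^ ((d : ℝ) - 1) * Real.exp (-t * ρ ^ 2) *
        (ξ ^ ((d : ℝ) + 2 * j - 1) / (1 + ξ ^ (2 * n)))) =
      1 / 2 * t ^ (-((d : ℝ) / 2)) *
        (ξ ^ ((d : ℝ) + 2 * j - 1) / (1 + ξ ^ (2 * n)) * Real.exp (-(ξ ^ 2 / 4 / t))) := by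
    intro ξ hξ
    rw [show 1 / 2 * t ^ (-((d : ℝ) / 2)) *
        (ξ ^ ((d : ℝ) + 2 * j - 1) / (1 + ξ ^ (2 * n)) * Real.exp (-(ξ ^ 2 / 4 / t))) =
        1 / 2 * t ^ (-((d : ℝ) / 2)) * Real.exp (-(ξ ^ 2 / 4 / t)) *
        (ξ ^ ((d : ℝ) + 2 * j - 1) / (1 + ξ ^ (2 * n))) by ring,
      ← integral_exp_neg_sq_mul_besselEntire hd ht hξ, ← integral_mul_const]
    refine integral_congr_ae (Eventually.of_forall fun ρ => ?_)
    simp only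
    ring
  rw [setIntegral_congr_fun measurableSet_Ioi e1, integral_const_mul, hsw,
    setIntegral_congr_fun measurableSet_Ioi e2, integral_const_mul,
    Real.rpow_neg zero_le_two, Real.rpow_sub zero_lt_two, Real.rpow_one]
  field_simp

/-- Near 0 the function is bounded, so σ > 0 suffices. At infinity it is square integrable for
ρ^{d-1} dρ, by the trial function, and the complementary weight ρ^{2σ-d-1} is integrable for σ <
d/2. -/
theorem integrableOn_rpow_mul_besselL (hd : 1 ≤ d) (hn : 0 < n) (hj : 0 ≤ j) (hjn : j ≤ n)
    (hlt : j / n + d / (2 * n) < 1) {σ : ℝ} (h0 : 0 < σ) (h1 : σ < d / 2) :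
    IntegrableOn (fun ρ : ℝ => ρ ^ (σ - 1) * |besselL d j n ρ|) (Ioi 0) := by
  have hcont := continuousOn_besselL hd hn hj hlt
  have hpow : ContinuousOn (fun ρ : ℝ => ρ ^ (σ - 1)) (Ioi 0) := fun ρ hρ =>
    (Real.continuousAt_rpow_const _ _ (Or.inl (ne_of_gt hρ))).continuousWithinAt
  have hmeas : AEStronglyMeasurable (fun ρ : ℝ => ρ ^ (σ - 1) * |besselL d j n ρ|)
      (volume.restrict (Ioi 0)) :=
    (hpow.mul (hcont.mono Ioi_subset_Ici_self).abs).aestronglyMeasurable measurableSet_Ioi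
  have hpi := Real.pi_pos
  have hsq : IntegrableOn (fun ρ : ℝ => ρ ^ ((d : ℝ) - 1) * besselL d j n ρ ^ 2) (Ioi 0) := by
    obtain ⟨f, Dnf, Djf, hf, hDnf, hDjf, hfn, hfj, hnf, hnD, hc, ht, hM, he, -⟩ :=
      exists_trial hd hn hj hjn hlt one_pos
    have hi := (memLp_two_iff_integrable_sq_norm hc.aestronglyMeasurable).1 hDjf
    refine (integrable_radial_iff hd (f := fun r => besselL d j n r ^ 2)).1 ?_
    set c := (2 * Real.pi) ^ (-((d : ℝ) / 2))
    have hc0 : 0 < c := by positivity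
    refine (hi.const_mul ((c ^ 2)⁻¹)).congr (Eventually.of_forall fun x => ?_)
    simp only
    rw [he x, Complex.norm_real, Real.one_rpow, mul_one, one_mul, Real.norm_eq_abs, sq_abs, mul_pow,
      inv_mul_cancel_left₀ (by positivity)]
  rw [← Ioc_union_Ioi_eq_Ioi (zero_le_one (α := ℝ)), integrableOn_union]
  constructor
  · obtain ⟨B, hB⟩ := (isCompact_Icc (a := (0 : ℝ)) (b := 1)).exists_bound_of_continuousOn
      (hcont.mono Icc_subset_Ici_self)
    have hi : IntegrableOn (fun ρ : ℝ => ρ ^ (σ - 1)) (Ioc 0 1) :=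
      (intervalIntegrable_iff_integrableOn_Ioc_of_le zero_le_one).1
        (intervalIntegral.intervalIntegrable_rpow' (by linarith))
    refine (hi.mul_const B).mono' (hmeas.mono_measure (Measure.restrict_mono Ioc_subset_Ioi_self le_rfl))
      ((ae_restrict_iff' measurableSet_Ioc).2 (Eventually.of_forall fun ρ hρ => ?_))
    have h2 : 0 ≤ ρ ^ (σ - 1) := Real.rpow_nonneg hρ.1.le _
    rw [Real.norm_of_nonneg (by positivity)]
    exact mul_le_mul_of_nonneg_left (hB ρ ⟨hρ.1.le, hρ.2⟩) h2
  · have hi : IntegrableOn (fun ρ : ℝ => ρ ^ (2 * σ - d - 1)) (Ioi 1) :=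
      integrableOn_Ioi_rpow_of_lt (by linarith) zero_lt_one
    refine (hi.add (hsq.mono_set (Ioi_subset_Ioi zero_le_one))).mono'
      (hmeas.mono_measure (Measure.restrict_mono (Ioi_subset_Ioi zero_le_one) le_rfl))
      ((ae_restrict_iff' measurableSet_Ioi).2 (Eventually.of_forall fun ρ hρ => ?_))
    have hρ0 : 0 < ρ := lt_trans zero_lt_one hρ
    have h2 : 0 ≤ ρ ^ (σ - 1) := Real.rpow_nonneg hρ0.le _
    rw [Real.norm_of_nonneg (by positivity)]
    simp only [Pi.add_apply]
    have e1 : ρ ^ (2 * σ - d - 1) = (ρ ^ (σ - 1 - ((d : ℝ) - 1) / 2)) ^ 2 := by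
      rw [← Real.rpow_mul_natCast hρ0.le]
      congr 1
      push_cast
      ring
    have e2 : ρ ^ ((d : ℝ) - 1) = (ρ ^ (((d : ℝ) - 1) / 2)) ^ 2 := by
      rw [← Real.rpow_mul_natCast hρ0.le]
      congr 1
      push_cast
      ring
    have e3 : ρ ^ (σ - 1) = ρ ^ (σ - 1 - ((d : ℝ) - 1) / 2) * ρ ^ (((d : ℝ) - 1) / 2) := by
      rw [← Real.rpow_add hρ0]
      congr 1
      ring
    rw [e1, e2, e3, ← sq_abs (besselL d j n ρ)]
    have p1 := Real.rpow_nonneg hρ0.le (σ - 1 - ((d : ℝ) - 1) / 2)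
    have p2 := Real.rpow_nonneg hρ0.le (((d : ℝ) - 1) / 2)
    -- This is x y ≤ x² + y², with x the power of ρ and y = ρ^{(d-1)/2} |L|.
    nlinarith [sq_nonneg (ρ ^ (σ - 1 - ((d : ℝ) - 1) / 2) - ρ ^ (((d : ℝ) - 1) / 2) * |besselL d j n ρ|),
      sq_nonneg (ρ ^ (σ - 1 - ((d : ℝ) - 1) / 2)), sq_nonneg (ρ ^ (((d : ℝ) - 1) / 2) * |besselL d j n ρ|)]

theorem mellinConvergent_besselL (hd : 1 ≤ d) (hn : 0 < n) (hj : 0 ≤ j) (hjn : j ≤ n)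
    (hlt : j / n + d / (2 * n) < 1) {u : ℂ} (h0 : 0 < u.re) (h1 : u.re < d / 2) :
    MellinConvergent (fun ρ => (besselL d j n ρ : ℂ)) u := by
  have hm : AEStronglyMeasurable (fun ρ => (besselL d j n ρ : ℂ)) (volume.restrict (Ioi 0)) :=
    (Complex.continuous_ofReal.comp_continuousOn ((continuousOn_besselL hd hn hj hlt).mono
      Ioi_subset_Ici_self)).aestronglyMeasurable measurableSet_Ioi
  refine (mellin_convergent_iff_norm Subset.rfl measurableSet_Ioi hm).2 ?_
  simpa only [Complex.norm_real, Real.norm_eq_abs] using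
    integrableOn_rpow_mul_besselL hd hn hj hjn hlt h0 h1

/-- With v = (d - u)/2, write Γ(v) ρ^{-2v} = ∫ t^{v-1} e^{-tρ²} dt. Integrating in ρ first turns the
Bessel factor into a Gaussian e^{-ξ²/(4t)}; the t-integral then gives Γ(u/2) times a power of ξ, and
the ξ-integral is a beta integral with q = 1. -/
theorem mellin_besselL (hd : 1 ≤ d) (hn : 0 < n) (hj : 0 ≤ j) (hjn : j ≤ n)
    (hlt : j / n + d / (2 * n) < 1) {u : ℂ} (h0 : 0 < u.re) (h1 : u.re < d / 2) :
    mellin (fun ρ => (besselL d j n ρ : ℂ)) u =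
      2 ^ (u - d / 2) * (Complex.Gamma (u / 2) / Complex.Gamma ((d - u) / 2)) *
        (Complex.Gamma ((d + 2 * j - u) / (2 * n)) *
          Complex.Gamma (1 - (d + 2 * j - u) / (2 * n))) / (2 * n) := by
  have hd' : (1 : ℝ) ≤ d := by exact_mod_cast hd
  have hpos := two_mul_add_dim_pos hd hj
  have hlt2 := two_mul_add_dim_lt hn hlt
  set v : ℂ := (d - u) / 2 with hv
  have hvre : 0 < v.re := by
    have : v.re = (d - u.re) / 2 := by rw [hv]; simp
    rw [this]
    linarith
  have hLcont := (continuousOn_besselL hd hn hj hlt).mono Ioi_subset_Ici_self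
  have hcp : ∀ s : ℂ, ContinuousOn (fun t : ℝ => (t : ℂ) ^ s) (Ioi 0) := fun s =>
    ContinuousOn.cpow_const Complex.continuous_ofReal.continuousOn fun t ht =>
      Complex.ofReal_mem_slitPlane.2 ht
  have hrp : ∀ s : ℝ, ContinuousOn (fun t : ℝ => t ^ s) (Ioi 0) := fun s t ht =>
    (Real.continuousAt_rpow_const _ _ (Or.inl (ne_of_gt ht))).continuousWithinAt
  have m1 : MapsTo (Prod.fst : ℝ × ℝ → ℝ) (Ioi 0 ×ˢ Ioi 0) (Ioi 0) := fun z hz => hz.1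
  have m2 : MapsTo (Prod.snd : ℝ × ℝ → ℝ) (Ioi 0 ×ˢ Ioi 0) (Ioi 0) := fun z hz => hz.2
  -- The integrand before ρ is eliminated; its t-integral is Γ(v) times the Mellin integrand.
  set f : ℝ → ℝ → ℂ := fun ρ t => ((ρ ^ ((d : ℝ) - 1) * besselL d j n ρ : ℝ) : ℂ) *
    ((t : ℂ) ^ (v - 1) • ((Real.exp (-(ρ ^ 2 * t)) : ℝ) : ℂ)) with hf
  have hswap1 : ∫ ρ in Ioi (0 : ℝ), ∫ t in Ioi (0 : ℝ), f ρ t =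
      ∫ t in Ioi (0 : ℝ), ∫ ρ in Ioi (0 : ℝ), f ρ t := by
    refine integral_Ioi_swap ?_ (fun ρ hρ => ?_) ?_
    · refine ContinuousOn.mul (Complex.continuous_ofReal.comp_continuousOn
        ((((hrp _).mul hLcont).comp continuousOn_fst m1))) (ContinuousOn.smul
        ((hcp _).comp continuousOn_snd m2) ?_)
      exact (by fun_prop : Continuous fun z : ℝ × ℝ =>
        ((Real.exp (-(z.1 ^ 2 * z.2)) : ℝ) : ℂ)).continuousOn
    · exact (hasMellin_exp_neg_mul (r := ρ ^ 2) (by positivity) hvre).1.const_mul _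
    · refine IntegrableOn.congr_fun ((integrableOn_rpow_mul_besselL hd hn hj hjn hlt h0 h1).mul_const
        (Real.Gamma v.re)) (fun ρ hρ => ?_) measurableSet_Ioi
      have hρ0 : 0 < ρ := hρ
      have e : ∀ t ∈ Ioi (0 : ℝ), ‖f ρ t‖ = ρ ^ ((d : ℝ) - 1) * |besselL d j n ρ| *
          (t ^ (v.re - 1) * Real.exp (-(ρ ^ 2 * t))) := fun t ht => by
        rw [hf, norm_mul, norm_mellin_kernel ht _ (Real.exp_pos _).le, Complex.norm_real,
          Real.norm_eq_abs, abs_mul, abs_of_nonneg (Real.rpow_nonneg hρ0.le _)]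
      rw [setIntegral_congr_fun measurableSet_Ioi e, integral_const_mul,
        Real.integral_rpow_mul_exp_neg_mul_Ioi hvre (by positivity : 0 < ρ ^ 2)]
      have e2 : ρ ^ (u.re - 1) = ρ ^ ((d : ℝ) - 1) * (1 / ρ ^ 2) ^ v.re := by
        rw [one_div, Real.inv_rpow (by positivity), ← Real.rpow_neg (by positivity),
          ← Real.rpow_natCast, ← Real.rpow_mul hρ0.le, ← Real.rpow_add hρ0]
        congr 1
        rw [hv]
        simp
        ring
      rw [e2]
      ring
  have hleft : ∀ ρ ∈ Ioi (0 : ℝ), ∫ t in Ioi (0 : ℝ), f ρ t =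
      Complex.Gamma v * ((ρ : ℂ) ^ (u - 1) • (besselL d j n ρ : ℂ)) := fun ρ hρ => by
    have hρ0 : 0 < ρ := hρ
    have hρc : (ρ : ℂ) ≠ 0 := by exact_mod_cast hρ0.ne'
    have h := (hasMellin_exp_neg_mul (r := ρ ^ 2) (by positivity) hvre).2
    rw [mellin] at h
    rw [hf]
    simp only
    rw [integral_const_mul, h, ofReal_one_div_cpow (by positivity), ofReal_sq_cpow hρ0, smul_eq_mul,
      Complex.ofReal_mul, Complex.ofReal_cpow hρ0.le]
    have e2 : (ρ : ℂ) ^ (u - 1) = (ρ : ℂ) ^ ((((d : ℝ) - 1 : ℝ)) : ℂ) * (ρ : ℂ) ^ (2 * -v) := by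
      rw [← Complex.cpow_add _ _ hρc]
      congr 1
      rw [hv]
      push_cast
      ring
    rw [e2]
    ring
  set w : ℝ → ℝ := fun ξ => ξ ^ ((d : ℝ) + 2 * j - 1) / (1 + ξ ^ (2 * n)) with hw
  have hwpos : ∀ ξ, 0 < ξ → 0 ≤ w ξ := fun ξ hξ => by rw [hw]; positivity
  -- The integrand after ρ is eliminated; the power of t comes from v - 1 - d/2 = -u/2 - 1.
  set g : ℝ → ℝ → ℂ := fun ξ t => (w ξ : ℂ) *
    ((t : ℂ) ^ (-(u / 2) - 1) • ((Real.exp (-(ξ ^ 2 / 4 / t)) : ℝ) : ℂ)) with hg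
  have hure : (-(u / 2)).re < 0 := by simpa using h0
  have hright : ∀ t ∈ Ioi (0 : ℝ), ∫ ρ in Ioi (0 : ℝ), f ρ t =
      2 ^ (-((d : ℂ) / 2)) * ∫ ξ in Ioi (0 : ℝ), g ξ t := fun t ht => by
    have ht0 : 0 < t := ht
    have htc : (t : ℂ) ≠ 0 := by exact_mod_cast ht0.ne'
    have e : ∀ ρ : ℝ, f ρ t = (t : ℂ) ^ (v - 1) *
        ((ρ ^ ((d : ℝ) - 1) * Real.exp (-t * ρ ^ 2) * besselL d j n ρ : ℝ) : ℂ) := fun ρ => by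
      simp only [hf, smul_eq_mul]
      rw [show -(ρ ^ 2 * t) = -t * ρ ^ 2 by ring]
      push_cast
      ring
    have e' : ∀ ξ : ℝ, g ξ t = (t : ℂ) ^ (-(u / 2) - 1) *
        ((w ξ * Real.exp (-(ξ ^ 2 / 4 / t)) : ℝ) : ℂ) := fun ξ => by
      simp only [hg, smul_eq_mul]
      push_cast
      ring
    simp only [e, e']
    rw [integral_const_mul, integral_const_mul, integral_complex_ofReal, integral_complex_ofReal,
      integral_exp_neg_sq_mul_besselL hd hn hj hlt ht0, Complex.ofReal_mul, Complex.ofReal_mul,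
      Complex.ofReal_cpow zero_le_two, Complex.ofReal_cpow ht0.le]
    have e2 : (t : ℂ) ^ (-(u / 2) - 1) = (t : ℂ) ^ (v - 1) * (t : ℂ) ^ ((-((d : ℝ) / 2) : ℝ) : ℂ) := by
      rw [← Complex.cpow_add _ _ htc]
      congr 1
      rw [hv]
      push_cast
      ring
    rw [e2]
    push_cast
    ring
  have hmid : HasMellin (fun x : ℝ => ((((1 + x ^ (2 * n)) ^ 1)⁻¹ : ℝ) : ℂ)) (d + 2 * j - u)
      (Complex.Gamma ((d + 2 * j - u) / (2 * n : ℝ)) *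
        Complex.Gamma ((1 : ℕ) - (d + 2 * j - u) / (2 * n : ℝ)) / ((2 * n : ℝ) * Complex.Gamma (1 : ℕ))) := by
    refine hasMellin_inv_one_add_rpow_pow 1 (by positivity) ?_ ?_
    · simp
      linarith
    · simp
      linarith
  have hker : ∀ ξ ∈ Ioi (0 : ℝ), ∫ t in Ioi (0 : ℝ), g ξ t =
      2 ^ u * Complex.Gamma (u / 2) * ((ξ : ℂ) ^ ((d + 2 * j - u : ℂ) - 1) •
        ((((1 + ξ ^ (2 * n)) ^ 1)⁻¹ : ℝ) : ℂ)) := fun ξ hξ => by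
    have hξ0 : 0 < ξ := hξ
    have hξc : (ξ : ℂ) ≠ 0 := by exact_mod_cast hξ0.ne'
    have h := (hasMellin_exp_neg_div (r := ξ ^ 2 / 4) (by positivity) hure).2
    rw [mellin, neg_neg, ofReal_one_div_cpow (by positivity), show ξ ^ 2 / 4 = (ξ / 2) ^ 2 by ring,
      ofReal_sq_cpow (by positivity), show 2 * -(u / 2) = -u by ring] at h
    rw [hg]
    simp only
    rw [integral_const_mul, show ξ ^ 2 / 4 = (ξ / 2) ^ 2 by ring, h, smul_eq_mul]
    have ew : w ξ = ξ ^ ((d : ℝ) + 2 * j - 1) * (1 + ξ ^ (2 * n))⁻¹ := div_eq_mul_inv _ _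
    have e1 : ((ξ / 2 : ℝ) : ℂ) ^ (-u) = (ξ : ℂ) ^ (-u) * 2 ^ u := by
      rw [div_eq_mul_inv, Complex.ofReal_mul, Complex.mul_cpow_ofReal_nonneg hξ0.le (by norm_num),
        show (((2 : ℝ)⁻¹ : ℝ) : ℂ) = 1 / ((2 : ℝ) : ℂ) by push_cast; ring,
        ofReal_one_div_cpow zero_lt_two, neg_neg]
      norm_num
    have e2 : (ξ : ℂ) ^ ((d + 2 * j - u : ℂ) - 1) =
        (ξ : ℂ) ^ (((d : ℝ) + 2 * j - 1 : ℝ) : ℂ) * (ξ : ℂ) ^ (-u) := by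
      rw [← Complex.cpow_add _ _ hξc]
      congr 1
      push_cast
      ring
    rw [e1, e2, ew, pow_one, Complex.ofReal_mul, Complex.ofReal_cpow hξ0.le]
    ring
  have hswap2 : ∫ ξ in Ioi (0 : ℝ), ∫ t in Ioi (0 : ℝ), g ξ t =
      ∫ t in Ioi (0 : ℝ), ∫ ξ in Ioi (0 : ℝ), g ξ t := by
    refine integral_Ioi_swap ?_ (fun ξ hξ => ?_) ?_
    · have hwc : ContinuousOn w (Ioi 0) := (hrp _).div (continuousOn_const.add (hrp _)) fun ξ hξ => by
        have hξ0 : 0 < ξ := hξ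
        positivity
      refine ContinuousOn.mul (Complex.continuous_ofReal.comp_continuousOn
        (hwc.comp continuousOn_fst m1)) (ContinuousOn.smul ((hcp _).comp continuousOn_snd m2) ?_)
      refine Complex.continuous_ofReal.comp_continuousOn (Real.continuous_exp.comp_continuousOn
        (ContinuousOn.neg (ContinuousOn.div (by fun_prop) continuousOn_snd fun z hz => ?_)))
      exact ne_of_gt hz.2
    · exact (hasMellin_exp_neg_div (r := ξ ^ 2 / 4) (by have : 0 < ξ := hξ; positivity) hure).1.const_mul _
    · refine IntegrableOn.congr_fun ((hmid.1.norm).const_mul (2 ^ u.re * Real.Gamma (u.re / 2)))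
        (fun ξ hξ => ?_) measurableSet_Ioi
      have hξ0 : 0 < ξ := hξ
      have e : ∀ t ∈ Ioi (0 : ℝ), ‖g ξ t‖ = w ξ *
          (t ^ ((-(u / 2)).re - 1) * Real.exp (-(ξ ^ 2 / 4 / t))) := fun t ht => by
        rw [hg, norm_mul, norm_mellin_kernel ht _ (Real.exp_pos _).le, Complex.norm_real,
          Real.norm_of_nonneg (hwpos ξ hξ0)]
      have hure' : (-(u / 2)).re = -(u.re / 2) := by simp
      rw [setIntegral_congr_fun measurableSet_Ioi e, integral_const_mul,
        integral_rpow_mul_exp_neg_div (by positivity) hure, norm_mellin_kernel hξ0 _ (by positivity),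
        hure', neg_neg]
      have e3 : (1 / (ξ ^ 2 / 4)) ^ (u.re / 2) = ξ ^ (-u.re) * 2 ^ u.re := by
        rw [show 1 / (ξ ^ 2 / 4) = (2 / ξ) ^ (2 : ℝ) by rw [Real.rpow_two]; field_simp; norm_num,
          ← Real.rpow_mul (by positivity), Real.div_rpow zero_le_two hξ0.le, Real.rpow_neg hξ0.le,
          mul_div_cancel₀ _ two_ne_zero]
        ring
      have e4 : ξ ^ ((d + 2 * j - u : ℂ).re - 1) = ξ ^ ((d : ℝ) + 2 * j - 1) * ξ ^ (-u.re) := by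
        rw [← Real.rpow_add hξ0]
        congr 1
        simp
        ring
      rw [e3, e4, hw]
      ring
  have hM : Complex.Gamma v * mellin (fun ρ => (besselL d j n ρ : ℂ)) u =
      2 ^ (-((d : ℂ) / 2)) * (2 ^ u * Complex.Gamma (u / 2) * (Complex.Gamma ((d + 2 * j - u) / (2 * n : ℝ)) *
        Complex.Gamma ((1 : ℕ) - (d + 2 * j - u) / (2 * n : ℝ)) / ((2 * n : ℝ) * Complex.Gamma (1 : ℕ)))) := by
    rw [← hmid.2, mellin, mellin, ← integral_const_mul, ← integral_const_mul,
      ← setIntegral_congr_fun measurableSet_Ioi hleft, hswap1,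
      setIntegral_congr_fun measurableSet_Ioi hright, integral_const_mul, ← hswap2,
      setIntegral_congr_fun measurableSet_Ioi hker]
  have hΓ : Complex.Gamma v ≠ 0 := Complex.Gamma_ne_zero_of_re_pos hvre
  rw [Nat.cast_one, Complex.Gamma_one, mul_one] at hM
  rw [sub_eq_add_neg, Complex.cpow_add _ _ two_ne_zero]
  rw [← mul_right_inj' hΓ, hM]
  push_cast
  field_simp

end GaussianMellin

/-! ### Gauss's multiplication theorem for the Gamma function. -/

section GammaProduct

/-- Each index below N k is written uniquely as N l + h with h < N. -/
theorem prod_range_mul_add (N : ℕ) (hN : N ≠ 0) (s : ℂ) (k : ℕ) :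
    ∏ i ∈ Finset.range (N * k), (N * s + i) =
      (N : ℂ) ^ (N * k) * ∏ l ∈ Finset.range k, ∏ h ∈ Finset.range N, (s + h / N + l) := by
  have hN' : (N : ℂ) ≠ 0 := by exact_mod_cast hN
  induction k with
  | zero => simp
  | succ k ih =>
    rw [mul_add, mul_one, Finset.prod_range_add, ih, Finset.prod_range_succ, pow_add]
    have : ∏ h ∈ Finset.range N, ((N : ℂ) * s + ((N * k + h : ℕ) : ℂ)) =
        (N : ℂ) ^ N * ∏ h ∈ Finset.range N, (s + h / N + k) := by
      rw [← Finset.card_range N, ← Finset.prod_const, Finset.card_range, ← Finset.prod_mul_distrib]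
      refine Finset.prod_congr rfl fun h _ => ?_
      push_cast
      field_simp
      ring
    rw [this]
    ring

/-- The part of the finite Gauss product which does not depend on the argument. -/
noncomputable def gaussSeq (N m : ℕ) : ℂ :=
  (∏ h ∈ Finset.range N, (m : ℂ) ^ ((h : ℂ) / N)) * (m.factorial : ℂ) ^ N * (N : ℂ) ^ (N * (m + 1)) /
    ((N * (m + 1) - 1).factorial : ℂ)

/-- For q = N(m + 1) - 1 the denominator of Euler's product at N s has exactly N(m + 1) factors,
matching those of the N products at s + h/N; the powers of m and q cancel as well, so nothing
depends on s. -/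
theorem gaussSeq_eq {N m : ℕ} (hN : N ≠ 0) (hm : m ≠ 0) {s : ℂ} (hs : 0 < s.re) :
    (∏ h ∈ Finset.range N, Complex.GammaSeq (s + h / N) m) /
        Complex.GammaSeq (N * s) (N * (m + 1) - 1) *
      ((((N * (m + 1) - 1 : ℕ) : ℝ) / m : ℝ) : ℂ) ^ (N * s) = gaussSeq N m := by
  have hN' : (N : ℂ) ≠ 0 := by exact_mod_cast hN
  have hm' : (m : ℂ) ≠ 0 := by exact_mod_cast hm
  have h1 : 1 ≤ N * (m + 1) := Nat.one_le_iff_ne_zero.2 (by positivity)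
  have hq : N * (m + 1) - 1 ≠ 0 := by
    have : 1 * 2 ≤ N * (m + 1) := Nat.mul_le_mul (Nat.one_le_iff_ne_zero.2 hN) (by omega)
    omega
  set q := N * (m + 1) - 1 with hqdef
  have hq' : (q : ℂ) ≠ 0 := by exact_mod_cast hq
  have hq1 : q + 1 = N * (m + 1) := by omega
  have hne : ∏ l ∈ Finset.range (m + 1), ∏ h ∈ Finset.range N, (s + h / N + l) ≠ 0 := by
    refine Finset.prod_ne_zero_iff.2 fun l _ => Finset.prod_ne_zero_iff.2 fun h _ h0 => ?_
    have := congrArg Complex.re h0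
    rw [show (h : ℂ) / N = ((h / N : ℝ) : ℂ) by push_cast; rfl] at this
    simp only [Complex.add_re, Complex.ofReal_re, Complex.natCast_re, Complex.zero_re] at this
    have h2 : (0 : ℝ) ≤ h / N := by positivity
    have h3 : (0 : ℝ) ≤ l := by positivity
    linarith
  have e1 : ∏ h ∈ Finset.range N, Complex.GammaSeq (s + h / N) m =
      (m : ℂ) ^ (N * s) * (∏ h ∈ Finset.range N, (m : ℂ) ^ ((h : ℂ) / N)) * (m.factorial : ℂ) ^ N /
        ∏ l ∈ Finset.range (m + 1), ∏ h ∈ Finset.range N, (s + h / N + l) := by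
    simp only [Complex.GammaSeq]
    rw [Finset.prod_div_distrib, Finset.prod_mul_distrib, Finset.prod_const, Finset.card_range,
      Finset.prod_comm]
    congr 2
    rw [Finset.prod_congr rfl fun h _ => Complex.cpow_add _ _ hm', Finset.prod_mul_distrib,
      Finset.prod_const, Finset.card_range, Complex.cpow_nat_mul]
  have e2 : (((q : ℝ) / m : ℝ) : ℂ) ^ (N * s) = (q : ℂ) ^ (N * s) / (m : ℂ) ^ (N * s) := by
    rw [div_eq_mul_inv, Complex.ofReal_mul, Complex.mul_cpow_ofReal_nonneg (by positivity) (by positivity),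
      Complex.ofReal_inv, ← one_div, ofReal_one_div_cpow (by positivity), Complex.cpow_neg]
    push_cast
    rw [div_eq_mul_inv]
  rw [e1, e2, Complex.GammaSeq, hq1, prod_range_mul_add N hN, gaussSeq, ← hqdef]
  have a1 : (q : ℂ) ^ (N * s) ≠ 0 := by simp [Complex.cpow_eq_zero_iff, hq]
  have a2 : (m : ℂ) ^ (N * s) ≠ 0 := by simp [Complex.cpow_eq_zero_iff, hm]
  have a3 : (q.factorial : ℂ) ≠ 0 := by exact_mod_cast q.factorial_ne_zero
  generalize ∏ l ∈ Finset.range (m + 1), ∏ h ∈ Finset.range N, (s + h / N + l) = Q at hne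
  field_simp

theorem tendsto_gaussSeq {N : ℕ} (hN : N ≠ 0) {s : ℂ} (hs : 0 < s.re) :
    Tendsto (gaussSeq N) atTop (𝓝 ((∏ h ∈ Finset.range N, Complex.Gamma (s + h / N)) /
      Complex.Gamma (N * s) * (N : ℂ) ^ (N * s))) := by
  have hN1 : 1 ≤ N := Nat.one_le_iff_ne_zero.2 hN
  have hre : 0 < ((N : ℂ) * s).re := by
    have : ((N : ℂ) * s).re = N * s.re := by simp
    rw [this]
    positivity
  have hq : Tendsto (fun m : ℕ => N * (m + 1) - 1) atTop atTop := by
    refine tendsto_atTop_mono (fun m => ?_) tendsto_id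
    have : 1 * (m + 1) ≤ N * (m + 1) := Nat.mul_le_mul_right _ hN1
    simp only [id]
    omega
  have hratio : Tendsto (fun m : ℕ => ((((N * (m + 1) - 1 : ℕ) : ℝ) / m : ℝ) : ℂ)) atTop (𝓝 (N : ℂ)) := by
    have h : Tendsto (fun m : ℕ => (N : ℝ) + ((N : ℝ) - 1) * ((m : ℝ))⁻¹) atTop
        (𝓝 ((N : ℝ) + ((N : ℝ) - 1) * 0)) :=
      tendsto_const_nhds.add (tendsto_const_nhds.mul tendsto_inv_atTop_nhds_zero_nat)
    rw [mul_zero, add_zero] at h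
    have h2 := (Complex.continuous_ofReal.tendsto (N : ℝ)).comp h
    refine h2.congr' ((eventually_ne_atTop 0).mono fun m hm => ?_)
    have h1 : 1 ≤ N * (m + 1) := Nat.one_le_iff_ne_zero.2 (by positivity)
    have hm' : (m : ℝ) ≠ 0 := by exact_mod_cast hm
    simp only [Function.comp_apply]
    congr 1
    rw [Nat.cast_sub h1]
    push_cast
    field_simp
    ring
  refine Tendsto.congr' ((eventually_ne_atTop 0).mono fun m hm => gaussSeq_eq hN hm hs) ?_
  refine ((tendsto_finsetProd _ fun h _ => Complex.GammaSeq_tendsto_Gamma _).div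
    ((Complex.GammaSeq_tendsto_Gamma _).comp hq) (Complex.Gamma_ne_zero_of_re_pos hre)).mul ?_
  exact ((continuousAt_cpow_const (by simpa using hN)).tendsto.comp hratio)

/-- The constant in the multiplication theorem for the Gamma function. -/
noncomputable def gaussConst (N : ℕ) : ℂ :=
  N * ∏ h ∈ Finset.range N, Complex.Gamma (1 / N + h / N)

/-- The multiplication theorem of Gauss. -/
theorem prod_Gamma_add_div {N : ℕ} (hN : N ≠ 0) {s : ℂ} (hs : 0 < s.re) :
    ∏ h ∈ Finset.range N, Complex.Gamma (s + h / N) =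
      gaussConst N * (N : ℂ) ^ (-(N * s)) * Complex.Gamma (N * s) := by
  have hN' : (N : ℂ) ≠ 0 := by exact_mod_cast hN
  have h1re : 0 < (1 / (N : ℂ)).re := by
    rw [show 1 / (N : ℂ) = ((1 / N : ℝ) : ℂ) by push_cast; rfl, Complex.ofReal_re]
    positivity
  -- The same sequence converges to the normalised product at s and at 1/N. At 1/N the denominator
  -- is Γ(1) = 1, which identifies the constant.
  have h := tendsto_nhds_unique (tendsto_gaussSeq hN hs) (tendsto_gaussSeq hN h1re)
  have hre : 0 < ((N : ℂ) * s).re := by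
    have : ((N : ℂ) * s).re = N * s.re := by simp
    rw [this]
    positivity
  have hg := Complex.Gamma_ne_zero_of_re_pos hre
  have hc : (N : ℂ) ^ (N * s) ≠ 0 := by simp [Complex.cpow_eq_zero_iff, hN]
  rw [mul_one_div_cancel hN', Complex.Gamma_one, Complex.cpow_one, div_one] at h
  rw [div_mul_eq_mul_div, div_eq_iff hg] at h
  rw [gaussConst, Complex.cpow_neg, mul_right_comm, ← div_eq_mul_inv, eq_div_iff hc, h]
  ring

/-- The modulus of ∏(1 - ζ^k) = n + 1 for ζ a primitive root of unity of order n + 1. -/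
theorem prod_two_mul_sin (n : ℕ) :
    ∏ k ∈ Finset.range n, (2 * Real.sin (Real.pi * ((k + 1) / (n + 1)))) = n + 1 := by
  have hζ := Complex.isPrimitiveRoot_exp (n + 1) n.succ_ne_zero
  have h := congrArg norm hζ.prod_one_sub_pow_eq_order
  rw [norm_prod] at h
  have e : ∀ k ∈ Finset.range n, ‖1 - Complex.exp (2 * Real.pi * Complex.I / (n + 1 : ℕ)) ^ (k + 1)‖ =
      2 * Real.sin (Real.pi * ((k + 1) / (n + 1))) := by
    intro k hk
    have hk' : (k : ℝ) + 1 < n + 1 := by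
      have := Finset.mem_range.1 hk
      exact_mod_cast Nat.succ_lt_succ this
    rw [norm_sub_rev, ← Complex.exp_nat_mul,
      show ((k + 1 : ℕ) : ℂ) * (2 * Real.pi * Complex.I / (n + 1 : ℕ)) =
        Complex.I * ((2 * Real.pi * ((k + 1) / (n + 1)) : ℝ) : ℂ) by push_cast; ring,
      Complex.norm_exp_I_mul_ofReal_sub_one,
      show 2 * Real.pi * (((k : ℝ) + 1) / (n + 1)) / 2 = Real.pi * ((k + 1) / (n + 1)) by ring]
    refine Real.norm_of_nonneg (mul_nonneg zero_le_two (sin_pi_mul_pos (by positivity) ?_).le)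
    rw [div_lt_one (by positivity)]
    exact hk'
  rw [Finset.prod_congr rfl e] at h
  rw [h]
  norm_cast

/-- Reversing the order in one of the two products pairs Γ(x) with Γ(1 - x), and the resulting sines
multiply to n + 1. The square suffices here: the constant later occurs twice or cancels. -/
theorem gaussConst_sq {N : ℕ} (hN : N ≠ 0) :
    gaussConst N ^ 2 = (((2 * Real.pi) ^ (N - 1) * N : ℝ) : ℂ) := by
  obtain ⟨n, rfl⟩ := Nat.exists_eq_succ_of_ne_zero hN
  have hne : ((n : ℂ) + 1) ≠ 0 := by exact_mod_cast n.succ_ne_zero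
  have e1 : gaussConst (n + 1) = (n + 1) * ∏ k ∈ Finset.range n, Complex.Gamma ((k + 1) / (n + 1)) := by
    rw [gaussConst, Finset.prod_range_succ]
    push_cast
    rw [← add_div, add_comm (1 : ℂ) n, div_self hne, Complex.Gamma_one, mul_one]
    congr 1
    refine Finset.prod_congr rfl fun k _ => ?_
    congr 1
    ring
  have e2 : ∏ k ∈ Finset.range n, Complex.Gamma (((k : ℂ) + 1) / (n + 1)) =
      ∏ k ∈ Finset.range n, Complex.Gamma (1 - ((k : ℂ) + 1) / (n + 1)) := by
    rw [← Finset.prod_range_reflect]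
    refine Finset.prod_congr rfl fun k hk => ?_
    have := Finset.mem_range.1 hk
    congr 1
    rw [Nat.sub_sub, Nat.cast_sub (by omega)]
    push_cast
    field_simp
    ring
  have e3 : (∏ k ∈ Finset.range n, Complex.Gamma (((k : ℂ) + 1) / (n + 1))) ^ 2 =
      (((2 * Real.pi) ^ n / (n + 1) : ℝ) : ℂ) := by
    rw [sq]
    nth_rewrite 2 [e2]
    rw [← Finset.prod_mul_distrib, ← prod_two_mul_sin n]
    have : ((2 * Real.pi) ^ n : ℝ) = ∏ k ∈ Finset.range n, (2 * Real.pi) := by simp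
    rw [this, ← Finset.prod_div_distrib, Complex.ofReal_prod]
    refine Finset.prod_congr rfl fun k hk => ?_
    rw [Complex.Gamma_mul_Gamma_one_sub, mul_div_mul_left _ _ two_ne_zero]
    push_cast
    rfl
  rw [Nat.succ_eq_add_one, e1, mul_pow, e3]
  push_cast
  field_simp

end GammaProduct

/-! ### Integrability of the Mellin–Barnes integrand and Mellin inversion. -/

section BarnesKernel

theorem norm_betaIntegral_le {x y : ℝ} (t : ℝ) :
    ‖Complex.betaIntegral (x + t * Complex.I) y‖ ≤
      ∫ r in (0 : ℝ)..1, ‖(r : ℂ) ^ ((x : ℂ) - 1) * (1 - (r : ℂ)) ^ ((y : ℂ) - 1)‖ := by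
  rw [Complex.betaIntegral]
  refine (intervalIntegral.norm_integral_le_integral_norm zero_le_one).trans_eq ?_
  rw [intervalIntegral.integral_of_le zero_le_one, intervalIntegral.integral_of_le zero_le_one]
  refine setIntegral_congr_fun measurableSet_Ioc fun r hr => ?_
  simp only [norm_mul]
  congr 1
  rw [Complex.norm_cpow_eq_rpow_re_of_pos hr.1, Complex.norm_cpow_eq_rpow_re_of_pos hr.1]
  simp

/-- Since Γ(x + it) Γ(y - x) = Γ(y + it) B(x + it, y - x) and the beta integral is bounded uniformly
in t, the quotient is bounded without Stirling's formula. Conjugation exchanges x - it and x + it.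
-/
theorem exists_norm_Gamma_div_le {x y : ℝ} (hx : 0 < x) (hxy : x < y) :
    ∃ C, ∀ t : ℝ, ‖Complex.Gamma (x - t * Complex.I) / Complex.Gamma (y + t * Complex.I)‖ ≤ C := by
  have hg : 0 < ‖Complex.Gamma ((y - x : ℝ) : ℂ)‖ :=
    norm_pos_iff.2 (Complex.Gamma_ne_zero_of_re_pos (by simpa using hxy))
  refine ⟨(∫ r in (0 : ℝ)..1, ‖(r : ℂ) ^ ((x : ℂ) - 1) * (1 - (r : ℂ)) ^ (((y - x : ℝ) : ℂ) - 1)‖) /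
    ‖Complex.Gamma ((y - x : ℝ) : ℂ)‖, fun t => ?_⟩
  have hs : 0 < ‖Complex.Gamma (y + t * Complex.I)‖ :=
    norm_pos_iff.2 (Complex.Gamma_ne_zero_of_re_pos (by simpa using hx.trans hxy))
  have h := congrArg norm (Complex.Gamma_mul_Gamma_eq_betaIntegral (s := x + t * Complex.I)
    (t := ((y - x : ℝ) : ℂ)) (by simpa using hx) (by simpa using hxy))
  rw [norm_mul, norm_mul, show (x : ℂ) + t * Complex.I + ((y - x : ℝ) : ℂ) = y + t * Complex.I by
    push_cast; ring] at h
  have hconj : ‖Complex.Gamma (x - t * Complex.I)‖ = ‖Complex.Gamma (x + t * Complex.I)‖ := by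
    rw [← Complex.norm_conj, ← Complex.Gamma_conj]
    simp
  rw [norm_div, hconj, div_le_div_iff₀ hs hg, h, mul_comm]
  exact mul_le_mul_of_nonneg_right (norm_betaIntegral_le t) hs.le

theorem one_add_sq_div_four_le_cosh (x : ℝ) : (1 + x ^ 2) / 4 ≤ Real.cosh x := by
  rw [← Real.cosh_abs, Real.cosh_eq, ← sq_abs x]
  have h1 := Real.quadratic_le_exp_of_nonneg (abs_nonneg x)
  have h2 := Real.exp_pos (-|x|)
  have h3 := abs_nonneg x
  nlinarith

/-- The real part of sin(π(x + iy)) is sin(πx) cosh(πy); a quadratic lower bound for cosh already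
gives integrable decay. -/
theorem norm_pi_div_sin_le {x : ℝ} (h0 : 0 < x) (h1 : x < 1) (y : ℝ) :
    ‖(Real.pi : ℂ) / Complex.sin (Real.pi * (x + y * Complex.I))‖ ≤
      4 * Real.pi / Real.sin (Real.pi * x) * (1 + (Real.pi * y) ^ 2)⁻¹ := by
  have hpi := Real.pi_pos
  have hs := sin_pi_mul_pos h0 h1
  have hc := one_add_sq_div_four_le_cosh (Real.pi * y)
  have h : Real.sin (Real.pi * x) * Real.cosh (Real.pi * y) ≤
      ‖Complex.sin (Real.pi * (x + y * Complex.I))‖ := by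
    refine le_trans (le_of_eq ?_) (Complex.re_le_norm _)
    rw [show (Real.pi : ℂ) * (x + y * Complex.I) = ((Real.pi * x : ℝ) : ℂ) +
      ((Real.pi * y : ℝ) : ℂ) * Complex.I by push_cast; ring, Complex.sin_add_mul_I,
      ← Complex.ofReal_sin, ← Complex.ofReal_cosh, ← Complex.ofReal_cos, ← Complex.ofReal_sinh,
      ← Complex.ofReal_mul, ← Complex.ofReal_mul, Complex.add_re, Complex.ofReal_re,
      Complex.re_ofReal_mul, Complex.I_re, mul_zero, add_zero]
  have hq : 0 < 1 + (Real.pi * y) ^ 2 := by positivity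
  rw [norm_div, Complex.norm_real, Real.norm_of_nonneg hpi.le]
  calc Real.pi / ‖Complex.sin (Real.pi * (x + y * Complex.I))‖
      ≤ Real.pi / (Real.sin (Real.pi * x) * ((1 + (Real.pi * y) ^ 2) / 4)) := by
        refine div_le_div_of_nonneg_left hpi.le (by positivity) (le_trans ?_ h)
        gcongr
    _ = _ := by field_simp

variable {d : ℕ} {j n : ℝ}

/-- The Mellin transform of `besselL`, up to elementary factors, with `s = -u/2`. -/
noncomputable def barnesKernel (d : ℕ) (j n : ℝ) (s : ℂ) : ℂ :=
  Complex.Gamma (-s) / Complex.Gamma (d / 2 + s) *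
    (Complex.Gamma ((((2 * j + d) / (2 * n) : ℝ) : ℂ) + s / n) *
      Complex.Gamma (1 - ((((2 * j + d) / (2 * n) : ℝ) : ℂ) + s / n)))

/-- Re s = -d/8 corresponds to Re u = d/4, the middle of the strip where the Mellin transform
converges. On this line the reflected pair of Gamma factors has its argument strictly between 0 and
1. -/
theorem barnes_abscissa (hd : 1 ≤ d) (hn : 0 < n) (hj : 0 ≤ j) (hlt : j / n + d / (2 * n) < 1) :
    0 < (2 * j + d) / (2 * n) + -((d : ℝ) / 8) / n ∧
      (2 * j + d) / (2 * n) + -((d : ℝ) / 8) / n < 1 := by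
  have hd' : (1 : ℝ) ≤ d := by exact_mod_cast hd
  have h1 := two_mul_add_dim_lt hn hlt
  rw [show (2 * j + d) / (2 * n) + -((d : ℝ) / 8) / n = (2 * j + d - d / 4) / (2 * n) by
    field_simp; ring]
  constructor
  · exact div_pos (by linarith) (by positivity)
  · rw [div_lt_one (by positivity)]
    linarith

theorem continuous_Gamma_line {x : ℝ} (hx : 0 < x) (k : ℝ) :
    Continuous fun t : ℝ => Complex.Gamma (x + k * t * Complex.I) := by
  refine continuous_iff_continuousAt.2 fun t => ?_
  refine ContinuousAt.comp (g := Complex.Gamma) (Complex.continuousAt_Gamma _ fun m h => ?_) (by fun_prop)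
  have := congrArg Complex.re h
  simp at this
  have h2 : (0 : ℝ) ≤ m := by positivity
  linarith

theorem barnesKernel_line (d : ℕ) (j n : ℝ) (t : ℝ) :
    barnesKernel d j n (((-((d : ℝ) / 8) : ℝ) : ℂ) + t * Complex.I) =
      Complex.Gamma (((d : ℝ) / 8 : ℝ) - t * Complex.I) /
        Complex.Gamma (((3 * (d : ℝ) / 8 : ℝ)) + t * Complex.I) *
      (Complex.Gamma ((((2 * j + d) / (2 * n) + -((d : ℝ) / 8) / n : ℝ) : ℂ) + (t / n : ℝ) * Complex.I) *
      Complex.Gamma (1 - ((((2 * j + d) / (2 * n) + -((d : ℝ) / 8) / n : ℝ) : ℂ) +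
        (t / n : ℝ) * Complex.I))) := by
  have e1 : -(((-((d : ℝ) / 8) : ℝ) : ℂ) + t * Complex.I) = ((d : ℝ) / 8 : ℝ) - t * Complex.I := by
    push_cast; ring
  have e2 : (d : ℂ) / 2 + (((-((d : ℝ) / 8) : ℝ) : ℂ) + t * Complex.I) =
      ((3 * (d : ℝ) / 8 : ℝ)) + t * Complex.I := by
    push_cast; ring
  have e3 : (((2 * j + d) / (2 * n) : ℝ) : ℂ) + (((-((d : ℝ) / 8) : ℝ) : ℂ) + t * Complex.I) / n =
      (((2 * j + d) / (2 * n) + -((d : ℝ) / 8) / n : ℝ) : ℂ) + (t / n : ℝ) * Complex.I := by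
    push_cast; ring
  rw [barnesKernel, e1, e2, e3]

theorem continuous_barnesKernel_line (hd : 1 ≤ d) (hn : 0 < n) (hj : 0 ≤ j)
    (hlt : j / n + d / (2 * n) < 1) : Continuous fun t : ℝ =>
      barnesKernel d j n (((-((d : ℝ) / 8) : ℝ) : ℂ) + t * Complex.I) := by
  have hd' : (1 : ℝ) ≤ d := by exact_mod_cast hd
  obtain ⟨h0, h1⟩ := barnes_abscissa hd hn hj hlt
  simp only [barnesKernel_line]
  set x := (2 * j + d) / (2 * n) + -((d : ℝ) / 8) / n
  have c1 : Continuous fun t : ℝ => Complex.Gamma (((d : ℝ) / 8 : ℝ) - t * Complex.I) :=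
    (continuous_Gamma_line (x := (d : ℝ) / 8) (by linarith) (-1)).congr fun t => by
      congr 1; push_cast; ring
  have c2 : Continuous fun t : ℝ => Complex.Gamma ((3 * (d : ℝ) / 8 : ℝ) + t * Complex.I) :=
    (continuous_Gamma_line (x := 3 * (d : ℝ) / 8) (by linarith) 1).congr fun t => by
      congr 1; push_cast; ring
  have c3 : Continuous fun t : ℝ => Complex.Gamma ((x : ℂ) + (t / n : ℝ) * Complex.I) :=
    (continuous_Gamma_line h0 (1 / n)).congr fun t => by congr 1; push_cast; ring
  have c4 : Continuous fun t : ℝ => Complex.Gamma (1 - ((x : ℂ) + (t / n : ℝ) * Complex.I)) :=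
    (continuous_Gamma_line (x := 1 - x) (by linarith) (-(1 / n))).congr fun t => by
      congr 1; push_cast; ring
  exact (c1.div c2 fun t => Complex.Gamma_ne_zero_of_re_pos (by simp; linarith)).mul (c3.mul c4)

/-- The Gamma quotient is bounded and the reflected pair decays like (1 + t²)^{-1}. -/
theorem integrable_barnesKernel_line (hd : 1 ≤ d) (hn : 0 < n) (hj : 0 ≤ j)
    (hlt : j / n + d / (2 * n) < 1) : Integrable fun t : ℝ =>
      barnesKernel d j n (((-((d : ℝ) / 8) : ℝ) : ℂ) + t * Complex.I) := by
  have hd' : (1 : ℝ) ≤ d := by exact_mod_cast hd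
  have hpi := Real.pi_pos
  obtain ⟨h0, h1⟩ := barnes_abscissa hd hn hj hlt
  obtain ⟨C, hC⟩ := exists_norm_Gamma_div_le (x := (d : ℝ) / 8) (y := 3 * (d : ℝ) / 8) (by linarith)
    (by linarith)
  have hi := (integrable_inv_one_add_sq.comp_mul_left' (R := Real.pi / n) (by positivity)).const_mul
    (C * (4 * Real.pi / Real.sin (Real.pi * ((2 * j + d) / (2 * n) + -((d : ℝ) / 8) / n))))
  refine hi.mono' (continuous_barnesKernel_line hd hn hj hlt).aestronglyMeasurable
    (Eventually.of_forall fun t => ?_)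
  rw [barnesKernel_line, Complex.Gamma_mul_Gamma_one_sub, norm_mul, mul_assoc,
    show Real.pi / n * t = Real.pi * (t / n) by ring]
  exact mul_le_mul (hC t) (norm_pi_div_sin_le h0 h1 _) (norm_nonneg _) ((norm_nonneg _).trans (hC t))

theorem mellin_besselL_line (hd : 1 ≤ d) (hn : 0 < n) (hj : 0 ≤ j) (hjn : j ≤ n)
    (hlt : j / n + d / (2 * n) < 1) (y : ℝ) :
    mellin (fun ρ => (besselL d j n ρ : ℂ)) (((d : ℝ) / 4 : ℝ) + y * Complex.I) =
      (2 : ℂ) ^ ((((d : ℝ) / 4 : ℝ) : ℂ) + y * Complex.I) *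
        ((1 / (2 ^ ((d : ℝ) / 2) * (2 * n)) : ℝ) : ℂ) *
        barnesKernel d j n (((-((d : ℝ) / 8) : ℝ) : ℂ) + ((-1 / 2 * y : ℝ) : ℂ) * Complex.I) := by
  have hd' : (1 : ℝ) ≤ d := by exact_mod_cast hd
  have hnc : (n : ℂ) ≠ 0 := by exact_mod_cast hn.ne'
  rw [mellin_besselL hd hn hj hjn hlt (by simp; linarith) (by simp; linarith), barnesKernel,
    sub_eq_add_neg, Complex.cpow_add _ _ two_ne_zero]
  have e : (2 : ℂ) ^ (-((d : ℂ) / 2)) = ((1 / 2 ^ ((d : ℝ) / 2) : ℝ) : ℂ) := by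
    rw [one_div, ← Real.rpow_neg zero_le_two, Complex.ofReal_cpow zero_le_two]
    push_cast
    rfl
  have e1 : ((((d : ℝ) / 4 : ℝ) : ℂ) + y * Complex.I) / 2 =
      -((((-((d : ℝ) / 8) : ℝ) : ℂ) + ((-1 / 2 * y : ℝ) : ℂ) * Complex.I)) := by
    push_cast; ring
  have e2 : ((d : ℂ) - ((((d : ℝ) / 4 : ℝ) : ℂ) + y * Complex.I)) / 2 =
      d / 2 + (((-((d : ℝ) / 8) : ℝ) : ℂ) + ((-1 / 2 * y : ℝ) : ℂ) * Complex.I) := by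
    push_cast; ring
  have e3 : ((d : ℂ) + 2 * j - ((((d : ℝ) / 4 : ℝ) : ℂ) + y * Complex.I)) / (2 * n) =
      (((2 * j + d) / (2 * n) : ℝ) : ℂ) +
        (((-((d : ℝ) / 8) : ℝ) : ℂ) + ((-1 / 2 * y : ℝ) : ℂ) * Complex.I) / n := by
    push_cast; field_simp; ring
  rw [e, e1, e2, e3]
  have h2 : (0 : ℝ) < 2 ^ ((d : ℝ) / 2) := by positivity
  generalize (2 : ℝ) ^ ((d : ℝ) / 2) = A at h2
  have hA : (A : ℂ) ≠ 0 := by exact_mod_cast h2.ne'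
  push_cast
  field_simp

/-- The Mellin-Barnes representation of `besselL`. -/
theorem besselL_eq_barnes (hd : 1 ≤ d) (hn : 0 < n) (hj : 0 ≤ j) (hjn : j ≤ n)
    (hlt : j / n + d / (2 * n) < 1) {ρ : ℝ} (hρ : 0 < ρ) :
    Integrable (fun t : ℝ =>
      Complex.exp (((((-((d : ℝ) / 8) : ℝ) : ℂ)) + t * Complex.I) * (Real.log ((ρ / 2) ^ 2) : ℂ)) *
        barnesKernel d j n (((-((d : ℝ) / 8) : ℝ) : ℂ) + t * Complex.I)) ∧
    (besselL d j n ρ : ℂ) = ((1 / (2 ^ ((d : ℝ) / 2) * n) : ℝ) : ℂ) * (1 / (2 * Real.pi) * ∫ t : ℝ,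
      Complex.exp (((((-((d : ℝ) / 8) : ℝ) : ℂ)) + t * Complex.I) * (Real.log ((ρ / 2) ^ 2) : ℂ)) *
        barnesKernel d j n (((-((d : ℝ) / 8) : ℝ) : ℂ) + t * Complex.I)) := by
  have hd' : (1 : ℝ) ≤ d := by exact_mod_cast hd
  have hK := integrable_barnesKernel_line hd hn hj hlt
  set E : ℝ → ℂ := fun t : ℝ =>
      Complex.exp (((((-((d : ℝ) / 8) : ℝ) : ℂ)) + t * Complex.I) * (Real.log ((ρ / 2) ^ 2) : ℂ)) *
        barnesKernel d j n (((-((d : ℝ) / 8) : ℝ) : ℂ) + t * Complex.I) with hE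
  have hEi : Integrable E := by
    refine hK.bdd_mul (c := Real.exp (-((d : ℝ) / 8) * Real.log ((ρ / 2) ^ 2)))
      (by fun_prop) (Eventually.of_forall fun t => ?_)
    rw [Complex.norm_exp]
    simp
  refine ⟨hEi, ?_⟩
  have hline := mellin_besselL_line hd hn hj hjn hlt
  have hV : Complex.VerticalIntegrable (mellin fun ρ => (besselL d j n ρ : ℂ)) ((d : ℝ) / 4) := by
    unfold Complex.VerticalIntegrable
    simp only [hline]
    have h := (hK.comp_mul_left' (R := -1 / 2) (by norm_num))
    refine h.bdd_mul (c := 2 ^ ((d : ℝ) / 4) * |1 / (2 ^ ((d : ℝ) / 2) * (2 * n))|) ?_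
      (Eventually.of_forall fun y => ?_)
    · refine Continuous.aestronglyMeasurable (Continuous.mul ?_ continuous_const)
      exact Continuous.const_cpow (by fun_prop) (Or.inl two_ne_zero)
    · rw [norm_mul, Complex.norm_real, Real.norm_eq_abs,
        show (2 : ℂ) = ((2 : ℝ) : ℂ) by norm_num, Complex.norm_cpow_eq_rpow_re_of_pos zero_lt_two]
      simp
  have hcont : ContinuousAt (fun ρ => (besselL d j n ρ : ℂ)) ρ :=
    Complex.continuous_ofReal.continuousAt.comp
      ((continuousOn_besselL hd hn hj hlt).continuousAt (Ici_mem_nhds hρ))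
  have hinv := mellinInv_mellin_eq ((d : ℝ) / 4) (fun ρ => (besselL d j n ρ : ℂ)) hρ
    (mellinConvergent_besselL hd hn hj hjn hlt (by simp; linarith) (by simp; linarith)) hV hcont
  rw [← hinv, mellinInv]
  have e : ∀ y : ℝ, (ρ : ℂ) ^ (-((((d : ℝ) / 4 : ℝ) : ℂ) + y * Complex.I)) •
      mellin (fun ρ => (besselL d j n ρ : ℂ)) (((d : ℝ) / 4 : ℝ) + y * Complex.I) =
      ((1 / (2 ^ ((d : ℝ) / 2) * (2 * n)) : ℝ) : ℂ) * E (-1 / 2 * y) := by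
    intro y
    rw [hline, smul_eq_mul, hE]
    have hρc : (ρ : ℂ) ≠ 0 := by exact_mod_cast hρ.ne'
    have e2 : Complex.exp (((((-((d : ℝ) / 8) : ℝ) : ℂ)) + ((-1 / 2 * y : ℝ) : ℂ) * Complex.I) *
        (Real.log ((ρ / 2) ^ 2) : ℂ)) =
        (ρ : ℂ) ^ (-((((d : ℝ) / 4 : ℝ) : ℂ) + y * Complex.I)) *
          (2 : ℂ) ^ ((((d : ℝ) / 4 : ℝ) : ℂ) + y * Complex.I) := by
      rw [Complex.cpow_def_of_ne_zero hρc, Complex.cpow_def_of_ne_zero two_ne_zero, ← Complex.exp_add,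
        Real.log_pow, Real.log_div hρ.ne' two_ne_zero, ← Complex.ofReal_log hρ.le,
        show Complex.log 2 = ((Real.log 2 : ℝ) : ℂ) by rw [Complex.ofReal_log zero_le_two]; norm_num]
      congr 1
      push_cast
      ring
    simp only
    rw [e2]
    ring
  simp only [e]
  -- The substitution t = -y/2 contributes a factor 2, which turns 1/(2n) into 1/n.
  rw [integral_const_mul, Measure.integral_comp_mul_left E]
  rw [show |((-1 / 2 : ℝ))⁻¹| = 2 by norm_num]
  simp only [Complex.real_smul]
  have h2 : (0 : ℝ) < 2 ^ ((d : ℝ) / 2) := by positivity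
  generalize (2 : ℝ) ^ ((d : ℝ) / 2) = A at h2
  have hA : (A : ℂ) ≠ 0 := by exact_mod_cast h2.ne'
  have hnc : (n : ℂ) ≠ 0 := by exact_mod_cast hn.ne'
  push_cast
  field_simp

end BarnesKernel

/-! ### Vertical lines as Barnes paths, and the H-function. -/

section FoxMeijer

theorem hasDerivAt_vertical_line (c t : ℝ) :
    HasDerivAt (fun t : ℝ => (c : ℂ) + t * Complex.I) Complex.I t := by
  have h := ((hasDerivAt_id t).ofReal_comp.mul_const Complex.I).const_add (c : ℂ)
  simpa using h

theorem deriv_vertical_line (c t : ℝ) :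
    deriv (fun t : ℝ => (c : ℂ) + t * Complex.I) t = Complex.I :=
  (hasDerivAt_vertical_line c t).deriv

theorem add_mul_I_ne_zero {e : ℝ} (he : e ≠ 0) (t : ℝ) : (e : ℂ) + t * Complex.I ≠ 0 := fun h =>
  he (by simpa using congrArg Complex.re h)

/-- An antiderivative is i arctan(t/e) + ½ log(e² + t²); the logarithm is even and cancels over the
symmetric interval. -/
theorem integral_I_div_vertical_line {e : ℝ} (he : e ≠ 0) (T : ℝ) :
    ∫ t in (-T)..T, Complex.I / ((e : ℂ) + t * Complex.I) =
      ((2 * Real.arctan (T / e) : ℝ) : ℂ) * Complex.I := by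
  have hpos : ∀ t : ℝ, e ^ 2 + t ^ 2 ≠ 0 := fun t => by positivity
  have hF : ∀ t ∈ uIcc (-T) T, HasDerivAt (fun t : ℝ => ((Real.arctan (t / e) : ℝ) : ℂ) * Complex.I +
      ((1 / 2 * Real.log (e ^ 2 + t ^ 2) : ℝ) : ℂ)) (Complex.I / ((e : ℂ) + t * Complex.I)) t := by
    intro t _
    have h1 := ((Real.hasDerivAt_arctan (t / e)).comp t ((hasDerivAt_id t).div_const e)).ofReal_comp.mul_const
      Complex.I
    have h2 := ((((hasDerivAt_id t).pow 2).const_add (e ^ 2)).log (hpos t)).const_mul (1 / 2) |>.ofReal_comp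
    refine (h1.add h2).congr_deriv ?_
    have hne := add_mul_I_ne_zero he t
    have hec : (e : ℂ) ≠ 0 := by exact_mod_cast he
    have h3 : (e : ℂ) ^ 2 + (t : ℂ) ^ 2 ≠ 0 := by exact_mod_cast hpos t
    simp only [id, Pi.pow_apply]
    rw [show 1 / (1 + (t / e) ^ 2) * (1 / e) = e / (e ^ 2 + t ^ 2) by field_simp]
    push_cast
    rw [eq_div_iff hne]
    field_simp
    linear_combination ((e : ℂ) * t) * Complex.I_sq
  rw [intervalIntegral.integral_eq_sub_of_hasDerivAt hF]
  · rw [neg_div, Real.arctan_neg]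
    push_cast
    ring_nf
  · refine (Continuous.div continuous_const (by fun_prop) fun t => add_mul_I_ne_zero he t).intervalIntegrable _ _

theorem argVariation_vertical_line {c x : ℝ} (h : x ≠ c) :
    FoxParams.ArgVariation (fun t : ℝ => (c : ℂ) + t * Complex.I) (x : ℂ)
      (if x < c then Real.pi else -Real.pi) := by
  have he : c - x ≠ 0 := sub_ne_zero.2 (Ne.symm h)
  refine ⟨fun t ht => he ?_, ?_⟩
  · have := congrArg Complex.re ht
    simp at this
    linarith
  · have e1 : ∀ t : ℝ, deriv (fun t : ℝ => (c : ℂ) + t * Complex.I) t / ((c : ℂ) + t * Complex.I - x) =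
        Complex.I / (((c - x : ℝ) : ℂ) + t * Complex.I) := fun t => by
      rw [deriv_vertical_line]
      congr 1
      push_cast
      ring
    simp only [e1, integral_I_div_vertical_line he]
    refine Tendsto.mul_const _ ?_
    refine (Complex.continuous_ofReal.tendsto _).comp ?_
    split_ifs with hx
    · have := ((Real.tendsto_arctan_atTop.mono_right nhdsWithin_le_nhds).comp
        (tendsto_id.atTop_div_const (sub_pos.2 hx))).const_mul 2
      rw [mul_div_cancel₀ _ two_ne_zero] at this
      exact this
    · have hx' : 0 < x - c := sub_pos.2 (lt_of_le_of_ne (not_lt.1 hx) (Ne.symm h))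
      have := (((Real.tendsto_arctan_atTop.mono_right nhdsWithin_le_nhds).comp
        (tendsto_id.atTop_div_const hx')).const_mul 2).neg
      rw [mul_div_cancel₀ _ two_ne_zero] at this
      refine this.congr fun T => ?_
      simp only [Function.comp_apply, id]
      rw [← neg_sub x c, div_neg, Real.arctan_neg]
      ring

theorem isBarnesPath_vertical_line {P : FoxParams} {c : ℝ}
    (hl : ∀ σ ∈ P.leftPoles, ∃ x : ℝ, σ = x ∧ x < c) (hr : ∀ σ ∈ P.rightPoles, ∃ x : ℝ, σ = x ∧ c < x) :
    P.IsBarnesPath (fun t : ℝ => (c : ℂ) + t * Complex.I) c where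
  contDiff := contDiff_const.add (Complex.ofRealCLM.contDiff.mul contDiff_const)
  asymp := by
    simp only [sub_self]
    exact isBigO_zero _ _
  asymp_deriv := by
    simp only [deriv_vertical_line, sub_self]
    exact isBigO_zero _ _
  left := fun σ hσ => by
    obtain ⟨x, rfl, hx⟩ := hl σ hσ
    simpa [hx] using argVariation_vertical_line hx.ne
  right := fun σ hσ => by
    obtain ⟨x, rfl, hx⟩ := hr σ hσ
    simpa [hx.not_gt] using argVariation_vertical_line hx.ne'

/-- On a vertical line ds = i dt, so the prefactor 1/(2πi) becomes 1/(2π). -/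
theorem isValuePos_vertical_line {P : FoxParams} {c z : ℝ} {F : ℝ → ℂ} (hz : 0 < z)
    (hP : ∀ p ∈ P.a ++ P.aStar ++ P.b ++ P.bStar, 0 < p.2) (hα : 0 < P.alpha)
    (hl : ∀ σ ∈ P.leftPoles, ∃ x : ℝ, σ = x ∧ x < c) (hr : ∀ σ ∈ P.rightPoles, ∃ x : ℝ, σ = x ∧ c < x)
    (hF : ∀ t : ℝ, P.integrand z ((c : ℂ) + t * Complex.I) = F t) (hi : Integrable F) :
    P.IsValuePos z (1 / (2 * Real.pi) * ∫ t, F t) := by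
  refine ⟨hz, hP, hα, _, c, isBarnesPath_vertical_line hl hr, ?_, ?_⟩
  · simp only [hF, deriv_vertical_line]
    exact hi.mul_const _
  · simp only [hF, deriv_vertical_line]
    rw [integral_mul_const]
    have := Complex.I_ne_zero
    have hpi : (Real.pi : ℂ) ≠ 0 := by exact_mod_cast Real.pi_ne_zero
    field_simp

variable {d : ℕ} {j n : ℝ}

theorem besselLFox_integrand (d : ℕ) (j n z : ℝ) (s : ℂ) :
    (besselLFox d j n).integrand z s = Complex.exp (s * (Real.log z : ℂ)) * barnesKernel d j n s := by
  simp only [FoxParams.integrand, besselLFox, barnesKernel, List.map_cons, List.map_nil, List.prod_cons,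
    List.prod_nil, mul_one, one_mul]
  have e1 : 1 - (((1 - (2 * j + d) / (2 * n) : ℝ)) : ℂ) + ((1 / n : ℝ) : ℂ) * s =
      (((2 * j + d) / (2 * n) : ℝ) : ℂ) + s / n := by push_cast; ring
  have e2 : (((1 - (2 * j + d) / (2 * n) : ℝ)) : ℂ) - ((1 / n : ℝ) : ℂ) * s =
      1 - ((((2 * j + d) / (2 * n) : ℝ) : ℂ) + s / n) := by push_cast; ring
  have e3 : 1 - (((1 - (d : ℝ) / 2 : ℝ)) : ℂ) + ((1 : ℝ) : ℂ) * s = d / 2 + s := by push_cast; ring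
  have e4 : (0 : ℂ) - ((1 : ℝ) : ℂ) * s = -s := by push_cast; ring
  rw [e1, e2, e3, e4]
  ring

/-- The left poles are at most -(j + d/2) and the right ones at least 0, so the line Re s = -d/8
separates them. -/
theorem besselLFox_isValuePos (hd : 1 ≤ d) (hn : 0 < n) (hj : 0 ≤ j) (hjn : j ≤ n)
    (hlt : j / n + d / (2 * n) < 1) {ρ : ℝ} (hρ : 0 < ρ) :
    (besselLFox d j n).IsValuePos ((ρ / 2) ^ 2)
      (((2 ^ ((d : ℝ) / 2) * n : ℝ) : ℂ) * besselL d j n ρ) := by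
  have hd' : (1 : ℝ) ≤ d := by exact_mod_cast hd
  have h1 := two_mul_add_dim_lt hn hlt
  obtain ⟨hi, hL⟩ := besselL_eq_barnes hd hn hj hjn hlt hρ
  have hv : ((2 ^ ((d : ℝ) / 2) * n : ℝ) : ℂ) * besselL d j n ρ = 1 / (2 * Real.pi) * ∫ t : ℝ,
      Complex.exp (((((-((d : ℝ) / 8) : ℝ) : ℂ)) + t * Complex.I) * (Real.log ((ρ / 2) ^ 2) : ℂ)) *
        barnesKernel d j n (((-((d : ℝ) / 8) : ℝ) : ℂ) + t * Complex.I) := by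
    have h0 : (2 ^ ((d : ℝ) / 2) * n : ℝ) ≠ 0 := by positivity
    rw [hL, ← mul_assoc, ← Complex.ofReal_mul, mul_one_div_cancel h0, Complex.ofReal_one, one_mul]
  rw [hv]
  have ha : 0 < 1 - (2 * j + d) / (2 * n) := by
    rw [sub_pos, div_lt_one (by positivity)]
    exact h1
  refine isValuePos_vertical_line (by positivity) ?_ ?_ ?_ ?_
    (fun t => besselLFox_integrand d j n _ _) hi
  · simp [besselLFox, hn]
  · simp [FoxParams.alpha, besselLFox]
    have : 0 < n⁻¹ := by positivity
    linarith
  · rintro σ ⟨p, hp, k, rfl⟩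
    simp only [besselLFox, List.mem_singleton] at hp
    subst hp
    refine ⟨-n * ((2 * j + d) / (2 * n) + k), ?_, ?_⟩
    · have hnc : (n : ℂ) ≠ 0 := by exact_mod_cast hn.ne'
      push_cast
      field_simp
      ring
    · have : n * ((2 * j + d) / (2 * n) + k) = j + d / 2 + n * k := by field_simp
      have h2 : 0 ≤ n * k := by positivity
      linarith
  · rintro σ ⟨p, hp, k, rfl⟩
    simp only [besselLFox, List.mem_cons, List.not_mem_nil, or_false] at hp
    rcases hp with rfl | rfl
    · refine ⟨k, by simp, ?_⟩
      have : (0 : ℝ) ≤ k := by positivity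
      linarith
    · refine ⟨n * (1 - (2 * j + d) / (2 * n) + k), ?_, ?_⟩
      · have hnc : (n : ℂ) ≠ 0 := by exact_mod_cast hn.ne'
        push_cast
        field_simp
      · have : 0 < n * (1 - (2 * j + d) / (2 * n) + k) := by positivity
        linarith

/-- Extends the representation to ρ = 0: z = ψ(ρ) is inverted by φ, and continuity of f at 0 gives
the limit z → 0⁺. -/
theorem isValue_of_continuousOn {P : FoxParams} {K : ℂ} {f : ℝ → ℂ} {φ ψ : ℝ → ℝ}
    (hf : ContinuousOn f (Ici 0)) (hφ : Continuous φ) (hφ0 : φ 0 = 0) (hφpos : ∀ y, 0 < y → 0 < φ y)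
    (hψφ : ∀ y, 0 < y → ψ (φ y) = y) (hψ0 : ψ 0 = 0)
    (h : ∀ ρ, 0 < ρ → P.IsValuePos (ψ ρ) (K * f ρ)) {ρ : ℝ} (hρ : 0 ≤ ρ) :
    P.IsValue (ψ ρ) (K * f ρ) := by
  rcases hρ.eq_or_lt with rfl | hρ
  · refine Or.inr ⟨hψ0, fun y => K * f (φ y), fun y hy => ?_, ?_⟩
    · have := h (φ y) (hφpos y hy)
      rwa [hψφ y hy] at this
    · refine Tendsto.const_mul K ?_
      have h1 : Tendsto φ (𝓝[>] 0) (𝓝[Ici 0] 0) := by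
        refine tendsto_nhdsWithin_iff.2 ⟨?_, eventually_mem_nhdsWithin.mono fun y hy => (hφpos y hy).le⟩
        have := hφ.tendsto 0
        rw [hφ0] at this
        exact this.mono_left nhdsWithin_le_nhds
      exact (hf 0 self_mem_Ici).tendsto.comp h1
  · exact Or.inl (h ρ hρ)

theorem besselL_eq_fox (hd : 1 ≤ d) (hn : 0 < n) (hj : 0 ≤ j) (hjn : j ≤ n)
    (hlt : j / n + d / (2 * n) < 1) {ρ : ℝ} (hρ : 0 ≤ ρ) :
    ∃ w : ℂ, (besselLFox d j n).IsValue ((ρ / 2) ^ 2) w ∧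
      (besselL d j n ρ : ℂ) = ((1 / ((2 : ℝ) ^ ((d : ℝ) / 2) * n) : ℝ) : ℂ) * w := by
  refine ⟨((2 ^ ((d : ℝ) / 2) * n : ℝ) : ℂ) * besselL d j n ρ,
    isValue_of_continuousOn (f := fun ρ => (besselL d j n ρ : ℂ)) (φ := fun y => 2 * Real.sqrt y)
      (ψ := fun ρ => (ρ / 2) ^ 2)
      (Complex.continuous_ofReal.comp_continuousOn (continuousOn_besselL hd hn hj hlt))
      (by fun_prop) (by simp) (fun y hy => by positivity) (fun y hy => ?_) (by simp)
      (fun ρ hρ => besselLFox_isValuePos hd hn hj hjn hlt hρ) hρ, ?_⟩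
  · rw [mul_div_cancel_left₀ _ two_ne_zero, Real.sq_sqrt hy.le]
  · have h0 : (2 ^ ((d : ℝ) / 2) * n : ℝ) ≠ 0 := by positivity
    rw [← mul_assoc, ← Complex.ofReal_mul, one_div_mul_cancel h0, Complex.ofReal_one, one_mul]

end FoxMeijer

/-! ### The G-function for rational n. -/

section Meijer

variable {d : ℕ} {j n : ℝ}

/-- The multiplication theorem at y and at 1/M - y. The powers of M combine to 1/M and the two
constants to their square, which leaves (2π)^{M-1}. -/
theorem prod_Gamma_mul_prod_Gamma_one_sub {M : ℕ} (hM : M ≠ 0) {y : ℂ} (h0 : 0 < y.re)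
    (h1 : M * y.re < 1) :
    (∏ l ∈ Finset.range M, Complex.Gamma (y + l / M)) *
        ∏ l ∈ Finset.range M, Complex.Gamma (-y + (l + 1) / M) =
      (((2 * Real.pi) ^ (M - 1) : ℝ) : ℂ) * (Complex.Gamma (M * y) * Complex.Gamma (1 - M * y)) := by
  have hM' : (M : ℂ) ≠ 0 := by exact_mod_cast hM
  have hMr : (0 : ℝ) < M := by exact_mod_cast Nat.pos_of_ne_zero hM
  have h2 : 0 < (1 / (M : ℂ) - y).re := by
    rw [show 1 / (M : ℂ) = ((1 / M : ℝ) : ℂ) by push_cast; rfl, Complex.sub_re, Complex.ofReal_re,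
      sub_pos, lt_div_iff₀ hMr]
    linarith
  have e : ∏ l ∈ Finset.range M, Complex.Gamma (-y + (l + 1) / M) =
      ∏ l ∈ Finset.range M, Complex.Gamma ((1 / M - y) + l / M) :=
    Finset.prod_congr rfl fun l _ => by congr 1; ring
  rw [e, prod_Gamma_add_div hM h0, prod_Gamma_add_div hM h2,
    show (M : ℂ) * (1 / M - y) = 1 - M * y by field_simp]
  have h3 := gaussConst_sq hM
  have h4 : (M : ℂ) ^ (-(M * y)) * (M : ℂ) ^ (-(1 - M * y)) = 1 / M := by
    rw [← Complex.cpow_add _ _ hM', show -((M : ℂ) * y) + -(1 - M * y) = -1 by ring, Complex.cpow_neg_one,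
      one_div]
  calc _ = gaussConst M ^ 2 * ((M : ℂ) ^ (-(M * y)) * (M : ℂ) ^ (-(1 - M * y))) *
        (Complex.Gamma (M * y) * Complex.Gamma (1 - M * y)) := by ring
    _ = _ := by
      rw [h3, h4]
      push_cast
      field_simp

/-- The multiplication theorem in numerator and denominator; the constants cancel and only a power
of N remains. -/
theorem prod_Gamma_div_prod_Gamma {N : ℕ} (hN : N ≠ 0) {s w : ℂ} (hs : s.re < 0) (hw : 0 < (w + s).re) :
    (∏ h ∈ Finset.range N, Complex.Gamma (h / N - s)) /
        ∏ h ∈ Finset.range N, Complex.Gamma (w + h / N + s) =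
      (N : ℂ) ^ (2 * (N * s) + N * w) * (Complex.Gamma (-(N * s)) / Complex.Gamma (N * w + N * s)) := by
  have hN' : (N : ℂ) ≠ 0 := by exact_mod_cast hN
  have hNr : (0 : ℝ) < N := by exact_mod_cast Nat.pos_of_ne_zero hN
  have e1 : ∏ h ∈ Finset.range N, Complex.Gamma (h / N - s) =
      ∏ h ∈ Finset.range N, Complex.Gamma (-s + h / N) :=
    Finset.prod_congr rfl fun l _ => by congr 1; ring
  have e2 : ∏ h ∈ Finset.range N, Complex.Gamma (w + h / N + s) =
      ∏ h ∈ Finset.range N, Complex.Gamma ((w + s) + h / N) :=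
    Finset.prod_congr rfl fun l _ => by congr 1; ring
  rw [e1, e2, prod_Gamma_add_div hN (by simpa using hs), prod_Gamma_add_div hN hw]
  have hg : gaussConst N ≠ 0 := fun h => by
    have h3 := gaussConst_sq hN
    rw [h, zero_pow two_ne_zero] at h3
    have : (2 * Real.pi) ^ (N - 1) * N ≠ 0 := by have := Real.pi_pos; positivity
    exact this (by exact_mod_cast h3.symm)
  have h4 : (N : ℂ) ^ (2 * (N * s) + N * w) * (N : ℂ) ^ (-(N * (w + s))) = (N : ℂ) ^ (-(N * -s)) := by
    rw [← Complex.cpow_add _ _ hN']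
    congr 1
    ring
  have h5 : (N : ℂ) ^ (-(N * (w + s))) ≠ 0 := by simp [Complex.cpow_eq_zero_iff, hN]
  have h6 : Complex.Gamma (N * (w + s)) ≠ 0 := Complex.Gamma_ne_zero_of_re_pos (by
    have : ((N : ℂ) * (w + s)).re = N * (w + s).re := by rw [← Complex.ofReal_natCast, Complex.re_ofReal_mul]
    rw [this]
    positivity)
  rw [← h4, ← mul_add, show (N : ℂ) * -s = -(N * s) by ring]
  field_simp

/-- At s on the line Re s = -d/(8N) the product formulas reproduce the Fox integrand at N s, on the
line Re = -d/8. -/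
theorem besselLMeijer_integrand (hd : 1 ≤ d) {N M : ℕ} (hN : 0 < N) (hM : 0 < M)
    (hj : 0 ≤ j) (hn : n = (N : ℝ) / M) (hlt : j / n + d / (2 * n) < 1) {ρ : ℝ} (hρ : 0 < ρ) (t : ℝ) :
    (besselLMeijer d j N M).integrand ((ρ / (2 * N)) ^ (2 * N))
        (((-((d : ℝ) / 8) / N : ℝ) : ℂ) + t * Complex.I) =
      (((2 * Real.pi) ^ (M - 1) * (N : ℝ) ^ ((d : ℝ) / 2) : ℝ) : ℂ) *
        (Complex.exp (((((-((d : ℝ) / 8) : ℝ) : ℂ)) + ((N * t : ℝ) : ℂ) * Complex.I) *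
            (Real.log ((ρ / 2) ^ 2) : ℂ)) *
          barnesKernel d j n (((-((d : ℝ) / 8) : ℝ) : ℂ) + ((N * t : ℝ) : ℂ) * Complex.I)) := by
  have hd' : (1 : ℝ) ≤ d := by exact_mod_cast hd
  have hNr : (0 : ℝ) < N := by exact_mod_cast hN
  have hMr : (0 : ℝ) < M := by exact_mod_cast hM
  have hN' : (N : ℂ) ≠ 0 := by exact_mod_cast hN.ne'
  have hM' : (M : ℂ) ≠ 0 := by exact_mod_cast hM.ne'
  have hn0 : 0 < n := by rw [hn]; positivity
  have h1 := two_mul_add_dim_lt hn0 hlt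
  set s : ℂ := ((-((d : ℝ) / 8) / N : ℝ) : ℂ) + t * Complex.I with hs
  have hsre : s.re = -((d : ℝ) / 8) / N := by simp [hs]
  have hNs : (((-((d : ℝ) / 8) : ℝ) : ℂ)) + ((N * t : ℝ) : ℂ) * Complex.I = N * s := by
    rw [hs]
    push_cast
    field_simp
  set y : ℂ := (((2 * j + d) / (2 * N) : ℝ) : ℂ) + s with hy
  have hyre : y.re = (2 * j + d) / (2 * N) + -((d : ℝ) / 8) / N := by
    rw [hy, Complex.add_re, Complex.ofReal_re, hsre]
  have hy0 : 0 < y.re := by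
    rw [hyre, show (2 * j + d) / (2 * N) + -((d : ℝ) / 8) / N = (2 * j + d - d / 4) / (2 * N) by
      field_simp; ring]
    exact div_pos (by linarith) (by positivity)
  have hy1 : M * y.re < 1 := by
    rw [hyre, show M * ((2 * j + d) / (2 * N) + -((d : ℝ) / 8) / N) = (2 * j + d - d / 4) / (2 * n) by
      rw [hn]; field_simp; ring, div_lt_one (by positivity)]
    linarith
  have hMy : (M : ℂ) * y = (((2 * j + d) / (2 * n) : ℝ) : ℂ) + N * s / n := by
    rw [hy, hn]
    push_cast
    field_simp
  have hA := prod_Gamma_mul_prod_Gamma_one_sub hM.ne' hy0 hy1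
  have hB := prod_Gamma_div_prod_Gamma hN.ne' (s := s) (w := (((d : ℝ) / (2 * N) : ℝ) : ℂ))
    (by rw [hsre]; exact div_neg_of_neg_of_pos (by linarith) hNr) (by
      rw [Complex.add_re, Complex.ofReal_re, hsre, ← sub_neg_eq_add, ← neg_div, neg_neg,
        show (d : ℝ) / (2 * N) - (d : ℝ) / 8 / N = 3 * d / (8 * N) by field_simp; ring]
      positivity)
  rw [hNs, FoxParams.integrand, barnesKernel, ← hMy]
  have q1 : ((besselLMeijer d j N M).a.map fun p => Complex.Gamma (1 - p.1 + p.2 * s)).prod =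
      ∏ l ∈ Finset.range M, Complex.Gamma (y + l / M) := by
    simp only [besselLMeijer, FoxParams.meijer, List.map_ofFn, List.prod_ofFn]
    rw [← Fin.prod_univ_eq_prod_range (fun l => Complex.Gamma (y + l / M))]
    refine Finset.prod_congr rfl fun l _ => ?_
    simp only [Function.comp_apply, hy]
    congr 1
    push_cast
    ring
  have q2 : ((besselLMeijer d j N M).b.map fun p => Complex.Gamma (p.1 - p.2 * s)).prod =
      (∏ h ∈ Finset.range N, Complex.Gamma (h / N - s)) *
        ∏ l ∈ Finset.range M, Complex.Gamma (-y + (l + 1) / M) := by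
    simp only [besselLMeijer, FoxParams.meijer, List.map_append, List.map_ofFn, List.prod_append,
      List.prod_ofFn]
    rw [← Fin.prod_univ_eq_prod_range (fun l => Complex.Gamma (-y + (l + 1) / M)),
      ← Fin.prod_univ_eq_prod_range (fun h => Complex.Gamma (h / N - s))]
    congr 1
    · refine Finset.prod_congr rfl fun l _ => ?_
      simp only [Function.comp_apply]
      congr 1
      push_cast
      ring
    · refine Finset.prod_congr rfl fun l _ => ?_
      simp only [Function.comp_apply, hy]
      congr 1
      push_cast
      ring
  have q3 : ((besselLMeijer d j N M).bStar.map fun p => Complex.Gamma (1 - p.1 + p.2 * s)).prod =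
      ∏ h ∈ Finset.range N, Complex.Gamma ((((d : ℝ) / (2 * N) : ℝ) : ℂ) + h / N + s) := by
    simp only [besselLMeijer, FoxParams.meijer, List.map_ofFn, List.prod_ofFn]
    rw [← Fin.prod_univ_eq_prod_range (fun h => Complex.Gamma ((((d : ℝ) / (2 * N) : ℝ) : ℂ) + h / N + s))]
    refine Finset.prod_congr rfl fun l _ => ?_
    simp only [Function.comp_apply]
    congr 1
    push_cast
    ring
  have q4 : ((besselLMeijer d j N M).aStar.map fun p => Complex.Gamma (p.1 - p.2 * s)).prod = 1 := by
    simp [besselLMeijer, FoxParams.meijer]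
  rw [q1, q2, q3, q4, one_mul]
  -- The factor N^{2Ns} is absorbed by replacing ρ/2 with ρ/(2N) in the argument; the factor N^{d/2}
  -- survives.
  have hexp : Complex.exp (s * (Real.log ((ρ / (2 * N)) ^ (2 * N)) : ℂ)) *
      (N : ℂ) ^ (2 * (N * s) + N * (((d : ℝ) / (2 * N) : ℝ) : ℂ)) =
      Complex.exp (N * s * (Real.log ((ρ / 2) ^ 2) : ℂ)) * (((N : ℝ) ^ ((d : ℝ) / 2) : ℝ) : ℂ) := by
    rw [Complex.cpow_add _ _ hN', ← mul_assoc, Complex.cpow_def_of_ne_zero hN', ← Complex.exp_add]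
    congr 1
    · rw [Real.log_pow, Real.log_pow, Real.log_div hρ.ne' (by positivity),
        Real.log_mul two_ne_zero hNr.ne', Real.log_div hρ.ne' two_ne_zero,
        show Complex.log (N : ℂ) = ((Real.log N : ℝ) : ℂ) by
          rw [Complex.ofReal_log hNr.le, Complex.ofReal_natCast]]
      congr 1
      push_cast
      ring
    · rw [Complex.ofReal_cpow hNr.le]
      push_cast
      congr 1
      field_simp
  have hw : (N : ℂ) * (((d : ℝ) / (2 * N) : ℝ) : ℂ) = d / 2 := by
    push_cast
    field_simp
  calc _ = Complex.exp (s * (Real.log ((ρ / (2 * N)) ^ (2 * N)) : ℂ)) *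
        ((∏ l ∈ Finset.range M, Complex.Gamma (y + l / M)) *
          ∏ l ∈ Finset.range M, Complex.Gamma (-y + (l + 1) / M)) *
        ((∏ h ∈ Finset.range N, Complex.Gamma (h / N - s)) /
          ∏ h ∈ Finset.range N, Complex.Gamma ((((d : ℝ) / (2 * N) : ℝ) : ℂ) + h / N + s)) := by ring
    _ = (Complex.exp (s * (Real.log ((ρ / (2 * N)) ^ (2 * N)) : ℂ)) *
        (N : ℂ) ^ (2 * (N * s) + N * (((d : ℝ) / (2 * N) : ℝ) : ℂ))) *
        ((((2 * Real.pi) ^ (M - 1) : ℝ) : ℂ) * (Complex.Gamma (M * y) * Complex.Gamma (1 - M * y))) *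
        (Complex.Gamma (-(N * s)) / Complex.Gamma (N * (((d : ℝ) / (2 * N) : ℝ) : ℂ) + N * s)) := by
      rw [hA, hB]
      ring
    _ = _ := by
      rw [hexp, hw, Complex.ofReal_mul]
      ring

/-- The extra division by N is the Jacobian of s → N s. -/
theorem besselLMeijer_isValuePos (hd : 1 ≤ d) {N M : ℕ} (hN : 0 < N) (hM : 0 < M)
    (hj : 0 ≤ j) (hjn : j ≤ n) (hn : n = (N : ℝ) / M) (hlt : j / n + d / (2 * n) < 1) {ρ : ℝ}
    (hρ : 0 < ρ) :
    (besselLMeijer d j N M).IsValuePos ((ρ / (2 * N)) ^ (2 * N))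
      ((((2 * Real.pi) ^ (M - 1) * (N : ℝ) ^ ((d : ℝ) / 2) / N * (2 ^ ((d : ℝ) / 2) * n) : ℝ) : ℂ) *
        besselL d j n ρ) := by
  have hd' : (1 : ℝ) ≤ d := by exact_mod_cast hd
  have hNr : (0 : ℝ) < N := by exact_mod_cast hN
  have hMr : (0 : ℝ) < M := by exact_mod_cast hM
  have hn0 : 0 < n := by rw [hn]; positivity
  have h1 := two_mul_add_dim_lt hn0 hlt
  have h1' : (2 * j + d) * M < 2 * N := by
    rw [hn, ← mul_div_assoc, lt_div_iff₀ hMr] at h1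
    exact h1
  obtain ⟨hi, hL⟩ := besselL_eq_barnes hd hn0 hj hjn hlt hρ
  set E : ℝ → ℂ := fun t : ℝ =>
      Complex.exp (((((-((d : ℝ) / 8) : ℝ) : ℂ)) + t * Complex.I) * (Real.log ((ρ / 2) ^ 2) : ℂ)) *
        barnesKernel d j n (((-((d : ℝ) / 8) : ℝ) : ℂ) + t * Complex.I) with hE
  set κ : ℝ := (2 * Real.pi) ^ (M - 1) * (N : ℝ) ^ ((d : ℝ) / 2) with hκ
  have hv : ((κ / N * (2 ^ ((d : ℝ) / 2) * n) : ℝ) : ℂ) * besselL d j n ρ =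
      1 / (2 * Real.pi) * ∫ t : ℝ, (κ : ℂ) * E (N * t) := by
    have h0 : (2 ^ ((d : ℝ) / 2) * n : ℝ) ≠ 0 := by positivity
    have h2 : ∫ t : ℝ, E (N * t) = ((1 / N : ℝ) : ℂ) * ∫ t, E t := by
      rw [Measure.integral_comp_mul_left E, abs_of_pos (by positivity), ← one_div, Complex.real_smul]
    rw [integral_const_mul, h2, hL, Complex.ofReal_mul, mul_assoc, ← mul_assoc (((2 ^ ((d : ℝ) / 2) * n : ℝ)) : ℂ),
      ← Complex.ofReal_mul, mul_one_div_cancel h0]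
    push_cast
    ring
  rw [hv]
  refine isValuePos_vertical_line (c := -((d : ℝ) / 8) / N) (by positivity) ?_ ?_ ?_ ?_
    (fun t => besselLMeijer_integrand hd hN hM hj hn hlt hρ t)
    ((hi.comp_mul_left' hNr.ne').const_mul _)
  · intro p hp
    simp only [besselLMeijer, FoxParams.meijer, List.mem_append, List.mem_map] at hp
    have : p.2 = 1 := by
      rcases hp with ((⟨x, _, rfl⟩ | ⟨x, _, rfl⟩) | ⟨x, _, rfl⟩) | ⟨x, _, rfl⟩ <;> rfl
    rw [this]
    exact one_pos
  -- The count of Gamma factors is M + (N + M) - N.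
  · have e : (besselLMeijer d j N M).alpha = 2 * M := by
      simp [FoxParams.alpha, besselLMeijer, FoxParams.meijer, Function.comp_def, List.ofFn_const]
      ring
    rw [e]
    positivity
  · rintro σ ⟨p, hp, k, rfl⟩
    simp only [besselLMeijer, FoxParams.meijer, List.mem_map, List.mem_ofFn] at hp
    obtain ⟨_, ⟨l, rfl⟩, rfl⟩ := hp
    refine ⟨-((2 * j + d) / (2 * N)) - (l : ℕ) / M - k, ?_, ?_⟩
    · push_cast
      ring
    · have h3 : -((2 * j + d) / (2 * N)) < -((d : ℝ) / 8) / N := by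
        rw [neg_div, neg_lt_neg_iff, div_div, div_lt_div_iff₀ (by positivity) (by positivity)]
        nlinarith
      have h4 : (0 : ℝ) ≤ (l : ℕ) / M := by positivity
      have h5 : (0 : ℝ) ≤ k := by positivity
      linarith
  · rintro σ ⟨p, hp, k, rfl⟩
    have hc : -((d : ℝ) / 8) / N < 0 := div_neg_of_neg_of_pos (by linarith) hNr
    have h5 : (0 : ℝ) ≤ k := by positivity
    simp only [besselLMeijer, FoxParams.meijer, List.mem_map, List.mem_append, List.mem_ofFn] at hp
    obtain ⟨_, ⟨l, rfl⟩ | ⟨l, rfl⟩, rfl⟩ := hp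
    · refine ⟨(l : ℕ) / N + k, ?_, ?_⟩
      · push_cast
        ring
      · have h4 : (0 : ℝ) ≤ (l : ℕ) / N := by positivity
        linarith
    · refine ⟨-((2 * j + d) / (2 * N)) + ((l : ℕ) + 1) / M + k, ?_, ?_⟩
      · push_cast
        ring
      · have h3 : (2 * j + d) / (2 * N) < 1 / M := by
          rw [div_lt_div_iff₀ (by positivity) hMr]
          linarith
        have h4 : (0 : ℝ) ≤ (l : ℕ) / M := by positivity
        rw [add_div ((l : ℕ) : ℝ)]
        linarith

theorem besselL_eq_meijer (hd : 1 ≤ d) {N M : ℕ} (hN : 0 < N) (hM : 0 < M)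
    (hj : 0 ≤ j) (hjn : j ≤ n) (hn : n = (N : ℝ) / M) (hlt : j / n + d / (2 * n) < 1) {ρ : ℝ}
    (hρ : 0 ≤ ρ) :
    ∃ w : ℂ, (besselLMeijer d j N M).IsValue ((ρ / (2 * N)) ^ (2 * N)) w ∧
        (besselL d j n ρ : ℂ) =
          ((M / ((2 : ℝ) ^ ((d : ℝ) / 2 + M - 1) * Real.pi ^ ((M : ℝ) - 1)
            * (N : ℝ) ^ ((d : ℝ) / 2)) : ℝ) : ℂ) * w := by
  have hNr : (0 : ℝ) < N := by exact_mod_cast hN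
  have hMr : (0 : ℝ) < M := by exact_mod_cast hM
  have hn0 : 0 < n := by rw [hn]; positivity
  have hpi := Real.pi_pos
  refine ⟨_, isValue_of_continuousOn (f := fun ρ => (besselL d j n ρ : ℂ))
      (φ := fun y => 2 * N * y ^ (1 / (2 * N : ℝ))) (ψ := fun ρ => (ρ / (2 * N)) ^ (2 * N))
      (Complex.continuous_ofReal.comp_continuousOn (continuousOn_besselL hd hn0 hj hlt))
      (continuous_const.mul (continuous_id.rpow_const fun _ => Or.inr (by positivity)))
      (by rw [Real.zero_rpow (by positivity), mul_zero]) (fun y hy => by positivity) (fun y hy => ?_)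
      (by simp [hN.ne'])
      (fun ρ hρ => besselLMeijer_isValuePos hd hN hM hj hjn hn hlt hρ) hρ, ?_⟩
  · rw [mul_div_cancel_left₀ _ (by positivity), ← Real.rpow_mul_natCast hy.le]
    push_cast
    rw [one_div_mul_cancel (by positivity), Real.rpow_one]
  · have h2 : (2 : ℝ) ^ ((d : ℝ) / 2 + M - 1) = 2 ^ ((d : ℝ) / 2) * 2 ^ (M - 1) := by
      rw [add_sub_assoc, Real.rpow_add zero_lt_two, ← Real.rpow_natCast 2 (M - 1), Nat.cast_sub hM,
        Nat.cast_one]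
    have h3 : Real.pi ^ ((M : ℝ) - 1) = Real.pi ^ (M - 1) := by
      rw [← Real.rpow_natCast, Nat.cast_sub hM, Nat.cast_one]
    have h4 : M / ((2 : ℝ) ^ ((d : ℝ) / 2 + M - 1) * Real.pi ^ ((M : ℝ) - 1) * (N : ℝ) ^ ((d : ℝ) / 2)) *
        ((2 * Real.pi) ^ (M - 1) * (N : ℝ) ^ ((d : ℝ) / 2) / N * (2 ^ ((d : ℝ) / 2) * n)) = 1 := by
      rw [h2, h3, mul_pow, hn]
      field_simp
    rw [← mul_assoc, ← Complex.ofReal_mul, h4, Complex.ofReal_one, one_mul]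

end Meijer

/-! ### Assembly of the statements. -/

theorem proposition5p16 (d : ℕ) (hd : 1 ≤ d) (j n θ : ℝ) (hn : 0 < n) (hj : 0 ≤ j) (hjn : j ≤ n)
    (hθ₁ : j / n ≤ θ) (hθ₂ : θ ≤ j / n + d / (2 * n)) (hlt : j / n + d / (2 * n) < 1) :
    -- the Sobolev inequality holds, and its sharp constant has the lower bound
    (sobolevConstants d j n θ).Nonempty ∧
    sobolevLower d j n θ ≤ sharpSobolev d j n θ ∧
    -- the integrals defining `L_{jn}` and `I` converge, and `L_{jn}` is continuous
    (∀ ρ : ℝ, 0 < ρ → IntegrableOn (fun ξ : ℝ =>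
      besselJ ((d : ℝ) / 2 - 1) (ρ * ξ) / (ρ * ξ) ^ ((d : ℝ) / 2 - 1)
        * (ξ ^ ((d : ℝ) + 2 * j - 1) / (1 + ξ ^ (2 * n)))) (Ioi 0)) ∧
    (θ ≠ j / n + d / (2 * n) → IntegrableOn (fun ρ : ℝ =>
      ρ ^ ((d : ℝ) - 1) * |besselL d j n ρ| ^ (sobolevExponent d j n θ).toReal) (Ioi 0)) ∧
    ContinuousOn (besselL d j n) (Ici 0) ∧
    -- `L_{jn}` as an `H`-function and, for rational `n`, as a `G`-function
    (∀ ρ : ℝ, 0 ≤ ρ → ∃ w : ℂ, (besselLFox d j n).IsValue ((ρ / 2) ^ 2) w ∧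
      (besselL d j n ρ : ℂ) = ((1 / ((2 : ℝ) ^ ((d : ℝ) / 2) * n) : ℝ) : ℂ) * w) ∧
    (∀ N M : ℕ, 0 < N → 0 < M → n = (N : ℝ) / M →
      ∀ ρ : ℝ, 0 ≤ ρ → ∃ w : ℂ,
        (besselLMeijer d j N M).IsValue ((ρ / (2 * N)) ^ (2 * N)) w ∧
        (besselL d j n ρ : ℂ) =
          ((M / ((2 : ℝ) ^ ((d : ℝ) / 2 + M - 1) * Real.pi ^ ((M : ℝ) - 1)
            * (N : ℝ) ^ ((d : ℝ) / 2)) : ℝ) : ℂ) * w) ∧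
    -- the cases of equality
    (θ = 0 → j = 0 ∧ sobolevExponent d j n θ = 2 ∧
      sharpSobolev d j n θ = sobolevLower d j n θ ∧ sharpSobolev d j n θ = 1) ∧
    (θ = j / n + d / (2 * n) →
      sharpSobolev d j n θ = sobolevLower d j n θ ∧
      sharpSobolev d j n θ =
        1 / ((2 : ℝ) ^ ((d : ℝ) / 2) * Real.pi ^ ((d : ℝ) / 4 - 1 / 2)
          * Real.sqrt (Real.Gamma ((d : ℝ) / 2) * n * Real.sin (Real.pi * θ)))) := by
  refine ⟨sobolevConstants_nonempty hd hn hj hjn hθ₁ hlt,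
    sobolevLower_le_sharpSobolev hd hn hj hjn hθ₁ hθ₂ hlt,
    fun ρ hρ => integrableOn_besselL_integrand hd hn hj hlt hρ,
    fun hθ => integrableOn_besselL_rpow hd hn hj hjn hθ₁ hθ₂ hlt hθ,
    continuousOn_besselL hd hn hj hlt,
    fun ρ hρ => besselL_eq_fox hd hn hj hjn hlt hρ,
    fun N M hN hM hNM ρ hρ => besselL_eq_meijer hd hN hM hj hjn hNM hlt hρ,
    fun hθ => ⟨(sobolevExponent_zero (d := d) hn hj hθ₁ hθ).1, (sobolevExponent_zero hn hj hθ₁ hθ).2,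
      sharpSobolev_of_theta_eq_zero hd hn hj hjn hθ₁ hθ₂ hlt hθ⟩,
    fun hθ => sharpSobolev_of_theta_eq hd hn hj hjn hθ₁ hθ₂ hlt hθ⟩
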